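/- Let $g\colon\mathbb{N}\to\mathbb{C}$ be a multiplicative function (with $g(1)=1$; here $\mathbb{N}=\{1,2,\dots\}$) satisfying the Siegel--Walfisz assumption, that is: (i) for some $C\ge 0$ we have $|g(n)|\le d(n)^C$ for all $n\in\mathbb{N}$, where $d(n)$ is the number of positive divisors of $n$; (ii) for every $A>0$ there is a constant $K_A$ such that for all real $N\ge 3$ $$\max_{1\le a\le q\le (\log N)^A}\Bigl|\sum_{\substack{n\le N\\ n\equiv a \,(\mathrm{mod}\, q)}} g(n)\Bigr|\le K_A\frac{N}{(\log N)^A}.$$ For real $N\ge 1$ write $[N]=\{n\in\mathbb{N}: n\le N\}$, let $\mathbb{E}_{n\le N}$ denote the average over $n\in[N]$, and for $k\in\mathbb{N}$ and $f\colon\mathbb{N}\to\mathbb{C}$ let $$\|f\|_{u^k[N]}=\sup_{\substack{P\in\mathbb{R}[y]\\ \deg P\le k-1}}\bigl|\mathbb{E}_{n\le N}f(n)e^{-2\pi i P(n)}\bigr|.$$ Then there are functions $g_1,g_2\colon\mathbb{N}\to\mathbb{C}$ with $g=g_1+g_2$ and $|g_1|,|g_2|\le |g|$ pointwise such that: 1.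 for every $k\in\mathbb{N}$ and every $A>0$ there is a constant $K$ (depending on $g,k,A$) such that $\|g_1\|_{u^k[N]}\le K(\log N)^{-A}$ for all real $N\ge 3$; 2. there is a function $c$ with $c(N)\to 0$ as $N\to\infty$ such that for every real $r\ge 1$ there is a constant $K$ (depending on $g,r$) with $\mathbb{E}_{n\le N}|g_2(n)|^r\le K(\log N)^{-1+c(N)}$ for all real $N\ge 3$. -/

import Mathlib

open scoped BigOperators

/-- The discrete interval `[N] = {n ∈ ℕ : 1 ≤ n ≤ N}` for a real number `N`. -/
noncomputable def natInterval (N : ℝ) : Finset ℕ := Finset.Icc 1 ⌊N⌋₊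

/-- The additive character `e(x) = exp(2πix)`. -/
noncomputable def phase (x : ℝ) : ℂ := Complex.exp (2 * Real.pi * Complex.I * x)

/-- The average `𝔼_{n ∈ [N]} f(n) e(-P(n))`. -/
noncomputable def polyCorrelation (f : ℕ → ℂ) (N : ℝ) (P : Polynomial ℝ) : ℂ :=
  𝔼 n ∈ natInterval N, f n * phase (-(P.eval (n : ℝ)))

/-- The `u^s[N]` norm: the largest correlation of `f` on `[N]` with a phase `e(P)`, where `P`
runs over the real polynomials of degree at most `s - 1` (that is, of degree `< s`).
The supremum is over a nonempty bounded set, see `bddAbove_polyCorrelation`. -/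
noncomputable def uNorm (s : ℕ) (N : ℝ) (f : ℕ → ℂ) : ℝ :=
  ⨆ P : {P : Polynomial ℝ // P.degree < (s : WithBot ℕ)}, ‖polyCorrelation f N P.1‖

theorem norm_phase (x : ℝ) : ‖phase x‖ = 1 := by
  have h : (2 * Real.pi * Complex.I * x : ℂ) = ((2 * Real.pi * x : ℝ) : ℂ) * Complex.I := by
    push_cast
    ring
  rw [phase, h, Complex.norm_exp_ofReal_mul_I]

theorem norm_polyCorrelation_le (f : ℕ → ℂ) (N : ℝ) (P : Polynomial ℝ) :
    ‖polyCorrelation f N P‖ ≤ 𝔼 n ∈ natInterval N, ‖f n‖ := by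
  unfold polyCorrelation
  rw [Finset.expect_eq_sum_div_card, Finset.expect_eq_sum_div_card, norm_div, Complex.norm_natCast]
  gcongr
  refine (norm_sum_le _ _).trans (le_of_eq (Finset.sum_congr rfl fun n _ => ?_))
  rw [norm_mul, norm_phase, mul_one]

theorem bddAbove_polyCorrelation (s : ℕ) (N : ℝ) (f : ℕ → ℂ) :
    BddAbove (Set.range fun P : {P : Polynomial ℝ // P.degree < (s : WithBot ℕ)} =>
      ‖polyCorrelation f N P.1‖) :=
  ⟨_, by rintro _ ⟨P, rfl⟩; exact norm_polyCorrelation_le f N P.1⟩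

/-- The Siegel–Walfisz assumption on a function on the positive integers. -/
structure SiegelWalfisz (g : ℕ → ℂ) : Prop where
  /-- `g` is divisor-bounded: `|g(n)| ≤ d(n)^C` for some `C ≥ 0` and all `n ≥ 1`. -/
  divisorBounded : ∃ C : ℝ, 0 ≤ C ∧ ∀ n : ℕ, 1 ≤ n → ‖g n‖ ≤ (n.divisors.card : ℝ) ^ C
  /-- For all `A > 0`, uniformly for `N ≥ 3` and `1 ≤ a ≤ q ≤ (log N)^A`, the sum of `g` over
  `n ≤ N`, `n ≡ a (mod q)` is `O_A(N / (log N)^A)`. -/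
  equidistributed : ∀ A : ℝ, 0 < A → ∃ K : ℝ, ∀ N : ℝ, 3 ≤ N → ∀ a q : ℕ,
    1 ≤ a → a ≤ q → (q : ℝ) ≤ Real.log N ^ A →
      ‖∑ n ∈ natInterval N with n ≡ a [MOD q], g n‖ ≤ K * (N / Real.log N ^ A)

/-! Write τ for the number of divisors and L = 2^j on the block 2^(2^j) ≤ n < 2^(2^(j+1)), where log
n has size L. On this block g₁ keeps g(n) when n has a prime factor in the window 2^(j²) < p ≤
2^(2^j/(j²+1)) (`windowPart`), and g₂ keeps it otherwise (`sievedPart`). The lower end of the window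
beats every power of L and the upper end is a tiny power of the block size, yet the primes of the
block's range outside the window contribute only O(log j) to ∑ 1/p.

g₂ is small by a sieve. Moments of τ over a factor-closed set are controlled by the harmonic sum
over that set (`sum_divisor_pow_sieved_le`), and an Euler product bounds this harmonic sum by a
power of j. The r-th moment of g₂ is thus at most j^O(1)/L. The power of j depends on r, but c(N) =
1/√(log log N) majorises all such powers at once.

g₁ is treated by induction on the degree of the phase (`windowPart_polynomial_progression`), with
losses of powers of L allowed throughout.

Minor arcs: Ramaré's identity turns the sum into bilinear sums over window primes and cofactors m.
If one of them is large, `typeII_inverse` applies: Cauchy–Schwarz removes the coefficients in m,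
`weyl_inverse` puts (n^(k+1) - n'^(k+1))α near a rational of small denominator for many n, and
`polynomial_recurrence_inverse` deduces the same for the leading coefficient α itself.

Major arcs: splitting into classes modulo the denominator and summing by parts strips off the
leading term (`norm_sum_major_arc_le`), which lowers the degree.

Degree zero: Legendre's identity expands `sievedPart` as ∑ μ(d) g(d) g(n/d). For d ≤ √N the
Siegel–Walfisz assumption applies to the sum over n/d, and a larger d has so many prime factors that
moments of τ make it negligible. Both identities are exact away from multiples of p² with p in the
window, and these are negligible because p > 2^(j²).

Finally `norm_sum_blockIndex_le` glues the blocks: only the last two matter, the earlier ones lying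
below √N. -/

/-! ### Distance to the nearest integer and Vinogradov's lemma -/

/-- The distance from a real number to the nearest integer. -/
noncomputable def distInt (x : ℝ) : ℝ := ‖(x : UnitAddCircle)‖

theorem distInt_eq (x : ℝ) : distInt x = |x - round x| := UnitAddCircle.norm_eq

theorem distInt_nonneg (x : ℝ) : 0 ≤ distInt x := norm_nonneg _

theorem distInt_le_half (x : ℝ) : distInt x ≤ 1 / 2 := by
  rw [distInt_eq]; exact abs_sub_round x

theorem distInt_sub_le (x y : ℝ) : distInt (x - y) ≤ distInt x + distInt y := by
  unfold distInt
  rw [AddCircle.coe_sub]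
  exact norm_sub_le _ _

theorem distInt_add_int (x : ℝ) (n : ℤ) : distInt (x + n) = distInt x := by
  rw [distInt_eq, distInt_eq, round_add_intCast]
  push_cast
  congr 1; ring

theorem distInt_eq_abs {x : ℝ} (h : |x| ≤ 1 / 2) : distInt x = |x| := by
  unfold distInt
  exact (AddCircle.norm_coe_eq_abs_iff 1 one_ne_zero).2 (by simpa using h)

theorem card_le_of_abs_sub_le (U : Finset ℕ) {c : ℝ} (hc : 0 ≤ c)
    (h : ∀ s ∈ U, ∀ t ∈ U, |(s : ℝ) - t| ≤ c) : (U.card : ℝ) ≤ c + 1 := by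
  rcases U.eq_empty_or_nonempty with rfl | hne
  · simp; linarith
  have hsub : U ⊆ Finset.Icc (U.min' hne) (U.max' hne) := fun x hx =>
    Finset.mem_Icc.2 ⟨U.min'_le x hx, U.le_max' x hx⟩
  have h1 := Finset.card_le_card hsub
  rw [Nat.card_Icc] at h1
  have h2 := h _ (U.max'_mem hne) _ (U.min'_mem hne)
  have h3 : U.min' hne ≤ U.max' hne := U.min'_le _ (U.max'_mem hne)
  have h4 : (U.card : ℝ) + U.min' hne ≤ U.max' hne + 1 := by
    have : U.card + U.min' hne ≤ U.max' hne + 1 := by omega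
    exact_mod_cast this
  linarith [le_abs_self ((U.max' hne : ℝ) - U.min' hne)]

/-- Vinogradov's lemma: if `‖xθ‖ ≤ ε` for a positive proportion of `x ∈ [H]`, then `θ` is close to
a rational with small denominator. -/
theorem exists_denominator_of_many_close {θ ε δ : ℝ} {H : ℕ} (hδ : 0 < δ) (hεδ : 32 * ε ≤ δ)
    (hH : 0 < H) (S : Finset ℕ) (hS : S ⊆ Finset.Icc 1 H) (hcard : δ * H ≤ S.card)
    (hθ : ∀ x ∈ S, distInt (x * θ) ≤ ε) :
    ∃ q : ℕ, 1 ≤ q ∧ q * δ ≤ 2 ∧ distInt (q * θ) * (δ * H) ≤ 8 * ε * q := by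
  have hH' : (0 : ℝ) < H := by exact_mod_cast hH
  have hpos : (0 : ℝ) < S.card := lt_of_lt_of_le (by positivity) hcard
  have hne : S.Nonempty := Finset.card_pos.1 (by exact_mod_cast hpos)
  obtain ⟨x₀, hx₀⟩ := hne
  have hε : 0 ≤ ε := (distInt_nonneg _).trans (hθ x₀ hx₀)
  have hex : ∃ q : ℕ, 1 ≤ q ∧ distInt (q * θ) ≤ 2 * ε :=
    ⟨x₀, (Finset.mem_Icc.1 (hS hx₀)).1, (hθ x₀ hx₀).trans (by linarith)⟩
  classical
  -- Differences of elements of S satisfy the tolerance 2ε as well, so minimality of q makes S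
  -- q-separated; this gives q ≤ 2/δ.
  set q := Nat.find hex with hq
  obtain ⟨hq1, hq2⟩ := Nat.find_spec hex
  rw [← hq] at hq1 hq2
  have hqmin : ∀ m : ℕ, 1 ≤ m → distInt (m * θ) ≤ 2 * ε → q ≤ m := fun m h1 h2 =>
    Nat.find_min' hex ⟨h1, h2⟩
  have hqH : q ≤ H := (hqmin x₀ (Finset.mem_Icc.1 (hS hx₀)).1
    ((hθ x₀ hx₀).trans (by linarith))).trans (Finset.mem_Icc.1 (hS hx₀)).2
  have hq0 : (0 : ℝ) < q := by exact_mod_cast hq1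
  have hdiff : ∀ x ∈ S, ∀ y ∈ S, distInt (((x : ℝ) - y) * θ) ≤ 2 * ε := fun x hx y hy => by
    rw [sub_mul]
    exact (distInt_sub_le _ _).trans (by linarith [hθ x hx, hθ y hy])
  have hgap : ∀ x ∈ S, ∀ y ∈ S, x < y → q ≤ y - x := fun x hx y hy hxy => by
    refine hqmin _ (by omega) ?_
    rw [Nat.cast_sub hxy.le]
    exact hdiff y hy x hx
  have hinj : Set.InjOn (fun x => (x - 1) / q) S := by
    intro x hx y hy hxy
    simp only at hxy
    by_contra hne
    have aux : ∀ x ∈ S, ∀ y ∈ S, (x - 1) / q = (y - 1) / q → ¬ x < y := by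
      intro x hx y hy hxy hlt
      have h1 := hgap x hx y hy hlt
      have h2 := (Finset.mem_Icc.1 (hS hx)).1
      have h3 : (x - 1) / q + 1 ≤ (y - 1) / q := by
        rw [← Nat.add_div_right _ (by omega)]
        exact Nat.div_le_div_right (by omega)
      omega
    rcases lt_or_gt_of_ne hne with h | h
    · exact aux x hx y hy hxy h
    · exact aux y hy x hx hxy.symm h
  have hcardq : S.card ≤ (H - 1) / q + 1 := by
    rw [← Finset.card_image_of_injOn hinj, ← Finset.card_range ((H - 1) / q + 1)]
    refine Finset.card_le_card fun z hz => ?_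
    obtain ⟨x, hx, rfl⟩ := Finset.mem_image.1 hz
    have := (Finset.mem_Icc.1 (hS hx)).2
    exact Finset.mem_range.2 (Nat.lt_succ_of_le (Nat.div_le_div_right (by omega)))
  have hqδ : q * δ ≤ 2 := by
    have h1 : S.card * q ≤ 2 * H := by
      have := Nat.div_mul_le_self (H - 1) q
      calc S.card * q ≤ ((H - 1) / q + 1) * q := Nat.mul_le_mul_right _ hcardq
        _ = (H - 1) / q * q + q := by ring
        _ ≤ 2 * H := by omega
    have h2 : (S.card : ℝ) * q ≤ 2 * H := by exact_mod_cast h1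
    have h3 : δ * H * q ≤ 2 * H := (mul_le_mul_of_nonneg_right hcard hq0.le).trans h2
    nlinarith
  refine ⟨q, hq1, hqδ, ?_⟩
  set β : ℝ := q * θ - round (q * θ) with hβ
  have hβ1 : distInt (q * θ) = |β| := distInt_eq _
  rw [hβ1]
  rw [hβ1] at hq2
  have hβhalf : |β| ≤ 1 / 2 := abs_sub_round _
  rcases (abs_nonneg β).eq_or_lt with h0 | hβpos
  · rw [← h0]; simp; positivity
  -- Over at most T steps of length q the multiples of β stay within 1/2 of 0, so the distance to
  -- the integers is linear there, without wrap-around.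
  set T : ℕ := ⌊1 / (2 * |β|)⌋₊ with hT
  have hT1 : 1 ≤ T := by
    rw [hT, Nat.one_le_floor_iff, le_div_iff₀ (by positivity)]; linarith
  have hTβ : T * |β| ≤ 1 / 2 := by
    have := Nat.floor_le (show 0 ≤ 1 / (2 * |β|) by positivity)
    calc T * |β| ≤ 1 / (2 * |β|) * |β| := mul_le_mul_of_nonneg_right this hβpos.le
      _ = 1 / 2 := by field_simp
  have hTβ' : 1 ≤ 4 * |β| * T := by
    have h1 := Nat.lt_floor_add_one (1 / (2 * |β|))
    rw [← hT] at h1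
    have h2 : (1 : ℝ) ≤ T := by exact_mod_cast hT1
    rw [div_lt_iff₀ (by positivity)] at h1
    nlinarith
  -- The cells are residue classes mod q cut into runs of length T; points of S in one cell are at
  -- most 2ε/|β| steps apart.
  set f : ℕ → ℕ × ℕ := fun x => (x % q, x / q / T) with hf
  have hfib : ∀ b ∈ S.image f, (S.filter (fun x => f x = b)).card ≤ ⌊2 * ε / |β| + 1⌋₊ := by
    intro b _
    have hinj' : Set.InjOn (fun x => x / q) (S.filter (fun x => f x = b)) := by
      intro x hx y hy hxy
      simp only [Finset.coe_filter, Set.mem_ofPred_eq, hf] at hx hy hxy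
      have h1 : x % q = y % q := by rw [← hy.2] at hx; exact (Prod.ext_iff.1 hx.2).1
      rw [← Nat.div_add_mod x q, ← Nat.div_add_mod y q, h1, hxy]
    rw [← Finset.card_image_of_injOn hinj']
    refine Nat.le_floor (card_le_of_abs_sub_le _ (by positivity) ?_)
    intro s hs t ht
    obtain ⟨x, hx, rfl⟩ := Finset.mem_image.1 hs
    obtain ⟨y, hy, rfl⟩ := Finset.mem_image.1 ht
    rw [Finset.mem_filter] at hx hy
    have hxy : f x = f y := hx.2.trans hy.2.symm
    have hmod : x % q = y % q := (Prod.ext_iff.1 hxy).1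
    have hdiv : x / q / T = y / q / T := (Prod.ext_iff.1 hxy).2
    have hlt : |((x / q : ℕ) : ℝ) - ((y / q : ℕ) : ℝ)| ≤ T := by
      have h1 := Nat.div_add_mod (x / q) T
      have h2 := Nat.div_add_mod (y / q) T
      have h3 := Nat.mod_lt (x / q) hT1
      have h4 := Nat.mod_lt (y / q) hT1
      rw [hdiv] at h1
      rw [abs_le]
      constructor
      · have : y / q ≤ x / q + T := by omega
        have : ((y / q : ℕ) : ℝ) ≤ (x / q : ℕ) + T := by exact_mod_cast this
        linarith
      · have : x / q ≤ y / q + T := by omega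
        have : ((x / q : ℕ) : ℝ) ≤ (y / q : ℕ) + T := by exact_mod_cast this
        linarith
    have hd := hdiff x hx.1 y hy.1
    have hx' : (x : ℝ) = q * (x / q : ℕ) + (x % q : ℕ) := by exact_mod_cast (Nat.div_add_mod x q).symm
    have hy' : (y : ℝ) = q * (y / q : ℕ) + (y % q : ℕ) := by exact_mod_cast (Nat.div_add_mod y q).symm
    have heq : ((x : ℝ) - y) * θ = (((x / q : ℕ) : ℝ) - (y / q : ℕ)) * β +
        (((((x / q : ℕ) : ℤ) - ((y / q : ℕ) : ℤ)) * round (q * θ) : ℤ) : ℝ) := by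
      rw [hx', hy', hmod, hβ]
      simp only [Int.cast_mul, Int.cast_sub, Int.cast_natCast]
      ring
    rw [heq, distInt_add_int, distInt_eq_abs, abs_mul] at hd
    · rwa [le_div_iff₀ hβpos]
    · rw [abs_mul]
      exact (mul_le_mul_of_nonneg_right hlt hβpos.le).trans hTβ
  have himg : S.image f ⊆ Finset.range q ×ˢ Finset.range (H / q / T + 1) := by
    intro b hb
    obtain ⟨x, hx, rfl⟩ := Finset.mem_image.1 hb
    have := (Finset.mem_Icc.1 (hS hx)).2
    simp only [hf, Finset.mem_product, Finset.mem_range]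
    exact ⟨Nat.mod_lt _ hq1, Nat.lt_succ_of_le
      (Nat.div_le_div_right (Nat.div_le_div_right this))⟩
  have hcount : S.card ≤ ⌊2 * ε / |β| + 1⌋₊ * (q * (H / q / T + 1)) := by
    refine (Finset.card_le_mul_card_image S _ hfib).trans (Nat.mul_le_mul_left _ ?_)
    refine (Finset.card_le_card himg).trans (le_of_eq ?_)
    simp
  have h1 : (S.card : ℝ) ≤ (2 * ε / |β| + 1) * (q * (H / q * (4 * |β|) + 1)) := by
    have hc : (S.card : ℝ) ≤ (⌊2 * ε / |β| + 1⌋₊ : ℝ) * (q * ((H / q / T : ℕ) + 1)) := by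
      exact_mod_cast hcount
    refine hc.trans ?_
    have hA : (⌊2 * ε / |β| + 1⌋₊ : ℝ) ≤ 2 * ε / |β| + 1 := Nat.floor_le (by positivity)
    have hB : ((H / q / T : ℕ) : ℝ) ≤ H / q * (4 * |β|) := by
      refine (Nat.cast_div_le).trans ?_
      have hT0 : (0 : ℝ) < T := by exact_mod_cast hT1
      rw [div_le_iff₀ hT0]
      refine (Nat.cast_div_le).trans ?_
      have : (0 : ℝ) ≤ H / q := by positivity
      nlinarith
    gcongr
  have h2 : 2 * ε / |β| + 1 ≤ 4 * ε / |β| := by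
    have : 1 ≤ 2 * ε / |β| := by rw [le_div_iff₀ hβpos]; linarith
    have h3 : 4 * ε / |β| = 2 * (2 * ε / |β|) := by ring
    linarith
  have h3 : δ * H ≤ 4 * ε / |β| * (q * (H / q * (4 * |β|) + 1)) :=
    hcard.trans (h1.trans (mul_le_mul_of_nonneg_right h2 (by positivity)))
  have h4 : 4 * ε / |β| * (q * (H / q * (4 * |β|) + 1)) = (16 * ε * H * |β| + 4 * ε * q) / |β| := by
    field_simp; ring
  rw [h4, le_div_iff₀ hβpos] at h3
  -- At this point δH|β| ≤ 16εH|β| + 4εq, and 32ε ≤ δ lets half of the left side absorb the first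
  -- term.
  nlinarith [mul_nonneg hH'.le hβpos.le]

/-- Here the denominator may vary with x. One value q₀ serves a proportion δ/Q of [1, M], and
Vinogradov's lemma for q₀κ produces q' with q'q₀ a denominator of κ. -/
theorem exists_denominator_of_pigeonhole {κ ε δ Q : ℝ} {M : ℕ} (hδ : 0 < δ) (hQ : 1 ≤ Q)
    (hM : 0 < M) (hε : 32 * ε ≤ δ / Q) (S : Finset ℕ) (hS : S ⊆ Finset.Icc 1 M)
    (hcard : δ * M ≤ S.card)
    (h : ∀ x ∈ S, ∃ q : ℕ, 1 ≤ q ∧ q ≤ Q ∧ distInt (q * (x * κ)) ≤ ε) :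
    ∃ q : ℕ, 1 ≤ q ∧ q ≤ 2 * Q ^ 2 / δ ∧ distInt (q * κ) * M ≤ 16 * ε * Q ^ 2 / δ ^ 2 := by
  classical
  have hM' : (0 : ℝ) < M := by exact_mod_cast hM
  have hpos : (0 : ℝ) < S.card := lt_of_lt_of_le (by positivity) hcard
  obtain ⟨x₀, hx₀⟩ : S.Nonempty := Finset.card_pos.1 (by exact_mod_cast hpos)
  have hε0 : 0 ≤ ε := by
    obtain ⟨q, _, _, hq⟩ := h x₀ hx₀
    exact (distInt_nonneg _).trans hq
  choose! q hq1 hqQ hqε using h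
  have hQ0 : 0 < Q := by linarith
  have hfl : 1 ≤ ⌊Q⌋₊ := (Nat.one_le_floor_iff _).2 hQ
  obtain ⟨q₀, hq₀, hfib⟩ := Finset.exists_le_card_fiber_of_nsmul_le_card_of_maps_to
    (s := S) (t := Finset.Icc 1 ⌊Q⌋₊) (f := q) (b := δ / Q * M)
    (fun x hx => Finset.mem_Icc.2 ⟨hq1 x hx, Nat.le_floor (hqQ x hx)⟩)
    ⟨1, by simpa using hfl⟩ (by
      rw [Nat.card_Icc, nsmul_eq_mul, Nat.add_sub_cancel]
      refine le_trans ?_ hcard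
      have := Nat.floor_le hQ0.le
      calc (⌊Q⌋₊ : ℝ) * (δ / Q * M) ≤ Q * (δ / Q * M) := by gcongr
        _ = δ * M := by field_simp)
  have hq₀1 := (Finset.mem_Icc.1 hq₀).1
  have hq₀Q : (q₀ : ℝ) ≤ Q := (Nat.cast_le.2 (Finset.mem_Icc.1 hq₀).2).trans (Nat.floor_le hQ0.le)
  obtain ⟨q', hq'1, hq'2, hq'3⟩ := exists_denominator_of_many_close (θ := q₀ * κ) (ε := ε)
    (δ := δ / Q) (by positivity) hε hM (S.filter (fun x => q x = q₀))
    ((Finset.filter_subset _ _).trans hS) hfib (fun x hx => by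
      rw [Finset.mem_filter] at hx
      have := hqε x hx.1
      rw [hx.2] at this
      rwa [mul_left_comm])
  have hq'4 : (q' : ℝ) ≤ 2 * Q / δ := by
    rw [le_div_iff₀ hδ]
    rw [mul_div_assoc', div_le_iff₀ hQ0] at hq'2
    exact hq'2
  refine ⟨q' * q₀, one_le_mul hq'1 hq₀1, ?_, ?_⟩
  · push_cast
    calc (q' : ℝ) * q₀ ≤ 2 * Q / δ * Q := by gcongr
      _ = _ := by ring
  · push_cast
    rw [mul_assoc]
    calc distInt (q' * (q₀ * κ)) * M = distInt (q' * (q₀ * κ)) * (δ / Q * M) * (Q / δ) := by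
          field_simp
      _ ≤ 8 * ε * (2 * Q / δ) * (Q / δ) := by
          refine mul_le_mul_of_nonneg_right (hq'3.trans ?_) (by positivity)
          gcongr
      _ = _ := by ring

/-! ### Van der Corput differencing -/

/-- In the expanded square the pairs above and below the diagonal are complex conjugates; they are
grouped by their difference h. Vanishing outside [1, M] lets n + h run without restriction. -/
theorem norm_sum_sq_le_shifts (f : ℕ → ℂ) (M : ℕ) (hsupp : ∀ n, n ∉ Finset.Icc 1 M → f n = 0) :
    ‖∑ n ∈ Finset.Icc 1 M, f n‖ ^ 2 ≤ ∑ n ∈ Finset.Icc 1 M, ‖f n‖ ^ 2 +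
      2 * ∑ h ∈ Finset.Icc 1 M, ‖∑ n ∈ Finset.Icc 1 M, f (n + h) * star (f n)‖ := by
  set I := Finset.Icc 1 M
  set T : ℂ := ∑ h ∈ I, ∑ n ∈ I, f (n + h) * star (f n) with hT
  have hT2 : T = ∑ x ∈ (I ×ˢ I).filter (fun x => x.2 < x.1), f x.1 * star (f x.2) := by
    rw [hT, ← Finset.sum_product']
    rw [← Finset.sum_filter_of_ne (p := fun x : ℕ × ℕ => x.2 + x.1 ∈ I)]
    · refine Finset.sum_nbij' (fun x => (x.2 + x.1, x.2)) (fun x => (x.1 - x.2, x.2)) ?_ ?_ ?_ ?_ ?_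
      · rintro ⟨a, b⟩ h
        simp only [Finset.mem_filter, Finset.mem_product, I, Finset.mem_Icc] at h ⊢
        omega
      · rintro ⟨a, b⟩ h
        simp only [Finset.mem_filter, Finset.mem_product, I, Finset.mem_Icc] at h ⊢
        omega
      · rintro ⟨a, b⟩ h
        simp
      · rintro ⟨a, b⟩ h
        simp only [Finset.mem_filter, Finset.mem_product, I, Finset.mem_Icc] at h ⊢
        ext
        · simp only; omega
        · rfl
      · rintro ⟨a, b⟩ h
        rfl
    · intro x _ hx
      by_contra hn
      exact hx (by rw [hsupp _ hn, zero_mul])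
  have hstar : star T = ∑ x ∈ (I ×ˢ I).filter (fun x => x.1 < x.2), f x.1 * star (f x.2) := by
    rw [hT2, star_sum]
    refine Finset.sum_nbij' Prod.swap Prod.swap ?_ ?_ ?_ ?_ ?_
    · rintro ⟨a, b⟩ h
      simp only [Finset.mem_filter, Finset.mem_product, Prod.swap] at h ⊢
      tauto
    · rintro ⟨a, b⟩ h
      simp only [Finset.mem_filter, Finset.mem_product, Prod.swap] at h ⊢
      tauto
    · simp
    · simp
    · rintro ⟨a, b⟩ h
      simp [mul_comm]
  have hdiag : ∑ n ∈ I, f n * star (f n) =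
      ∑ x ∈ (I ×ˢ I).filter (fun x => x.1 = x.2), f x.1 * star (f x.2) := by
    refine Finset.sum_nbij' (fun a => (a, a)) Prod.fst ?_ ?_ ?_ ?_ ?_
    · intro a ha; simp [ha]
    · rintro ⟨a, b⟩ h
      simp only [Finset.mem_filter, Finset.mem_product] at h
      exact h.1.1
    · simp
    · rintro ⟨a, b⟩ h
      simp only [Finset.mem_filter, Finset.mem_product] at h
      simp [h.2]
    · simp
  have hall : (∑ n ∈ I, f n) * star (∑ n ∈ I, f n) =
      ∑ n ∈ I, f n * star (f n) + (T + star T) := by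
    rw [star_sum, Finset.sum_mul_sum, ← Finset.sum_product', hdiag, hstar, hT2,
      ← Finset.sum_filter_add_sum_filter_not (I ×ˢ I) (fun x : ℕ × ℕ => x.1 = x.2)]
    congr 1
    rw [← Finset.sum_filter_add_sum_filter_not ((I ×ˢ I).filter _) (fun x : ℕ × ℕ => x.2 < x.1),
      Finset.filter_filter, Finset.filter_filter]
    congr 1
    · refine Finset.sum_congr (Finset.filter_congr fun x _ => ?_) fun _ _ => rfl
      omega
    · refine Finset.sum_congr (Finset.filter_congr fun x _ => ?_) fun _ _ => rfl
      omega
  have hTle : ‖T‖ ≤ ∑ h ∈ I, ‖∑ n ∈ I, f (n + h) * star (f n)‖ := norm_sum_le _ _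
  calc ‖∑ n ∈ I, f n‖ ^ 2 = ‖(∑ n ∈ I, f n) * star (∑ n ∈ I, f n)‖ := by
        rw [norm_mul, norm_star, sq]
    _ = ‖∑ n ∈ I, f n * star (f n) + (T + star T)‖ := by rw [hall]
    _ ≤ ‖∑ n ∈ I, f n * star (f n)‖ + (‖T‖ + ‖star T‖) :=
        (norm_add_le _ _).trans (add_le_add_right (norm_add_le _ _) _)
    _ ≤ ∑ n ∈ I, ‖f n‖ ^ 2 + (‖T‖ + ‖T‖) := by
        rw [norm_star]
        refine add_le_add_left ((norm_sum_le _ _).trans (le_of_eq ?_)) _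
        exact Finset.sum_congr rfl fun n _ => by rw [norm_mul, norm_star, sq]
    _ ≤ _ := by linarith

/-- Van der Corput differencing: a bounded function with a large sum correlates with many of its
shifts. -/
theorem many_shifts_correlate {f : ℕ → ℂ} {M : ℕ} {δ : ℝ}
    (hsupp : ∀ n, n ∉ Finset.Icc 1 M → f n = 0) (hf : ∀ n, ‖f n‖ ≤ 1)
    (hM : 2 ≤ δ ^ 2 * M) (hδ : 0 ≤ δ) (hsum : δ * M ≤ ‖∑ n ∈ Finset.Icc 1 M, f n‖) :
    δ ^ 2 / 8 * M ≤ (((Finset.Icc 1 M).filter (fun h => δ ^ 2 / 8 * M ≤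
      ‖∑ n ∈ Finset.Icc 1 M, f (n + h) * star (f n)‖)).card : ℝ) := by
  have h1 := norm_sum_sq_le_shifts f M hsupp
  have hMpos : (0 : ℝ) < M := by
    rcases (Nat.cast_nonneg (α := ℝ) M).eq_or_lt with h | h
    · rw [← h] at hM; norm_num at hM
    · exact h
  have hsq : (δ * M) ^ 2 ≤ ‖∑ n ∈ Finset.Icc 1 M, f n‖ ^ 2 := by gcongr
  have h2 : ∑ n ∈ Finset.Icc 1 M, ‖f n‖ ^ 2 ≤ M := by
    calc ∑ n ∈ Finset.Icc 1 M, ‖f n‖ ^ 2 ≤ ∑ n ∈ Finset.Icc 1 M, (1 : ℝ) :=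
          Finset.sum_le_sum fun n _ => pow_le_one₀ (norm_nonneg _) (hf n)
      _ = M := by simp
  set c : ℕ → ℝ := fun h => ‖∑ n ∈ Finset.Icc 1 M, f (n + h) * star (f n)‖ with hc
  set 𝓗 := (Finset.Icc 1 M).filter (fun h => δ ^ 2 / 8 * M ≤ c h) with h𝓗
  have hcM : ∀ h, c h ≤ M := fun h => by
    refine (norm_sum_le _ _).trans ?_
    calc ∑ n ∈ Finset.Icc 1 M, ‖f (n + h) * star (f n)‖ ≤ ∑ n ∈ Finset.Icc 1 M, (1 : ℝ) :=
          Finset.sum_le_sum fun n _ => by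
            rw [norm_mul, norm_star]
            exact mul_le_one₀ (hf _) (norm_nonneg _) (hf _)
      _ = M := by simp
  have h3 : ∑ h ∈ Finset.Icc 1 M, c h ≤ 𝓗.card * M + M * (δ ^ 2 / 8 * M) := by
    rw [← Finset.sum_filter_add_sum_filter_not (Finset.Icc 1 M) (fun h => δ ^ 2 / 8 * M ≤ c h)]
    refine add_le_add ?_ ?_
    · calc ∑ h ∈ 𝓗, c h ≤ ∑ h ∈ 𝓗, (M : ℝ) := Finset.sum_le_sum fun h _ => hcM h
        _ = _ := by simp
    · calc _ ≤ ∑ h ∈ (Finset.Icc 1 M).filter (fun h => ¬ δ ^ 2 / 8 * M ≤ c h), δ ^ 2 / 8 * M :=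
            Finset.sum_le_sum fun h hh => (not_le.1 (Finset.mem_filter.1 hh).2).le
        _ ≤ _ := by
            rw [Finset.sum_const, nsmul_eq_mul]
            gcongr
            calc _ ≤ (Finset.Icc 1 M).card := Finset.card_filter_le _ _
              _ = M := by simp
  have h4 : (δ * M) ^ 2 ≤ M + 2 * (𝓗.card * M + M * (δ ^ 2 / 8 * M)) := by
    calc _ ≤ _ := hsq.trans h1
      _ ≤ _ := by gcongr
  -- Since 2 ≤ δ²M, the diagonal is at most δ²M²/2; the poor shifts cost δ²M²/4, which leaves δ²M²/4
  -- for the rich ones.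
  have h5 : (δ ^ 2 / 8 * M) * M ≤ 𝓗.card * M := by nlinarith
  exact le_of_mul_le_mul_right h5 hMpos

/-- The top coefficient of the difference is linear in the shift h, which is what allows
Vinogradov's lemma to act on the set of good shifts. -/
theorem Polynomial.exists_difference {R : Polynomial ℝ} {k : ℕ} (hR : R.natDegree ≤ k + 1) (h : ℝ) :
    ∃ D : Polynomial ℝ, D.natDegree ≤ k ∧ D.coeff k = (k + 1) * (h * R.coeff (k + 1)) ∧
      ∀ x, D.eval x = R.eval (x + h) - R.eval x := by
  have hk : ∀ n, k < n → (Polynomial.taylor h R - R).coeff n = 0 := by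
    intro n hn
    rw [Polynomial.coeff_sub, Polynomial.taylor_coeff]
    have hd : (Polynomial.hasseDeriv n R).natDegree ≤ 0 :=
      (Polynomial.natDegree_hasseDeriv_le R n).trans (by omega)
    rw [Polynomial.eq_C_of_natDegree_le_zero hd, Polynomial.eval_C, Polynomial.hasseDeriv_coeff]
    simp
  refine ⟨Polynomial.taylor h R - R, Polynomial.natDegree_le_iff_coeff_eq_zero.2 hk, ?_, ?_⟩
  · rw [Polynomial.coeff_sub, Polynomial.taylor_coeff]
    have hd : (Polynomial.hasseDeriv k R).natDegree ≤ 1 :=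
      (Polynomial.natDegree_hasseDeriv_le R k).trans (by omega)
    rw [Polynomial.eval_eq_sum_range' (Nat.lt_succ_of_le hd), Finset.sum_range_succ,
      Finset.sum_range_one, Polynomial.hasseDeriv_coeff, Polynomial.hasseDeriv_coeff]
    simp [Nat.choose_succ_self_right, add_comm 1 k]
    ring
  · intro x
    rw [Polynomial.eval_sub, Polynomial.taylor_eval]

/-! ### Additive characters and Weyl's inequality -/

theorem phase_add (x y : ℝ) : phase (x + y) = phase x * phase y := by
  unfold phase
  rw [← Complex.exp_add]; push_cast; ring_nf

theorem star_phase (x : ℝ) : star (phase x) = phase (-x) := by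
  unfold phase
  rw [Complex.star_def, ← Complex.exp_conj]
  congr 1
  simp only [map_mul, Complex.conj_I, Complex.conj_ofReal, map_ofNat]
  push_cast
  ring

theorem phase_int (n : ℤ) : phase n = 1 := by
  unfold phase
  rw [Complex.exp_eq_one_iff]
  exact ⟨n, by push_cast; ring⟩

theorem phase_nat_mul (n : ℕ) (x : ℝ) : phase (n * x) = phase x ^ n := by
  unfold phase
  rw [← Complex.exp_nat_mul]; push_cast; ring_nf

theorem norm_phase_sub_one (x : ℝ) : ‖phase x - 1‖ = 2 * |Real.sin (Real.pi * x)| := by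
  have h : (2 * Real.pi * Complex.I * x : ℂ) = Complex.I * ((2 * Real.pi * x : ℝ) : ℂ) := by
    push_cast; ring
  rw [phase, h, Complex.norm_exp_I_mul_ofReal_sub_one, Real.norm_eq_abs, abs_mul, abs_two]
  congr 3; ring

theorem four_mul_distInt_le (x : ℝ) : 4 * distInt x ≤ ‖phase x - 1‖ := by
  have hx : phase x = phase (x - round x) := by
    conv_lhs => rw [← sub_add_cancel x (round x : ℝ), phase_add, phase_int, mul_one]
  rw [hx, norm_phase_sub_one, distInt_eq]
  set y := x - round x
  have hy : |y| ≤ 1 / 2 := abs_sub_round x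
  have h1 : 2 / Real.pi * (Real.pi * |y|) ≤ Real.sin (Real.pi * |y|) :=
    Real.mul_le_sin (by positivity) (by nlinarith [Real.pi_pos])
  have h2 : 2 / Real.pi * (Real.pi * |y|) = 2 * |y| := by
    field_simp
  have h3 : Real.sin (Real.pi * |y|) ≤ |Real.sin (Real.pi * y)| := by
    rcases abs_cases y with ⟨h, _⟩ | ⟨h, _⟩
    · rw [h]; exact le_abs_self _
    · rw [h, mul_neg, Real.sin_neg]; exact neg_le_abs _
  linarith

theorem norm_phase_sub_one_le (x : ℝ) : ‖phase x - 1‖ ≤ 2 * Real.pi * |x| := by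
  rw [norm_phase_sub_one]
  have := Real.abs_sin_le_abs (x := Real.pi * x)
  rw [abs_mul, abs_of_pos Real.pi_pos] at this
  linarith

/-- A geometric series of ratio e(β), with |e(β) - 1| at least four times the distance from β to the
integers. The product form also covers integral β. -/
theorem norm_sum_linear_phase_le (β γ : ℝ) (M : ℕ) :
    ‖∑ m ∈ Finset.Icc 1 M, phase (β * m + γ)‖ * (2 * distInt β) ≤ 1 := by
  have h1 : ∑ m ∈ Finset.Icc 1 M, phase (β * m + γ) =
      phase (β + γ) * ∑ m ∈ Finset.range M, phase β ^ m := by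
    rw [Finset.mul_sum, ← Finset.Ico_add_one_right_eq_Icc, Finset.sum_Ico_eq_sum_range,
      Nat.add_sub_cancel]
    refine Finset.sum_congr rfl fun m _ => ?_
    rw [← phase_nat_mul, ← phase_add]
    push_cast; ring_nf
  have h2 := geom_sum_mul (phase β) M
  rw [h1, norm_mul, norm_phase, one_mul]
  have h3 : ‖∑ m ∈ Finset.range M, phase β ^ m‖ * ‖phase β - 1‖ ≤ 2 := by
    rw [← norm_mul, h2]
    refine (norm_sub_le _ _).trans ?_
    rw [norm_pow, norm_phase]; norm_num
  have h4 := mul_le_mul_of_nonneg_left (four_mul_distInt_le β)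
    (norm_nonneg (∑ m ∈ Finset.range M, phase β ^ m))
  linarith

/-- Weyl's inequality, inverse form with polynomial losses: a large exponential sum over an interval
forces the leading coefficient of the polynomial onto a major arc. -/
theorem weyl_inverse (k : ℕ) : ∃ C : ℕ, ∀ δ : ℝ, 0 < δ → δ ≤ 1 / 2 → ∀ M M' : ℕ, 0 < M → M' ≤ M →
    ∀ R : Polynomial ℝ, R.natDegree ≤ k + 1 →
      δ * M ≤ ‖∑ m ∈ Finset.Icc 1 M', phase (R.eval (m : ℝ))‖ →
      ∃ q : ℕ, 1 ≤ q ∧ q ≤ δ⁻¹ ^ C ∧ distInt (q * R.coeff (k + 1)) * M ^ (k + 1) ≤ δ⁻¹ ^ C := by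
  induction k with
  | zero =>
    refine ⟨1, fun δ hδ hδ2 M M' hM hM' R hR hsum => ⟨1, le_rfl, ?_, ?_⟩⟩
    · rw [pow_one, Nat.cast_one, one_le_inv₀ hδ]; linarith
    · have h1 := norm_sum_linear_phase_le (R.coeff 1) (R.coeff 0) M'
      have h2 : ∀ x : ℝ, R.eval x = R.coeff 1 * x + R.coeff 0 := fun x => by
        rw [Polynomial.eval_eq_sum_range' (Nat.lt_succ_of_le hR)]
        simp [Finset.sum_range_succ]; ring
      simp only [h2] at hsum
      have h3 := mul_le_mul_of_nonneg_right hsum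
        (show 0 ≤ 2 * distInt (R.coeff 1) from mul_nonneg zero_le_two (distInt_nonneg _))
      rw [pow_one, Nat.cast_one, one_mul, zero_add, pow_one, ← one_div, le_div_iff₀ hδ]
      have := distInt_nonneg (R.coeff 1)
      nlinarith [mul_nonneg this (Nat.cast_nonneg (α := ℝ) M)]
  | succ k ih =>
    obtain ⟨C, ih⟩ := ih
    -- M > Δ^E is what the pigeonhole lemma needs: its hypothesis 32ε ≤ δ⁵/Q is used with Q =
    -- Δ^(5C), ε = Q/M^(k+1) and 32 ≤ Δ⁵. For smaller M, q = 1 works, because the final exponent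
    -- contains E(k + 2).
    set E := 10 + 10 * C with hE
    refine ⟨E * (k + 2) + 15 * C + 20 + k, fun δ hδ hδ2 M M' hM hM' R hR hsum => ?_⟩
    set Δ := δ⁻¹ with hΔ
    have hΔ2 : 2 ≤ Δ := by rw [hΔ, le_inv_comm₀ two_pos hδ]; linarith
    have hΔ1 : 1 ≤ Δ := by linarith
    have hδΔ : δ = Δ⁻¹ := by rw [hΔ, inv_inv]
    have hM0 : (0 : ℝ) < M := by exact_mod_cast hM
    by_cases hsmall : (M : ℝ) ≤ Δ ^ E
    · refine ⟨1, le_rfl, by rw [Nat.cast_one]; exact one_le_pow₀ hΔ1, ?_⟩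
      calc distInt ((1 : ℕ) * R.coeff (k + 1 + 1)) * (M : ℝ) ^ (k + 1 + 1)
          ≤ 1 * (Δ ^ E) ^ (k + 1 + 1) := by
            gcongr
            exact (distInt_le_half _).trans (by norm_num)
        _ = Δ ^ (E * (k + 2)) := by rw [one_mul, ← pow_mul]
        _ ≤ _ := pow_le_pow_right₀ hΔ1 (by omega)
    push Not at hsmall
    have hpw : ∀ a b : ℕ, a ≤ b → Δ ^ a ≤ Δ ^ b := fun a b h => pow_le_pow_right₀ hΔ1 h
    have h8 : (8 : ℝ) ≤ Δ ^ 3 := by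
      calc (8 : ℝ) = 2 ^ 3 := by norm_num
        _ ≤ Δ ^ 3 := by gcongr
    -- Replacing δ²/8 by δ⁵ keeps every loss a pure power of Δ.
    have hδ5 : δ ^ 5 ≤ δ ^ 2 / 8 := by
      have h9 : 8 * δ ^ 3 ≤ 1 := by
        have : δ ^ 3 * Δ ^ 3 = 1 := by rw [← mul_pow, hΔ, mul_inv_cancel₀ hδ.ne', one_pow]
        nlinarith [pow_pos hδ 3]
      nlinarith [pow_pos hδ 2]
    -- After extension by zero, the autocorrelation at h is a sum of the differenced phase over [1,
    -- M' - h], still measured against M; this is why M' and M are kept separate.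
    set f : ℕ → ℂ := fun n => if n ∈ Finset.Icc 1 M' then phase (R.eval (n : ℝ)) else 0 with hf
    have hfs : ∑ n ∈ Finset.Icc 1 M, f n = ∑ m ∈ Finset.Icc 1 M', phase (R.eval (m : ℝ)) := by
      rw [← Finset.sum_subset (Finset.Icc_subset_Icc_right hM')]
      · exact Finset.sum_congr rfl fun n hn => if_pos hn
      · intro n _ hn; exact if_neg hn
    have hmany := many_shifts_correlate (f := f) (M := M) (δ := δ)
      (fun n hn => if_neg fun h => hn (Finset.Icc_subset_Icc_right hM' h))
      (fun n => by
        simp only [hf]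
        split_ifs
        · rw [norm_phase]
        · simp)
      (by
        have h10 : Δ ^ 3 ≤ M := (hpw 3 E (by omega)).trans hsmall.le
        have h11 : δ ^ 2 * Δ ^ 3 = Δ := by rw [hΔ]; field_simp
        calc (2 : ℝ) ≤ δ ^ 2 * Δ ^ 3 := by rw [h11]; exact hΔ2
          _ ≤ _ := by gcongr) hδ.le (by rw [hfs]; exact hsum)
    have hcorr : ∀ h ∈ Finset.Icc 1 M, ∀ D : Polynomial ℝ,
        (∀ x, D.eval x = R.eval (x + h) - R.eval x) →
        ∑ n ∈ Finset.Icc 1 M, f (n + h) * star (f n) =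
          ∑ n ∈ Finset.Icc 1 (M' - h), phase (D.eval (n : ℝ)) := by
      intro h _ D hD
      rw [← Finset.sum_subset (Finset.Icc_subset_Icc_right (show M' - h ≤ M by omega))]
      · refine Finset.sum_congr rfl fun n hn => ?_
        rw [Finset.mem_Icc] at hn
        simp only [hf]
        rw [if_pos (Finset.mem_Icc.2 (by omega)), if_pos (Finset.mem_Icc.2 (by omega)), star_phase,
          ← phase_add, hD]
        push_cast; ring_nf
      · intro n hn hn'
        simp only [hf]
        rw [Finset.mem_Icc] at hn hn'
        rw [if_neg (by rw [Finset.mem_Icc]; omega), zero_mul]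
    set β := R.coeff (k + 1 + 1) with hβ
    have hind : ∀ h ∈ (Finset.Icc 1 M).filter (fun h => δ ^ 2 / 8 * M ≤
        ‖∑ n ∈ Finset.Icc 1 M, f (n + h) * star (f n)‖), ∃ q : ℕ, 1 ≤ q ∧ q ≤ Δ ^ (5 * C) ∧
        distInt (q * (h * (((k + 1 : ℕ) + 1 : ℝ) * β))) ≤ Δ ^ (5 * C) / M ^ (k + 1) := by
      intro h hh
      rw [Finset.mem_filter] at hh
      obtain ⟨D, hD1, hD2, hD3⟩ := Polynomial.exists_difference hR (h : ℝ)
      rw [hcorr h hh.1 D hD3] at hh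
      obtain ⟨q, hq1, hq2, hq3⟩ := ih (δ ^ 5) (by positivity)
        ((pow_le_of_le_one hδ.le (by linarith) (by norm_num)).trans hδ2) M (M' - h) hM (by omega)
        D hD1 (le_trans (by gcongr) hh.2)
      rw [← inv_pow, ← hΔ, ← pow_mul] at hq2 hq3
      refine ⟨q, hq1, hq2, ?_⟩
      rw [le_div_iff₀ (by positivity)]
      rw [hD2, mul_left_comm _ (h : ℝ)] at hq3
      exact hq3
    have hMk : Δ ^ E ≤ (M : ℝ) ^ (k + 1) :=
      hsmall.le.trans (le_self_pow₀ (by exact_mod_cast hM) (by omega))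
    obtain ⟨q, hq1, hq2, hq3⟩ := exists_denominator_of_pigeonhole
      (κ := ((k + 1 : ℕ) + 1 : ℝ) * β) (ε := Δ ^ (5 * C) / M ^ (k + 1)) (δ := δ ^ 5)
      (Q := Δ ^ (5 * C)) (M := M) (by positivity) (one_le_pow₀ hΔ1) hM (by
        rw [mul_div_assoc', div_le_div_iff₀ (by positivity) (by positivity)]
        have h32 : (32 : ℝ) ≤ Δ ^ 5 := by
          calc (32 : ℝ) = 2 ^ 5 := by norm_num
            _ ≤ Δ ^ 5 := by gcongr
        have hone : δ ^ 5 * Δ ^ 5 = 1 := by rw [← mul_pow, hΔ, mul_inv_cancel₀ hδ.ne', one_pow]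
        calc 32 * Δ ^ (5 * C) * Δ ^ (5 * C) ≤ Δ ^ 5 * Δ ^ (5 * C) * Δ ^ (5 * C) := by gcongr
          _ = (δ ^ 5 * Δ ^ 5) * (Δ ^ 5 * Δ ^ (5 * C) * Δ ^ (5 * C)) := by rw [hone, one_mul]
          _ = δ ^ 5 * Δ ^ E := by rw [hE]; ring
          _ ≤ δ ^ 5 * (M : ℝ) ^ (k + 1) := by gcongr)
      _ (Finset.filter_subset _ _) (le_trans (by gcongr) hmany) hind
    have h16 : (16 : ℝ) ≤ Δ ^ 4 := by
      calc (16 : ℝ) = 2 ^ 4 := by norm_num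
        _ ≤ Δ ^ 4 := by gcongr
    have hk2 : ((k + 1 : ℕ) + 1 : ℝ) ≤ Δ ^ (k + 2) := by
      calc ((k + 1 : ℕ) + 1 : ℝ) = ((k + 2 : ℕ) : ℝ) := by push_cast; ring
        _ ≤ ((2 ^ (k + 2) : ℕ) : ℝ) := by exact_mod_cast (Nat.lt_two_pow_self).le
        _ = 2 ^ (k + 2) := by push_cast; ring
        _ ≤ _ := by gcongr
    have hinv5 : (δ ^ 5)⁻¹ = Δ ^ 5 := by rw [hΔ, inv_pow]
    refine ⟨q * (k + 2), one_le_mul hq1 (by omega), ?_, ?_⟩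
    · rw [div_eq_mul_inv, hinv5] at hq2
      push_cast
      calc (q : ℝ) * (k + 2) ≤ (2 * (Δ ^ (5 * C)) ^ 2 * Δ ^ 5) * Δ ^ (k + 2) := by
            gcongr
            calc (k + 2 : ℝ) = ((k + 1 : ℕ) + 1 : ℝ) := by push_cast; ring
              _ ≤ _ := hk2
        _ ≤ (Δ * (Δ ^ (5 * C)) ^ 2 * Δ ^ 5) * Δ ^ (k + 2) := by gcongr
        _ = Δ ^ (10 * C + 8 + k) := by ring
        _ ≤ _ := hpw _ _ (by omega)
    · rw [div_eq_mul_inv _ ((δ ^ 5) ^ 2), ← inv_pow, hinv5] at hq3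
      have e1 : (((q * (k + 2) : ℕ) : ℝ) * β) = q * (((k + 1 : ℕ) + 1 : ℝ) * β) := by
        push_cast; ring
      rw [e1]
      calc distInt (q * (((k + 1 : ℕ) + 1 : ℝ) * β)) * (M : ℝ) ^ (k + 1 + 1)
          = (distInt (q * (((k + 1 : ℕ) + 1 : ℝ) * β)) * M) * (M : ℝ) ^ (k + 1) := by ring
        _ ≤ (16 * (Δ ^ (5 * C) / M ^ (k + 1)) * (Δ ^ (5 * C)) ^ 2 * (Δ ^ 5) ^ 2) *
            (M : ℝ) ^ (k + 1) := by gcongr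
        _ = 16 * Δ ^ (15 * C + 10) := by field_simp; ring
        _ ≤ Δ ^ 4 * Δ ^ (15 * C + 10) := by gcongr
        _ = Δ ^ (15 * C + 14) := by ring
        _ ≤ _ := hpw _ _ (by omega)

/-! ### Polynomial recurrence and Type II sums -/

/-- If a polynomial is close to the integers at a positive proportion of an interval, its leading
coefficient lies on a correspondingly narrow major arc. -/
theorem polynomial_recurrence_inverse (k : ℕ) : ∃ C : ℕ, ∀ δ : ℝ, 0 < δ → δ ≤ 1 / 2 →
    ∀ ε : ℝ, ε ≤ δ ^ C → ∀ H : ℕ, δ⁻¹ ^ C ≤ H → ∀ S ⊆ Finset.Icc 1 H, δ * H ≤ S.card →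
    ∀ R : Polynomial ℝ, R.natDegree ≤ k → (∀ n ∈ S, distInt (R.eval (n : ℝ)) ≤ ε) →
      ∃ q : ℕ, 1 ≤ q ∧ q ≤ δ⁻¹ ^ C ∧ distInt (q * R.coeff k) * H ^ k ≤ δ⁻¹ ^ C * ε := by
  induction k with
  | zero =>
    refine ⟨0, fun δ hδ hδ2 ε hε H hH S hS hcard R hR hclose => ⟨1, le_rfl, by simp, ?_⟩⟩
    have hH0 : (0 : ℝ) < H := lt_of_lt_of_le (by simp) hH
    have hpos : (0 : ℝ) < S.card := lt_of_lt_of_le (by positivity) hcard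
    obtain ⟨x₀, hx₀⟩ : S.Nonempty := Finset.card_pos.1 (by exact_mod_cast hpos)
    have := hclose x₀ hx₀
    rw [Polynomial.eq_C_of_natDegree_le_zero hR, Polynomial.eval_C] at this
    simpa using this
  | succ k ih =>
    obtain ⟨C, ih⟩ := ih
    refine ⟨15 * C + 20 + k, fun δ hδ hδ2 ε hε H hH S hS hcard R hR hclose => ?_⟩
    set Δ := δ⁻¹ with hΔ
    have hΔ2 : 2 ≤ Δ := by rw [hΔ, le_inv_comm₀ two_pos hδ]; linarith
    have hΔ1 : 1 ≤ Δ := by linarith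
    have hpw : ∀ a b : ℕ, a ≤ b → Δ ^ a ≤ Δ ^ b := fun a b h => pow_le_pow_right₀ hΔ1 h
    have hδpw : ∀ a b : ℕ, a ≤ b → δ ^ b ≤ δ ^ a := fun a b h =>
      pow_le_pow_of_le_one hδ.le (by linarith) h
    have hH0 : (0 : ℝ) < H := lt_of_lt_of_le (by positivity) hH
    have hHpos : 0 < H := by exact_mod_cast hH0
    have h8δ : 8 * δ ^ 3 ≤ 1 := by
      calc 8 * δ ^ 3 ≤ 8 * (1 / 2) ^ 3 := by gcongr
        _ = 1 := by norm_num
    have hδ5 : δ ^ 5 ≤ δ ^ 2 / 8 := by nlinarith [pow_pos hδ 2]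
    have hpos : (0 : ℝ) < S.card := lt_of_lt_of_le (by positivity) hcard
    obtain ⟨x₀, hx₀⟩ : S.Nonempty := Finset.card_pos.1 (by exact_mod_cast hpos)
    have hε0 : 0 ≤ ε := (distInt_nonneg _).trans (hclose x₀ hx₀)
    -- Differencing is applied to the indicator of S: for many h there are many n with n and n + h
    -- both in S, and there the differenced polynomial is within 2ε of an integer.
    set f : ℕ → ℂ := fun n => if n ∈ S then 1 else 0 with hf
    have hmany := many_shifts_correlate (f := f) (M := H) (δ := δ)
      (fun n hn => if_neg fun h => hn (hS h))
      (fun n => by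
        simp only [hf]
        split_ifs <;> simp)
      (by
        have h10 : Δ ^ 3 ≤ H := (hpw 3 _ (by omega)).trans hH
        have h11 : δ ^ 2 * Δ ^ 3 = Δ := by rw [hΔ]; field_simp
        calc (2 : ℝ) ≤ δ ^ 2 * Δ ^ 3 := by rw [h11]; exact hΔ2
          _ ≤ _ := by gcongr) hδ.le (by
        simp only [hf]
        rw [← Finset.sum_filter, Finset.filter_mem_eq_inter, Finset.inter_eq_right.2 hS]
        simpa using hcard)
    have hcorr : ∀ h, ∑ n ∈ Finset.Icc 1 H, f (n + h) * star (f n) =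
        (((Finset.Icc 1 H).filter (fun n => n ∈ S ∧ n + h ∈ S)).card : ℂ) := by
      intro h
      rw [Finset.card_filter]
      push_cast
      refine Finset.sum_congr rfl fun n _ => ?_
      simp only [hf]
      by_cases h1 : n ∈ S <;> by_cases h2 : n + h ∈ S <;> simp [h1, h2]
    set β := R.coeff (k + 1) with hβ
    have hind : ∀ h ∈ (Finset.Icc 1 H).filter (fun h => δ ^ 2 / 8 * H ≤
        ‖∑ n ∈ Finset.Icc 1 H, f (n + h) * star (f n)‖), ∃ q : ℕ, 1 ≤ q ∧ q ≤ Δ ^ (5 * C) ∧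
        distInt (q * (h * ((k + 1 : ℝ) * β))) ≤ Δ ^ (5 * C) * (2 * ε) / H ^ k := by
      intro h hh
      rw [Finset.mem_filter, hcorr, Complex.norm_natCast] at hh
      obtain ⟨D, hD1, hD2, hD3⟩ := Polynomial.exists_difference hR (h : ℝ)
      obtain ⟨q, hq1, hq2, hq3⟩ := ih (δ ^ 5) (by positivity)
        ((pow_le_of_le_one hδ.le (by linarith) (by norm_num)).trans hδ2) (2 * ε) (by
          rw [← pow_mul]
          calc 2 * ε ≤ 2 * δ ^ (5 * C + 1) := by
                gcongr; exact hε.trans (hδpw _ _ (by omega))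
            _ = (2 * δ) * δ ^ (5 * C) := by ring
            _ ≤ 1 * δ ^ (5 * C) := by gcongr; linarith
            _ = _ := one_mul _) H (by
          rw [← inv_pow, ← hΔ, ← pow_mul]
          exact (hpw _ _ (by omega)).trans hH) _ (Finset.filter_subset _ _)
        (le_trans (by gcongr) hh.2) D hD1 (fun n hn => by
          rw [Finset.mem_filter] at hn
          have h1 := hclose _ hn.2.2
          have h2 := hclose _ hn.2.1
          push_cast at h1
          rw [hD3]
          exact (distInt_sub_le _ _).trans (by linarith))
      rw [← inv_pow, ← hΔ, ← pow_mul] at hq2 hq3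
      refine ⟨q, hq1, hq2, ?_⟩
      rw [le_div_iff₀ (by positivity)]
      rw [hD2, mul_left_comm _ (h : ℝ)] at hq3
      exact hq3
    have hHk : (1 : ℝ) ≤ (H : ℝ) ^ k := one_le_pow₀ (by exact_mod_cast hHpos)
    obtain ⟨q, hq1, hq2, hq3⟩ := exists_denominator_of_pigeonhole
      (κ := (k + 1 : ℝ) * β) (ε := Δ ^ (5 * C) * (2 * ε) / H ^ k) (δ := δ ^ 5)
      (Q := Δ ^ (5 * C)) (M := H) (by positivity) (one_le_pow₀ hΔ1) hHpos (by
        rw [le_div_iff₀ (by positivity)]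
        have h64 : 64 * δ ^ 6 ≤ 1 := by
          calc 64 * δ ^ 6 ≤ 64 * (1 / 2) ^ 6 := by gcongr
            _ = 1 := by norm_num
        have hone : δ * Δ = 1 := mul_inv_cancel₀ hδ.ne'
        calc 32 * (Δ ^ (5 * C) * (2 * ε) / H ^ k) * Δ ^ (5 * C)
            ≤ 32 * (Δ ^ (5 * C) * (2 * ε)) * Δ ^ (5 * C) := by
              gcongr; exact div_le_self (by positivity) hHk
          _ ≤ 32 * (Δ ^ (5 * C) * (2 * δ ^ (10 * C + 11))) * Δ ^ (5 * C) := by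
              gcongr; exact hε.trans (hδpw _ _ (by omega))
          _ = (64 * δ ^ 6) * δ ^ 5 * (δ * Δ) ^ (10 * C) := by ring
          _ ≤ 1 * δ ^ 5 * (δ * Δ) ^ (10 * C) := by gcongr
          _ = δ ^ 5 := by rw [hone]; simp)
      _ (Finset.filter_subset _ _) (le_trans (by gcongr) hmany) hind
    have h32 : (32 : ℝ) ≤ Δ ^ 5 := by
      calc (32 : ℝ) = 2 ^ 5 := by norm_num
        _ ≤ Δ ^ 5 := by gcongr
    have hk2 : (k + 1 : ℝ) ≤ Δ ^ (k + 1) := by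
      calc (k + 1 : ℝ) = ((k + 1 : ℕ) : ℝ) := by push_cast; ring
        _ ≤ ((2 ^ (k + 1) : ℕ) : ℝ) := by exact_mod_cast (Nat.lt_two_pow_self).le
        _ = 2 ^ (k + 1) := by push_cast; ring
        _ ≤ _ := by gcongr
    have hinv5 : (δ ^ 5)⁻¹ = Δ ^ 5 := by rw [hΔ, inv_pow]
    refine ⟨q * (k + 1), one_le_mul hq1 (by omega), ?_, ?_⟩
    · rw [div_eq_mul_inv, hinv5] at hq2
      push_cast
      calc (q : ℝ) * (k + 1) ≤ (2 * (Δ ^ (5 * C)) ^ 2 * Δ ^ 5) * Δ ^ (k + 1) := by gcongr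
        _ ≤ (Δ * (Δ ^ (5 * C)) ^ 2 * Δ ^ 5) * Δ ^ (k + 1) := by gcongr
        _ = Δ ^ (10 * C + 7 + k) := by ring
        _ ≤ _ := hpw _ _ (by omega)
    · rw [div_eq_mul_inv _ ((δ ^ 5) ^ 2), ← inv_pow, hinv5] at hq3
      have e1 : (((q * (k + 1) : ℕ) : ℝ) * β) = q * ((k + 1 : ℝ) * β) := by
        push_cast; ring
      rw [e1]
      calc distInt (q * ((k + 1 : ℝ) * β)) * (H : ℝ) ^ (k + 1)
          = (distInt (q * ((k + 1 : ℝ) * β)) * H) * (H : ℝ) ^ k := by ring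
        _ ≤ (16 * (Δ ^ (5 * C) * (2 * ε) / H ^ k) * (Δ ^ (5 * C)) ^ 2 * (Δ ^ 5) ^ 2) *
            (H : ℝ) ^ k := by gcongr
        _ = 32 * (Δ ^ (15 * C + 10) * ε) := by field_simp; ring
        _ ≤ Δ ^ 5 * (Δ ^ (15 * C + 10) * ε) := by gcongr
        _ = Δ ^ (15 * C + 15) * ε := by ring
        _ ≤ _ := mul_le_mul_of_nonneg_right (hpw _ _ (by omega)) hε0

/-- With s = n and t = n' this is the polynomial in m that survives Cauchy–Schwarz. As a function of
n its top coefficient is again a polynomial, to which recurrence applies. -/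
theorem Polynomial.dilate_sub_dilate (P : Polynomial ℝ) {k : ℕ} (hP : P.natDegree ≤ k) (s t : ℝ) :
    ∃ R : Polynomial ℝ, R.natDegree ≤ k ∧ R.coeff k = (s ^ k - t ^ k) * P.coeff k ∧
      ∀ x, R.eval x = P.eval (s * x) - P.eval (t * x) := by
  refine ⟨P.comp (Polynomial.C s * Polynomial.X) - P.comp (Polynomial.C t * Polynomial.X), ?_, ?_, ?_⟩
  · refine Polynomial.natDegree_le_iff_coeff_eq_zero.2 fun n hn => ?_
    rw [Polynomial.coeff_sub, Polynomial.comp_C_mul_X_coeff, Polynomial.comp_C_mul_X_coeff,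
      Polynomial.natDegree_le_iff_coeff_eq_zero.1 hP n hn]
    simp
  · rw [Polynomial.coeff_sub, Polynomial.comp_C_mul_X_coeff, Polynomial.comp_C_mul_X_coeff]
    ring
  · intro x
    simp

/-- Cauchy–Schwarz for bilinear sums: the second coefficient sequence is removed. -/
theorem norm_bilinear_sq_le {ι κ : Type*} (I : Finset ι) (J : Finset κ) (b : κ → ℂ)
    (A : ι → κ → ℂ) :
    ‖∑ m ∈ J, b m * ∑ n ∈ I, A n m‖ ^ 2 ≤
      (∑ m ∈ J, ‖b m‖ ^ 2) * ∑ n' ∈ I, ∑ n ∈ I, ‖∑ m ∈ J, A n m * star (A n' m)‖ := by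
  have h1 : ‖∑ m ∈ J, b m * ∑ n ∈ I, A n m‖ ^ 2 ≤
      (∑ m ∈ J, ‖b m‖ ^ 2) * ∑ m ∈ J, ‖∑ n ∈ I, A n m‖ ^ 2 := by
    refine le_trans ?_ (Finset.sum_mul_sq_le_sq_mul_sq J _ _)
    gcongr
    refine (norm_sum_le _ _).trans (le_of_eq ?_)
    exact Finset.sum_congr rfl fun m _ => norm_mul _ _
  refine h1.trans (mul_le_mul_of_nonneg_left ?_ (Finset.sum_nonneg fun _ _ => by positivity))
  have h2 : ((∑ m ∈ J, ‖∑ n ∈ I, A n m‖ ^ 2 : ℝ) : ℂ) =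
      ∑ n' ∈ I, ∑ n ∈ I, ∑ m ∈ J, A n m * star (A n' m) := by
    push_cast
    calc ∑ m ∈ J, (‖∑ n ∈ I, A n m‖ : ℂ) ^ 2
        = ∑ m ∈ J, ∑ n' ∈ I, ∑ n ∈ I, A n m * star (A n' m) := by
          refine Finset.sum_congr rfl fun m _ => ?_
          rw [← Complex.mul_conj', ← Complex.star_def, star_sum, Finset.sum_mul_sum,
            Finset.sum_comm]
      _ = _ := by
          rw [Finset.sum_comm]
          exact Finset.sum_congr rfl fun n' _ => Finset.sum_comm
  have h3 : ∑ m ∈ J, ‖∑ n ∈ I, A n m‖ ^ 2 =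
      ‖∑ n' ∈ I, ∑ n ∈ I, ∑ m ∈ J, A n m * star (A n' m)‖ := by
    rw [← h2, Complex.norm_real, Real.norm_of_nonneg (Finset.sum_nonneg fun _ _ => by positivity)]
  rw [h3]
  exact (norm_sum_le _ _).trans (Finset.sum_le_sum fun n' _ => norm_sum_le _ _)

/-- A large Type II sum twisted by a polynomial phase forces the leading coefficient of the
polynomial onto a major arc. -/
theorem typeII_inverse (k : ℕ) : ∃ C : ℕ, ∀ δ : ℝ, 0 < δ → δ ≤ 1 / 2 → ∀ Y M y : ℕ,
    δ⁻¹ ^ C ≤ Y → δ⁻¹ ^ C ≤ M → y ≤ Y * M → ∀ a b : ℕ → ℂ, (∀ n, ‖a n‖ ≤ 1) → ∀ B : ℝ, 0 < B →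
    ∑ m ∈ Finset.Icc 1 M, ‖b m‖ ^ 2 ≤ B → ∀ P : Polynomial ℝ, P.natDegree ≤ k + 1 →
    δ * Y ^ 2 * M * B ≤ ‖∑ n ∈ Finset.Ioc Y (2 * Y), ∑ m ∈ Finset.Icc 1 (y / n),
      a n * b m * phase (P.eval ((n : ℝ) * m))‖ ^ 2 →
    ∃ q : ℕ, 1 ≤ q ∧ q ≤ δ⁻¹ ^ C ∧
      distInt (q * P.coeff (k + 1)) * ((Y : ℝ) * M) ^ (k + 1) ≤ δ⁻¹ ^ C := by
  obtain ⟨C₁, hW⟩ := weyl_inverse k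
  obtain ⟨C₂, hV⟩ := polynomial_recurrence_inverse (k + 1)
  -- Recurrence is used at density δ^(3+2C₁): δ² for the good n, δ^(2C₁) for fixing the denominator,
  -- and one δ for placing (Y, 2Y] inside [1, 2Y].
  set D := (3 + 2 * C₁) * C₂ with hD
  refine ⟨2 * C₁ + D, fun δ hδ hδ2 Y M y hY hM hy a b ha B hB hbB P hP hT => ?_⟩
  classical
  set Δ := δ⁻¹ with hΔ
  have hΔ2 : 2 ≤ Δ := by rw [hΔ, le_inv_comm₀ two_pos hδ]; linarith
  have hΔ1 : 1 ≤ Δ := by linarith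
  have hδΔ : δ * Δ = 1 := mul_inv_cancel₀ hδ.ne'
  have hpw : ∀ a b : ℕ, a ≤ b → Δ ^ a ≤ Δ ^ b := fun a b h => pow_le_pow_right₀ hΔ1 h
  have hY0 : (0 : ℝ) < Y := lt_of_lt_of_le (by positivity) hY
  have hM0 : (0 : ℝ) < M := lt_of_lt_of_le (by positivity) hM
  have hYpos : 0 < Y := by exact_mod_cast hY0
  have hMpos : 0 < M := by exact_mod_cast hM0
  set I := Finset.Ioc Y (2 * Y) with hI
  have hIcard : I.card = Y := by rw [hI, Nat.card_Ioc]; omega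
  have hyn : ∀ n ∈ I, y / n ≤ M := fun n hn => by
    rw [hI, Finset.mem_Ioc] at hn
    calc y / n ≤ y / Y := Nat.div_le_div_left hn.1.le hYpos
      _ ≤ Y * M / Y := Nat.div_le_div_right hy
      _ = M := Nat.mul_div_cancel_left _ hYpos
  -- The cut-off m ≤ y/n is moved into the coefficients so that the range of m does not depend on n,
  -- as Cauchy–Schwarz requires.
  set A : ℕ → ℕ → ℂ := fun n m => if m ≤ y / n then a n * phase (P.eval ((n : ℝ) * m)) else 0
    with hA
  have hTeq : ∑ n ∈ I, ∑ m ∈ Finset.Icc 1 (y / n), a n * b m * phase (P.eval ((n : ℝ) * m)) =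
      ∑ m ∈ Finset.Icc 1 M, b m * ∑ n ∈ I, A n m := by
    simp only [Finset.mul_sum]
    rw [Finset.sum_comm (s := Finset.Icc 1 M)]
    refine Finset.sum_congr rfl fun n hn => ?_
    rw [← Finset.sum_subset (Finset.Icc_subset_Icc_right (hyn n hn))]
    · refine Finset.sum_congr rfl fun m hm => ?_
      simp only [hA]
      rw [if_pos (Finset.mem_Icc.1 hm).2]; ring
    · intro m hm hm'
      simp only [hA]
      rw [Finset.mem_Icc] at hm hm'
      rw [if_neg (by omega), mul_zero]
  rw [hTeq] at hT
  have hCS := norm_bilinear_sq_le I (Finset.Icc 1 M) b A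
  choose R hR1 hR2 hR3 using fun s t : ℝ => Polynomial.dilate_sub_dilate P hP s t
  set c : ℕ → ℕ → ℝ := fun n' n => ‖∑ m ∈ Finset.Icc 1 (min (y / n) (y / n')),
    phase ((R n n').eval (m : ℝ))‖ with hc
  have hinner : ∀ n' ∈ I, ∀ n ∈ I, ‖∑ m ∈ Finset.Icc 1 M, A n m * star (A n' m)‖ ≤ c n' n := by
    intro n' hn' n hn
    have : ∑ m ∈ Finset.Icc 1 M, A n m * star (A n' m) = a n * star (a n') *
        ∑ m ∈ Finset.Icc 1 (min (y / n) (y / n')), phase ((R n n').eval (m : ℝ)) := by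
      rw [Finset.mul_sum, ← Finset.sum_subset (Finset.Icc_subset_Icc_right
        ((min_le_left _ _).trans (hyn n hn)))]
      · refine Finset.sum_congr rfl fun m hm => ?_
        rw [Finset.mem_Icc, le_min_iff] at hm
        simp only [hA]
        rw [if_pos hm.2.1, if_pos hm.2.2, star_mul, star_phase, hR3, sub_eq_add_neg, phase_add]
        ring
      · intro m hm hm'
        rw [Finset.mem_Icc] at hm hm'
        simp only [hA]
        by_cases h1 : m ≤ y / n
        · rw [if_neg (show ¬ m ≤ y / n' by omega), star_zero, mul_zero]
        · rw [if_neg h1, zero_mul]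
    rw [this, norm_mul, norm_mul, norm_star]
    have := mul_le_one₀ (ha n) (norm_nonneg _) (ha n')
    exact mul_le_of_le_one_left (norm_nonneg _) this
  have hcM : ∀ n' n, n ∈ I → c n' n ≤ M := fun n' n hn => by
    refine (norm_sum_le _ _).trans ?_
    simp only [norm_phase, Finset.sum_const, Nat.card_Icc, Nat.add_sub_cancel, nsmul_eq_mul, mul_one]
    exact_mod_cast (min_le_left _ _).trans (hyn n hn)
  have hsum : δ * Y ^ 2 * M ≤ ∑ n' ∈ I, ∑ n ∈ I, c n' n := by
    have h1 : δ * Y ^ 2 * M * B ≤ (∑ n' ∈ I, ∑ n ∈ I, c n' n) * B := by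
      refine hT.trans (hCS.trans ?_)
      rw [mul_comm]
      have h0 : ∑ n' ∈ I, ∑ n ∈ I, ‖∑ m ∈ Finset.Icc 1 M, A n m * star (A n' m)‖ ≤
          ∑ n' ∈ I, ∑ n ∈ I, c n' n :=
        Finset.sum_le_sum fun n' hn' => Finset.sum_le_sum fun n hn => hinner n' hn' n hn
      exact mul_le_mul h0 hbB (Finset.sum_nonneg fun _ _ => by positivity)
        (Finset.sum_nonneg fun _ _ => Finset.sum_nonneg fun _ _ => norm_nonneg _)
    exact le_of_mul_le_mul_right h1 hB
  obtain ⟨n', hn', hn'sum⟩ : ∃ n' ∈ I, δ * Y * M ≤ ∑ n ∈ I, c n' n := by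
    by_contra hcon
    push Not at hcon
    have hne : I.Nonempty := Finset.card_pos.1 (by omega)
    have := Finset.sum_lt_sum_of_nonempty hne hcon
    rw [Finset.sum_const, hIcard, nsmul_eq_mul] at this
    nlinarith
  set S := I.filter (fun n => δ ^ 2 * M ≤ c n' n) with hS
  have hScard : δ ^ 2 * Y ≤ S.card := by
    have h1 : ∑ n ∈ I, c n' n ≤ S.card * M + Y * (δ ^ 2 * M) := by
      rw [← Finset.sum_filter_add_sum_filter_not I (fun n => δ ^ 2 * M ≤ c n' n)]
      refine add_le_add ?_ ?_
      · calc ∑ n ∈ S, c n' n ≤ ∑ n ∈ S, (M : ℝ) :=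
              Finset.sum_le_sum fun n hn => hcM n' n (Finset.mem_filter.1 hn).1
          _ = _ := by simp
      · calc _ ≤ ∑ n ∈ I.filter (fun n => ¬ δ ^ 2 * M ≤ c n' n), δ ^ 2 * M :=
              Finset.sum_le_sum fun n hn => (not_le.1 (Finset.mem_filter.1 hn).2).le
          _ ≤ _ := by
              rw [Finset.sum_const, nsmul_eq_mul]
              gcongr
              exact (Finset.card_filter_le _ _).trans hIcard.le
    have h2 : δ ^ 2 * Y * M ≤ S.card * M := by
      have : 2 * δ ^ 2 ≤ δ := by nlinarith
      have hYM : 0 < (Y : ℝ) * M := by positivity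
      nlinarith
    exact le_of_mul_le_mul_right h2 hM0
  set α := P.coeff (k + 1) with hα
  have hq : ∀ n ∈ S, ∃ q : ℕ, 1 ≤ q ∧ q ≤ Δ ^ (2 * C₁) ∧
      distInt (q * (((n : ℝ) ^ (k + 1) - (n' : ℝ) ^ (k + 1)) * α)) ≤
        Δ ^ (2 * C₁) / M ^ (k + 1) := by
    intro n hn
    rw [hS, Finset.mem_filter] at hn
    obtain ⟨q, h1, h2, h3⟩ := hW (δ ^ 2) (by positivity)
      ((pow_le_of_le_one hδ.le (by linarith) two_ne_zero).trans hδ2) M _ hMpos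
      ((min_le_left _ _).trans (hyn n hn.1)) (R n n') (hR1 _ _) hn.2
    rw [← inv_pow, ← hΔ, ← pow_mul] at h2 h3
    refine ⟨q, h1, h2, ?_⟩
    rw [le_div_iff₀ (by positivity), ← hR2]
    exact h3
  choose! q hq1 hqQ hqε using hq
  set Q := Δ ^ (2 * C₁) with hQ
  have hQ1 : 1 ≤ Q := one_le_pow₀ hΔ1
  have hQ0 : 0 < Q := by linarith
  obtain ⟨q₀, hq₀, hfib⟩ := Finset.exists_le_card_fiber_of_nsmul_le_card_of_maps_to
    (s := S) (t := Finset.Icc 1 ⌊Q⌋₊) (f := q) (b := δ ^ 2 / Q * Y)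
    (fun x hx => Finset.mem_Icc.2 ⟨hq1 x hx, Nat.le_floor (hqQ x hx)⟩)
    ⟨1, by simpa using (Nat.one_le_floor_iff _).2 hQ1⟩ (by
      rw [Nat.card_Icc, nsmul_eq_mul, Nat.add_sub_cancel]
      refine le_trans ?_ hScard
      have := Nat.floor_le hQ0.le
      calc (⌊Q⌋₊ : ℝ) * (δ ^ 2 / Q * Y) ≤ Q * (δ ^ 2 / Q * Y) := by gcongr
        _ = δ ^ 2 * Y := by field_simp)
  have hq₀1 := (Finset.mem_Icc.1 hq₀).1
  have hq₀Q : (q₀ : ℝ) ≤ Q := (Nat.cast_le.2 (Finset.mem_Icc.1 hq₀).2).trans (Nat.floor_le hQ0.le)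
  -- With n' and q₀ fixed, the Weyl information says that this polynomial in n is close to integers
  -- at many n; its top coefficient is q₀α.
  set L : Polynomial ℝ := Polynomial.C (q₀ * α) * Polynomial.X ^ (k + 1) -
    Polynomial.C (q₀ * ((n' : ℝ) ^ (k + 1) * α)) with hL
  have hLcoeff : L.coeff (k + 1) = q₀ * α := by
    rw [hL, Polynomial.coeff_sub, Polynomial.coeff_C_mul, Polynomial.coeff_X_pow, if_pos rfl,
      Polynomial.coeff_C, if_neg (by omega)]
    ring
  have hLdeg : L.natDegree ≤ k + 1 := by
    refine (Polynomial.natDegree_sub_le _ _).trans (max_le (Polynomial.natDegree_C_mul_X_pow_le _ _) ?_)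
    rw [Polynomial.natDegree_C]; omega
  have hδ' : δ ^ (3 + 2 * C₁) ≤ 1 / 2 :=
    (pow_le_of_le_one hδ.le (by linarith) (by omega)).trans hδ2
  have hQinv : δ ^ (2 * C₁) = 1 / Q := by rw [hQ, hΔ, inv_pow, one_div, inv_inv]
  obtain ⟨q', hq'1, hq'2, hq'3⟩ := hV (δ ^ (3 + 2 * C₁)) (by positivity) hδ' (Q / M ^ (k + 1)) (by
      rw [← pow_mul, ← hD, div_le_iff₀ (by positivity)]
      calc Q = (δ * Δ) ^ D * Q := by rw [hδΔ, one_pow, one_mul]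
        _ = δ ^ D * Δ ^ (2 * C₁ + D) := by rw [hQ, mul_pow, pow_add]; ring
        _ ≤ δ ^ D * M := by gcongr
        _ ≤ δ ^ D * (M : ℝ) ^ (k + 1) := by
            gcongr
            exact le_self_pow₀ (by exact_mod_cast hMpos) (by omega))
    (2 * Y) (by
      rw [← inv_pow, ← hΔ, ← pow_mul, ← hD]
      push_cast
      calc Δ ^ D ≤ Δ ^ (2 * C₁ + D) := hpw _ _ (by omega)
        _ ≤ Y := hY
        _ ≤ 2 * Y := by linarith)
    (S.filter (fun n => q n = q₀)) (by
      intro n hn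
      rw [Finset.mem_filter, hS, Finset.mem_filter, hI, Finset.mem_Ioc] at hn
      rw [Finset.mem_Icc]; omega) (by
      refine le_trans ?_ hfib
      push_cast
      rw [pow_add, hQinv]
      have : δ ^ 3 * 2 ≤ δ ^ 2 := by nlinarith [pow_pos hδ 2]
      calc δ ^ 3 * (1 / Q) * (2 * Y) = (δ ^ 3 * 2) / Q * Y := by ring
        _ ≤ δ ^ 2 / Q * Y := by gcongr) L hLdeg (by
      intro n hn
      rw [Finset.mem_filter] at hn
      have := hqε n hn.1
      rw [hn.2] at this
      convert this using 2
      simp [hL]; ring)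
  rw [← inv_pow, ← hΔ, ← pow_mul, ← hD] at hq'2 hq'3
  refine ⟨q' * q₀, one_le_mul hq'1 hq₀1, ?_, ?_⟩
  · push_cast
    calc (q' : ℝ) * q₀ ≤ Δ ^ D * Q := by gcongr
      _ = _ := by rw [hQ, pow_add, mul_comm]
  · rw [hLcoeff] at hq'3
    push_cast at hq'3 ⊢
    rw [mul_assoc, mul_pow]
    calc distInt (q' * (q₀ * α)) * ((Y : ℝ) ^ (k + 1) * M ^ (k + 1))
        ≤ distInt (q' * (q₀ * α)) * ((2 * Y : ℝ) ^ (k + 1) * M ^ (k + 1)) := by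
          have := distInt_nonneg (q' * (q₀ * α))
          gcongr
          linarith
      _ = (distInt (q' * (q₀ * α)) * (2 * Y : ℝ) ^ (k + 1)) * M ^ (k + 1) := by ring
      _ ≤ (Δ ^ D * (Q / M ^ (k + 1))) * M ^ (k + 1) := by gcongr
      _ = Δ ^ D * Q := by field_simp
      _ = _ := by rw [hQ, pow_add, mul_comm]

/-! ### Moments of the divisor function -/

theorem Nat.card_divisors_mul_le (a b : ℕ) :
    (a * b).divisors.card ≤ a.divisors.card * b.divisors.card := by
  classical
  rw [Nat.divisors_mul]
  exact Finset.card_mul_le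

theorem Nat.one_le_card_divisors {n : ℕ} (hn : 1 ≤ n) : 1 ≤ n.divisors.card :=
  Finset.card_pos.2 ⟨1, Nat.one_mem_divisors.2 (by omega)⟩

theorem Nat.card_divisors_le_of_dvd {d n : ℕ} (hn : 1 ≤ n) (h : d ∣ n) :
    d.divisors.card ≤ n.divisors.card :=
  Finset.card_le_card (Nat.divisors_subset_of_dvd (by omega) h)

theorem sum_multiples_eq {M : Type*} [AddCommMonoid M] (d N : ℕ) (hd : 0 < d) (f : ℕ → M) :
    ∑ n ∈ Finset.Icc 1 N with d ∣ n, f n = ∑ m ∈ Finset.Icc 1 (N / d), f (d * m) := by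
  symm
  refine Finset.sum_nbij' (fun m => d * m) (fun n => n / d) ?_ ?_ ?_ ?_ ?_
  · intro m hm
    rw [Finset.mem_Icc, Nat.le_div_iff_mul_le hd] at hm
    rw [Finset.mem_filter, Finset.mem_Icc]
    exact ⟨⟨one_le_mul hd hm.1, by rw [mul_comm]; exact hm.2⟩, dvd_mul_right _ _⟩
  · intro n hn
    rw [Finset.mem_filter, Finset.mem_Icc] at hn
    rw [Finset.mem_Icc]
    exact ⟨Nat.div_pos (Nat.le_of_dvd hn.1.1 hn.2) hd, Nat.div_le_div_right hn.1.2⟩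
  · intro m _
    exact Nat.mul_div_cancel_left _ hd
  · intro n hn
    rw [Finset.mem_filter] at hn
    exact Nat.mul_div_cancel' hn.2
  · intro _ _; rfl

theorem sum_sum_dvd_eq {M : Type*} [AddCommMonoid M] (D : Finset ℕ) (hD : ∀ d ∈ D, 0 < d) (N : ℕ)
    (F : ℕ → ℕ → M) :
    ∑ n ∈ Finset.Icc 1 N, ∑ d ∈ D with d ∣ n, F d n =
      ∑ d ∈ D, ∑ m ∈ Finset.Icc 1 (N / d), F d (d * m) := by
  simp only [Finset.sum_filter]
  rw [Finset.sum_comm]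
  refine Finset.sum_congr rfl fun d hd => ?_
  rw [← Finset.sum_filter, sum_multiples_eq d N (hD d hd)]

section Moments

variable (p : ℕ → Prop) [DecidablePred p]

/-- Induction on B through τ(n)·τ(n)^B ≤ ∑ τ(a)^B τ(b)^B over ab = n: each further factor τ squares
the sum. The factors a and b stay in the set because it is closed under factors. -/
theorem sum_divisor_pow_div_le (hp : ∀ a b, p (a * b) → p a ∧ p b) (B N : ℕ) :
    ∑ n ∈ Finset.Icc 1 N with p n, (n.divisors.card : ℝ) ^ B / n ≤
      (∑ n ∈ Finset.Icc 1 N with p n, 1 / (n : ℝ)) ^ 2 ^ B := by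
  induction B with
  | zero => simp
  | succ B ih =>
    set I := (Finset.Icc 1 N).filter p with hI
    have h1 : ∑ n ∈ I, (n.divisors.card : ℝ) ^ (B + 1) / n ≤
        ∑ n ∈ I, ∑ x ∈ n.divisorsAntidiagonal,
          (x.1.divisors.card : ℝ) ^ B / x.1 * ((x.2.divisors.card : ℝ) ^ B / x.2) := by
      refine Finset.sum_le_sum fun n hn => ?_
      have h2 : (n.divisors.card : ℝ) ^ (B + 1) / n =
          ∑ x ∈ n.divisorsAntidiagonal, (n.divisors.card : ℝ) ^ B / n := by
        rw [Nat.sum_divisorsAntidiagonal (f := fun _ _ => (n.divisors.card : ℝ) ^ B / n),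
          Finset.sum_const, nsmul_eq_mul]
        ring
      rw [h2]
      refine Finset.sum_le_sum fun x hx => ?_
      have hx' := (Nat.mem_divisorsAntidiagonal.1 hx).1
      rw [← hx', div_mul_div_comm, ← mul_pow]
      push_cast
      gcongr
      exact_mod_cast Nat.card_divisors_mul_le _ _
    refine h1.trans ?_
    rw [pow_succ 2 B, pow_mul, sq]
    refine le_trans ?_ (mul_le_mul ih ih (Finset.sum_nonneg fun _ _ => by positivity)
      (pow_nonneg (Finset.sum_nonneg fun _ _ => by positivity) _))
    rw [Finset.sum_mul_sum, ← Finset.sum_product', Finset.sum_sigma']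
    have hinj : Set.InjOn (fun y : (_ : ℕ) × ℕ × ℕ => y.2)
        (I.sigma fun n => n.divisorsAntidiagonal) := by
      rintro ⟨n, x⟩ hx ⟨n', x'⟩ hx' heq
      simp only [Finset.coe_sigma, Set.mem_sigma_iff, Finset.mem_coe,
        Nat.mem_divisorsAntidiagonal] at hx hx' heq
      subst heq
      obtain rfl : n = n' := hx.2.1.symm.trans hx'.2.1
      rfl
    rw [← Finset.sum_image (g := fun y : (_ : ℕ) × ℕ × ℕ => y.2)
      (f := fun x : ℕ × ℕ => (x.1.divisors.card : ℝ) ^ B / x.1 *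
        ((x.2.divisors.card : ℝ) ^ B / x.2)) hinj]
    refine Finset.sum_le_sum_of_subset_of_nonneg (fun x hx => ?_) fun _ _ _ => by positivity
    obtain ⟨⟨n, y⟩, hy, rfl⟩ := Finset.mem_image.1 hx
    simp only [Finset.mem_sigma, hI, Finset.mem_filter, Finset.mem_Icc,
      Nat.mem_divisorsAntidiagonal] at hy
    obtain ⟨⟨⟨hn1, hnN⟩, hpn⟩, hyn, -⟩ := hy
    rw [← hyn] at hpn hn1 hnN
    have h1 : 1 ≤ y.1 := Nat.one_le_iff_ne_zero.2 (left_ne_zero_of_mul (b := y.2) (by omega))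
    have h2 : 1 ≤ y.2 := Nat.one_le_iff_ne_zero.2 (right_ne_zero_of_mul (a := y.1) (by omega))
    simp only [Finset.mem_product, hI, Finset.mem_filter, Finset.mem_Icc]
    exact ⟨⟨⟨h1, (Nat.le_mul_of_pos_right _ h2).trans hnN⟩, (hp _ _ hpn).1⟩,
      ⟨⟨h2, (Nat.le_mul_of_pos_left _ h1).trans hnN⟩, (hp _ _ hpn).2⟩⟩

theorem sum_one_div_le (N : ℕ) : ∑ n ∈ Finset.Icc 1 N, 1 / (n : ℝ) ≤ 1 + Real.log N := by
  have := harmonic_le_one_add_log N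
  rw [harmonic_eq_sum_Icc] at this
  push_cast at this
  simpa [one_div] using this

theorem sum_divisor_pow_div_le_log (B N : ℕ) :
    ∑ n ∈ Finset.Icc 1 N, (n.divisors.card : ℝ) ^ B / n ≤ (1 + Real.log N) ^ 2 ^ B := by
  have h := sum_divisor_pow_div_le (fun _ => True) (fun _ _ _ => ⟨trivial, trivial⟩) B N
  simp only [Finset.filter_true] at h
  exact h.trans (pow_le_pow_left₀ (Finset.sum_nonneg fun _ _ => by positivity) (sum_one_div_le N) _)

theorem sum_divisor_pow_le (B N : ℕ) :
    ∑ n ∈ Finset.Icc 1 N, (n.divisors.card : ℝ) ^ B ≤ N * (1 + Real.log N) ^ 2 ^ B := by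
  refine le_trans ?_ (mul_le_mul_of_nonneg_left (sum_divisor_pow_div_le_log B N) N.cast_nonneg)
  rw [Finset.mul_sum]
  refine Finset.sum_le_sum fun n hn => ?_
  rw [Finset.mem_Icc] at hn
  have h1 : (0 : ℝ) < n := by exact_mod_cast hn.1
  have h2 : (n : ℝ) ≤ N := by exact_mod_cast hn.2
  rw [mul_div_assoc', le_div_iff₀ h1, mul_comm]
  gcongr

end Moments

/-- A union bound over p: write n = p²m, use τ(p²m) ≤ 3τ(m), and sum 1/p² over p > Y. -/
theorem sum_divisor_pow_sq_dvd_le (T : Finset ℕ) {Y : ℕ} (hY : 1 ≤ Y)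
    (hT : ∀ p ∈ T, p.Prime ∧ Y < p) (B N : ℕ) :
    ∑ n ∈ Finset.Icc 1 N with ∃ p ∈ T, p ^ 2 ∣ n, (n.divisors.card : ℝ) ^ B ≤
      3 ^ B * (N * (1 + Real.log N) ^ 2 ^ B) / Y := by
  have h1 : ∑ n ∈ Finset.Icc 1 N with ∃ p ∈ T, p ^ 2 ∣ n, (n.divisors.card : ℝ) ^ B ≤
      ∑ p ∈ T, ∑ m ∈ Finset.Icc 1 (N / p ^ 2), ((p ^ 2 * m).divisors.card : ℝ) ^ B := by
    have h2 : ∀ p ∈ T, ∑ m ∈ Finset.Icc 1 (N / p ^ 2), ((p ^ 2 * m).divisors.card : ℝ) ^ B =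
        ∑ n ∈ Finset.Icc 1 N, if p ^ 2 ∣ n then (n.divisors.card : ℝ) ^ B else 0 := fun p hp => by
      rw [← Finset.sum_filter, sum_multiples_eq _ _ (pow_pos (hT p hp).1.pos 2)]
    rw [Finset.sum_congr rfl h2, Finset.sum_comm, Finset.sum_filter]
    refine Finset.sum_le_sum fun n _ => ?_
    split_ifs with h
    · obtain ⟨p, hp, hpn⟩ := h
      refine le_trans (le_of_eq ?_) (Finset.single_le_sum
        (f := fun p => if p ^ 2 ∣ n then (n.divisors.card : ℝ) ^ B else 0)
        (fun p _ => by positivity) hp)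
      simp [hpn]
    · exact Finset.sum_nonneg fun p _ => by positivity
  refine h1.trans ?_
  set W := (1 + Real.log N) ^ 2 ^ B with hW
  have hW0 : 0 ≤ W := pow_nonneg (by have := Real.log_natCast_nonneg N; linarith) _
  have h3 : ∀ p ∈ T, ∑ m ∈ Finset.Icc 1 (N / p ^ 2), ((p ^ 2 * m).divisors.card : ℝ) ^ B ≤
      3 ^ B * (N * W) * ((p : ℝ) ^ 2)⁻¹ := by
    intro p hp
    have hp0 : (0 : ℝ) < p := by exact_mod_cast (hT p hp).1.pos
    calc ∑ m ∈ Finset.Icc 1 (N / p ^ 2), ((p ^ 2 * m).divisors.card : ℝ) ^ B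
        ≤ ∑ m ∈ Finset.Icc 1 (N / p ^ 2), 3 ^ B * (m.divisors.card : ℝ) ^ B := by
          refine Finset.sum_le_sum fun m _ => ?_
          rw [← mul_pow]
          gcongr
          have := Nat.card_divisors_mul_le (p ^ 2) m
          rw [Nat.divisors_prime_pow (hT p hp).1, Finset.card_map, Finset.card_range] at this
          exact_mod_cast this
      _ = 3 ^ B * ∑ m ∈ Finset.Icc 1 (N / p ^ 2), (m.divisors.card : ℝ) ^ B := by
          rw [Finset.mul_sum]
      _ ≤ 3 ^ B * (((N / p ^ 2 : ℕ) : ℝ) * (1 + Real.log (N / p ^ 2 : ℕ)) ^ 2 ^ B) := by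
          gcongr; exact sum_divisor_pow_le _ _
      _ ≤ 3 ^ B * ((N / (p : ℝ) ^ 2) * W) := by
          rcases Nat.eq_zero_or_pos (N / p ^ 2) with h0 | h0
          · rw [h0]; simp; positivity
          have h4 : ((N / p ^ 2 : ℕ) : ℝ) ≤ N / (p : ℝ) ^ 2 := by
            have := Nat.cast_div_le (α := ℝ) (m := N) (n := p ^ 2)
            push_cast at this; exact this
          have h5 : Real.log (N / p ^ 2 : ℕ) ≤ Real.log N :=
            Real.log_le_log (by exact_mod_cast h0) (by exact_mod_cast Nat.div_le_self _ _)
          have h6 := Real.log_natCast_nonneg (N / p ^ 2)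
          have h7 : (1 + Real.log (N / p ^ 2 : ℕ)) ^ 2 ^ B ≤ W :=
            pow_le_pow_left₀ (by linarith) (by linarith) _
          gcongr
      _ = _ := by ring
  refine (Finset.sum_le_sum h3).trans ?_
  rw [← Finset.mul_sum, div_eq_mul_inv]
  refine mul_le_mul_of_nonneg_left ?_ (by positivity)
  have hsub : T ⊆ Finset.Ioc Y (max (Y + 1) (T.sup id)) := fun p hp =>
    Finset.mem_Ioc.2 ⟨(hT p hp).2, (Finset.le_sup (f := id) hp).trans (le_max_right _ _)⟩
  calc ∑ p ∈ T, ((p : ℝ) ^ 2)⁻¹ ≤ ∑ p ∈ Finset.Ioc Y (max (Y + 1) (T.sup id)), ((p : ℝ) ^ 2)⁻¹ :=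
        Finset.sum_le_sum_of_subset_of_nonneg hsub fun _ _ _ => by positivity
    _ ≤ (Y : ℝ)⁻¹ - ((max (Y + 1) (T.sup id) : ℕ) : ℝ)⁻¹ :=
        sum_Ioc_inv_sq_le_sub (by omega) (le_trans (Nat.le_succ _) (le_max_left _ _))
    _ ≤ _ := sub_le_self _ (by positivity)

/-- Used for prime powers p^a, where τ = a + 1, and with a = 2^j, where it shows that a fixed power
of the block size beats every power of its logarithm. -/
theorem exists_succ_pow_le_sqrt_two_pow (B : ℕ) :
    ∃ K : ℝ, 0 ≤ K ∧ ∀ a : ℕ, ((a : ℝ) + 1) ^ B ≤ K * √2 ^ a := by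
  set c := Real.log √2 with hc
  have h2 : (1 : ℝ) < √2 := by
    rw [Real.lt_sqrt zero_le_one]; norm_num
  have hc0 : 0 < c := Real.log_pos h2
  have hexp : ∀ a : ℕ, Real.exp (((a : ℝ) + 1) * c) = √2 * √2 ^ a := fun a => by
    rw [mul_comm, Real.exp_mul, hc, Real.exp_log (by linarith), ← Nat.cast_succ, Real.rpow_natCast,
      pow_succ']
  refine ⟨B.factorial * √2 / c ^ B, by positivity, fun a => ?_⟩
  have h := Real.pow_div_factorial_le_exp (((a : ℝ) + 1) * c) (by positivity) B
  rw [hexp, div_le_iff₀ (by positivity), mul_pow] at h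
  rw [div_mul_eq_mul_div, le_div_iff₀ (by positivity)]
  linarith

/-- Primes have τ = 2 and total mass at most ψ(N) ≪ N. Proper prime powers have τ^B ≪ √N, but their
mass is only ψ(N) - θ(N) ≪ √N. -/
theorem sum_vonMangoldt_mul_divisor_pow_le (B : ℕ) : ∃ K : ℝ, 0 ≤ K ∧ ∀ N : ℕ,
    ∑ n ∈ Finset.Icc 1 N, ArithmeticFunction.vonMangoldt n * (n.divisors.card : ℝ) ^ B ≤ K * N := by
  obtain ⟨K₁, hK₁, h₁⟩ := exists_succ_pow_le_sqrt_two_pow B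
  obtain ⟨C, hC⟩ := Chebyshev.psi_sub_theta_le_mul_sqrt
  have hlog4 : 0 ≤ Real.log 4 := Real.log_nonneg (by norm_num)
  refine ⟨2 ^ B * (Real.log 4 + 4) + K₁ * max C 0, by positivity, fun N => ?_⟩
  have hIoc : Finset.Icc 1 N = Finset.Ioc 0 ⌊(N : ℝ)⌋₊ := by
    rw [Nat.floor_natCast]; rfl
  rw [← Finset.sum_filter_add_sum_filter_not _ Nat.Prime, add_mul]
  refine add_le_add ?_ ?_
  · calc ∑ n ∈ Finset.Icc 1 N with n.Prime,
          ArithmeticFunction.vonMangoldt n * (n.divisors.card : ℝ) ^ B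
        = ∑ n ∈ Finset.Icc 1 N with n.Prime, ArithmeticFunction.vonMangoldt n * 2 ^ B := by
          refine Finset.sum_congr rfl fun n hn => ?_
          rw [Nat.Prime.divisors (Finset.mem_filter.1 hn).2,
            Finset.card_pair (Finset.mem_filter.1 hn).2.one_lt.ne]
          norm_num
      _ ≤ ∑ n ∈ Finset.Icc 1 N, ArithmeticFunction.vonMangoldt n * 2 ^ B :=
          Finset.sum_le_sum_of_subset_of_nonneg (Finset.filter_subset _ _) fun _ _ _ =>
            mul_nonneg ArithmeticFunction.vonMangoldt_nonneg (by positivity)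
      _ = 2 ^ B * Chebyshev.psi N := by
          rw [← Finset.sum_mul, Chebyshev.psi, hIoc, mul_comm]
      _ ≤ 2 ^ B * ((Real.log 4 + 4) * N) := by
          gcongr; exact Chebyshev.psi_le_const_mul_self N.cast_nonneg
      _ = _ := by ring
  · calc ∑ n ∈ Finset.Icc 1 N with ¬ n.Prime,
          ArithmeticFunction.vonMangoldt n * (n.divisors.card : ℝ) ^ B
        ≤ ∑ n ∈ Finset.Icc 1 N with ¬ n.Prime, ArithmeticFunction.vonMangoldt n * (K₁ * √N) := by
          refine Finset.sum_le_sum fun n hn => ?_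
          rcases eq_or_ne (ArithmeticFunction.vonMangoldt n) 0 with h0 | h0
          · rw [h0, zero_mul, zero_mul]
          refine mul_le_mul_of_nonneg_left ?_ ArithmeticFunction.vonMangoldt_nonneg
          rw [ArithmeticFunction.vonMangoldt_ne_zero_iff] at h0
          obtain ⟨p, a, hp, ha, rfl⟩ := (isPrimePow_nat_iff n).1 h0
          rw [Nat.divisors_prime_pow hp, Finset.card_map, Finset.card_range]
          push_cast
          refine (h₁ a).trans (mul_le_mul_of_nonneg_left ?_ hK₁)
          rw [Real.le_sqrt (by positivity) N.cast_nonneg, ← pow_mul, mul_comm, pow_mul,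
            Real.sq_sqrt zero_le_two]
          have hpa := (Finset.mem_Icc.1 (Finset.mem_filter.1 hn).1).2
          exact_mod_cast (Nat.pow_le_pow_left hp.two_le a).trans hpa
      _ = K₁ * √N * (Chebyshev.psi N - Chebyshev.theta N) := by
          rw [Chebyshev.psi_sub_theta_eq_sum_not_prime, ← Finset.sum_mul, mul_comm, ← hIoc]
      _ ≤ K₁ * √N * (max C 0 * √N) := by
          gcongr
          exact (hC N).trans (by gcongr; exact le_max_left _ _)
      _ = K₁ * max C 0 * (√N * √N) := by ring
      _ = _ := by rw [Real.mul_self_sqrt N.cast_nonneg]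

/-- Sums of powers of the divisor function over a factor-closed set of integers. -/
theorem sum_divisor_pow_sieved_le (B : ℕ) : ∃ K : ℝ, 0 ≤ K ∧ ∀ (p : ℕ → Prop) [DecidablePred p],
    (∀ a b, p (a * b) → p a ∧ p b) → ∀ N : ℕ, 1 ≤ N →
    (∑ n ∈ Finset.Icc 1 N with p n, (n.divisors.card : ℝ) ^ B) * Real.log N ≤
      K * N * (∑ n ∈ Finset.Icc 1 N with p n, 1 / (n : ℝ)) ^ 2 ^ B := by
  obtain ⟨K, hK, hΛ⟩ := sum_vonMangoldt_mul_divisor_pow_le B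
  refine ⟨K + 1, by positivity, fun p _ hp N hN => ?_⟩
  set I := Finset.Icc 1 N with hI
  set F := ∑ n ∈ I with p n, (n.divisors.card : ℝ) ^ B / n with hF
  have hFle : F ≤ (∑ n ∈ I with p n, 1 / (n : ℝ)) ^ 2 ^ B := sum_divisor_pow_div_le p hp B N
  refine le_trans ?_ (mul_le_mul_of_nonneg_left hFle (by positivity))
  have hN0 : (0 : ℝ) < N := by exact_mod_cast hN
  set f : ℕ → ℝ := fun n => if p n then (n.divisors.card : ℝ) ^ B else 0 with hf
  have hf0 : ∀ n, 0 ≤ f n := fun n => by simp only [hf]; positivity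
  have hfmul : ∀ d m, f (d * m) ≤ (d.divisors.card : ℝ) ^ B * f m := fun d m => by
    simp only [hf]
    split_ifs with h1 h2
    · rw [← mul_pow]
      gcongr
      exact_mod_cast Nat.card_divisors_mul_le d m
    · exact absurd (hp _ _ h1).2 h2
    · positivity
    · simp
  have hFf : F = ∑ n ∈ I, f n / n := by
    rw [hF, Finset.sum_filter]
    refine Finset.sum_congr rfl fun n _ => ?_
    simp only [hf]
    split_ifs <;> simp
  have hSf : ∑ n ∈ I with p n, (n.divisors.card : ℝ) ^ B = ∑ n ∈ I, f n := by
    rw [Finset.sum_filter]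
  rw [hSf, hFf, Finset.sum_mul]
  have hI1 : ∀ n ∈ I, (0 : ℝ) < n ∧ (n : ℝ) ≤ N := fun n hn => by
    rw [hI, Finset.mem_Icc] at hn
    exact ⟨by exact_mod_cast hn.1, by exact_mod_cast hn.2⟩
  -- log N = log n + log(N/n), and log(N/n) ≤ N/n turns the second piece into the harmonic-type sum
  -- at once.
  have hsplit : ∑ n ∈ I, f n * Real.log N ≤
      ∑ n ∈ I, f n * Real.log n + ∑ n ∈ I, N * (f n / n) := by
    rw [← Finset.sum_add_distrib]
    refine Finset.sum_le_sum fun n hn => ?_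
    obtain ⟨h1, h2⟩ := hI1 n hn
    have h3 : Real.log N - Real.log n ≤ N / n := by
      rw [← Real.log_div hN0.ne' h1.ne']
      exact (Real.log_le_sub_one_of_pos (by positivity)).trans (by linarith)
    calc f n * Real.log N = f n * Real.log n + f n * (Real.log N - Real.log n) := by ring
      _ ≤ f n * Real.log n + f n * (N / n) := by
          gcongr
      _ = _ := by ring
  -- Expand log n as the sum of Λ(d) over d ∣ n, put n = dm, and use f(dm) ≤ τ(d)^B f(m); after
  -- exchanging sums, the sum over d ≤ N/m is O(N/m).
  have hmain : ∑ n ∈ I, f n * Real.log n ≤ K * N * ∑ n ∈ I, f n / n := by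
    calc ∑ n ∈ I, f n * Real.log n
        = ∑ n ∈ I, ∑ d ∈ I with d ∣ n, ArithmeticFunction.vonMangoldt d * f n := by
          refine Finset.sum_congr rfl fun n hn => ?_
          rw [← ArithmeticFunction.vonMangoldt_sum, Finset.mul_sum]
          rw [hI, Finset.mem_Icc] at hn
          refine Finset.sum_congr ?_ fun _ _ => mul_comm _ _
          ext d
          rw [Nat.mem_divisors, Finset.mem_filter, hI, Finset.mem_Icc]
          constructor
          · intro h
            exact ⟨⟨Nat.pos_of_dvd_of_pos h.1 hn.1, (Nat.le_of_dvd hn.1 h.1).trans hn.2⟩, h.1⟩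
          · intro h
            exact ⟨h.2, by omega⟩
      _ = ∑ d ∈ I, ∑ m ∈ Finset.Icc 1 (N / d), ArithmeticFunction.vonMangoldt d * f (d * m) :=
          sum_sum_dvd_eq I (fun d hd => (Finset.mem_Icc.1 hd).1) N
            (fun d n => ArithmeticFunction.vonMangoldt d * f n)
      _ ≤ ∑ d ∈ I, ∑ m ∈ Finset.Icc 1 (N / d),
            ArithmeticFunction.vonMangoldt d * ((d.divisors.card : ℝ) ^ B * f m) := by
          refine Finset.sum_le_sum fun d _ => Finset.sum_le_sum fun m _ => ?_
          exact mul_le_mul_of_nonneg_left (hfmul d m) ArithmeticFunction.vonMangoldt_nonneg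
      _ = ∑ m ∈ I, ∑ d ∈ Finset.Icc 1 (N / m),
            ArithmeticFunction.vonMangoldt d * ((d.divisors.card : ℝ) ^ B * f m) := by
          refine Finset.sum_comm' fun d m => ?_
          simp only [hI, Finset.mem_Icc]
          constructor
          · rintro ⟨⟨h1, _⟩, h3, h4⟩
            rw [Nat.le_div_iff_mul_le h1] at h4
            exact ⟨⟨h1, (Nat.le_div_iff_mul_le h3).2 (by rwa [mul_comm])⟩, h3,
              (Nat.le_mul_of_pos_right _ h1).trans h4⟩
          · rintro ⟨⟨h1, h4⟩, h3, _⟩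
            rw [Nat.le_div_iff_mul_le h3] at h4
            exact ⟨⟨h1, (Nat.le_mul_of_pos_right _ h3).trans h4⟩, h3,
              (Nat.le_div_iff_mul_le h1).2 (by rwa [mul_comm])⟩
      _ = ∑ m ∈ I, f m * ∑ d ∈ Finset.Icc 1 (N / m),
            ArithmeticFunction.vonMangoldt d * (d.divisors.card : ℝ) ^ B := by
          refine Finset.sum_congr rfl fun m _ => ?_
          rw [Finset.mul_sum]
          exact Finset.sum_congr rfl fun d _ => by ring
      _ ≤ ∑ m ∈ I, f m * (K * (N / m)) := by
          refine Finset.sum_le_sum fun m _ => mul_le_mul_of_nonneg_left ?_ (hf0 m)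
          exact (hΛ _).trans (mul_le_mul_of_nonneg_left Nat.cast_div_le hK)
      _ = _ := by
          rw [Finset.mul_sum]
          exact Finset.sum_congr rfl fun m _ => by ring
  calc ∑ n ∈ I, f n * Real.log N ≤ _ := hsplit
    _ ≤ K * N * ∑ n ∈ I, f n / n + N * ∑ n ∈ I, f n / n := by
        rw [← Finset.mul_sum]; gcongr
    _ = _ := by ring

/-! ### Reciprocals of primes and the sifted harmonic sum -/

/-- Chebyshev's bound for θ, with log p ≥ i log 2 on the range. The shift to i + 1 admits i = 0,
where the only prime is 2. -/
theorem sum_prime_inv_dyadic_le (i : ℕ) :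
    ∑ p ∈ Finset.Ioc ((2 : ℕ) ^ i) (2 ^ (i + 1)) with p.Prime, 1 / (p : ℝ) ≤ 8 / (i + 1) := by
  rcases Nat.eq_zero_or_pos i with rfl | hi
  · calc ∑ p ∈ Finset.Ioc ((2 : ℕ) ^ 0) (2 ^ (0 + 1)) with p.Prime, 1 / (p : ℝ)
        ≤ ∑ p ∈ Finset.Ioc ((2 : ℕ) ^ 0) (2 ^ (0 + 1)), 1 / (p : ℝ) :=
          Finset.sum_le_sum_of_subset_of_nonneg (Finset.filter_subset _ _) fun _ _ _ => by positivity
      _ ≤ 8 / ((0 : ℕ) + 1) := by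
          have : Finset.Ioc ((2 : ℕ) ^ 0) (2 ^ (0 + 1)) = {2} := by decide
          rw [this]; norm_num
  have hi' : (0 : ℝ) < i := by exact_mod_cast hi
  have hi1 : (1 : ℝ) ≤ i := by exact_mod_cast hi
  have hl2 : 0 < Real.log 2 := Real.log_pos one_lt_two
  have h1 : ∑ p ∈ Finset.Ioc ((2 : ℕ) ^ i) (2 ^ (i + 1)) with p.Prime, 1 / (p : ℝ) ≤
      ∑ p ∈ Finset.Ioc ((2 : ℕ) ^ i) (2 ^ (i + 1)) with p.Prime,
        Real.log p * (1 / (2 ^ i * (i * Real.log 2))) := by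
    refine Finset.sum_le_sum fun p hp => ?_
    rw [Finset.mem_filter, Finset.mem_Ioc] at hp
    have hp1 : (2 : ℝ) ^ i ≤ p := by exact_mod_cast hp.1.1.le
    have hlog : i * Real.log 2 ≤ Real.log p := by
      rw [← Real.log_pow]
      exact Real.log_le_log (by positivity) hp1
    have hp0 : (0 : ℝ) < p := lt_of_lt_of_le (by positivity) hp1
    rw [mul_one_div, div_le_div_iff₀ (by positivity) (by positivity), one_mul, mul_comm (Real.log _)]
    gcongr
  refine h1.trans ?_
  rw [← Finset.sum_mul]
  have h2 : ∑ p ∈ Finset.Ioc ((2 : ℕ) ^ i) (2 ^ (i + 1)) with p.Prime, Real.log p ≤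
      Real.log 4 * 2 ^ (i + 1) := by
    calc _ ≤ Chebyshev.theta ((2 ^ (i + 1) : ℕ) : ℝ) := by
          rw [Chebyshev.theta, Nat.floor_natCast]
          refine Finset.sum_le_sum_of_subset_of_nonneg ?_ fun p _ _ => Real.log_natCast_nonneg p
          exact Finset.filter_subset_filter _ (Finset.Ioc_subset_Ioc_left (Nat.zero_le _))
      _ ≤ Real.log 4 * ((2 ^ (i + 1) : ℕ) : ℝ) := Chebyshev.theta_le_log4_mul_x (by positivity)
      _ = _ := by push_cast; ring
  calc _ ≤ Real.log 4 * 2 ^ (i + 1) * (1 / (2 ^ i * (i * Real.log 2))) := by gcongr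
    _ = 4 / i := by
        have : Real.log 4 = 2 * Real.log 2 := by
          rw [show (4 : ℝ) = 2 ^ 2 by norm_num, Real.log_pow]; norm_num
        rw [this, pow_succ]; field_simp; norm_num
    _ ≤ _ := by
        rw [div_le_div_iff₀ hi' (by positivity)]; linarith

theorem sum_prime_inv_Ioc_le (a b : ℕ) (hab : a ≤ b) :
    ∑ p ∈ Finset.Ioc ((2 : ℕ) ^ a) (2 ^ b) with p.Prime, 1 / (p : ℝ) ≤
      ∑ i ∈ Finset.Ico a b, 8 / ((i : ℝ) + 1) := by
  induction b, hab using Nat.le_induction with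
  | base => simp
  | succ b hab ih =>
    rw [Finset.sum_Ico_succ_top hab]
    refine le_trans (le_of_eq ?_) (add_le_add ih (sum_prime_inv_dyadic_le b))
    rw [← Finset.sum_union]
    · rw [← Finset.filter_union, Finset.Ioc_union_Ioc_eq_Ioc] <;>
        exact Nat.pow_le_pow_right two_pos (by omega)
    · refine Finset.disjoint_filter_filter ?_
      exact Finset.Ioc_disjoint_Ioc_of_le le_rfl

theorem sum_inv_succ_le_log (a b : ℕ) (ha : 1 ≤ a) (hab : a ≤ b) :
    ∑ i ∈ Finset.Ico a b, 8 / ((i : ℝ) + 1) ≤ 8 * (Real.log b - Real.log a) := by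
  induction b, hab using Nat.le_induction with
  | base => simp
  | succ b hab ih =>
    rw [Finset.sum_Ico_succ_top hab]
    have hb : (0 : ℝ) < b := by exact_mod_cast (by omega : 0 < b)
    have h1 : 1 / ((b : ℝ) + 1) ≤ Real.log (b + 1) - Real.log b := by
      have := Real.log_le_sub_one_of_pos (x := b / (b + 1)) (by positivity)
      rw [Real.log_div (by positivity) (by positivity)] at this
      have h2 : (b : ℝ) / (b + 1) - 1 = - (1 / (b + 1)) := by field_simp; ring
      linarith
    push_cast
    have : 8 / ((b : ℝ) + 1) = 8 * (1 / (b + 1)) := by ring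
    linarith

/-- Upper bound for the harmonic sum over integers all of whose prime factors avoid `T`. -/
theorem sum_inv_avoiding_le (T : Finset ℕ) (N : ℕ) :
    ∑ n ∈ Finset.Icc 1 N with ∀ p ∈ T, ¬ p ∣ n, 1 / (n : ℝ) ≤
      Real.exp (2 * ∑ p ∈ Finset.Icc 1 N \ T with p.Prime, 1 / (p : ℝ)) := by
  set s := Finset.Icc 1 N \ T with hs
  set f : ℕ →* ℝ :=
    { toFun := fun n => 1 / (n : ℝ), map_one' := by simp, map_mul' := fun a b => by push_cast; ring }
    with hf
  have hfn : ∀ n, f n = 1 / (n : ℝ) := fun n => rfl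
  have hE := EulerProduct.summable_and_hasSum_factoredNumbers_prod_filter_prime_geometric (f := f)
    (fun {p} hp => by
      rw [hfn, norm_div, norm_one, Real.norm_natCast]
      rw [div_lt_one (by exact_mod_cast hp.pos)]
      exact_mod_cast hp.one_lt) s
  have h1 : ∑ n ∈ Finset.Icc 1 N with ∀ p ∈ T, ¬ p ∣ n, 1 / (n : ℝ) ≤
      ∏ p ∈ s with p.Prime, (1 - f p)⁻¹ := by
    have hmem : ∀ n ∈ (Finset.Icc 1 N).filter (fun n => ∀ p ∈ T, ¬ p ∣ n),
        n ∈ Nat.factoredNumbers s := fun n hn => by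
      rw [Finset.mem_filter, Finset.mem_Icc] at hn
      rw [Nat.mem_factoredNumbers']
      intro p hp hpn
      rw [hs, Finset.mem_sdiff, Finset.mem_Icc]
      exact ⟨⟨hp.pos, (Nat.le_of_dvd hn.1.1 hpn).trans hn.1.2⟩, fun hpT => hn.2 p hpT hpn⟩
    have := sum_le_hasSum (((Finset.Icc 1 N).filter (fun n => ∀ p ∈ T, ¬ p ∣ n)).attach.map
      ⟨fun n => (⟨n.1, hmem n.1 n.2⟩ : Nat.factoredNumbers s), fun a b hab =>
        Subtype.ext (Subtype.mk.inj hab)⟩) (fun m _ => by rw [hfn]; positivity) hE.2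
    rw [Finset.sum_map] at this
    refine le_trans (le_of_eq ?_) this
    rw [← Finset.sum_attach]
    rfl
  refine h1.trans ?_
  rw [Finset.mul_sum, Real.exp_sum]
  refine Finset.prod_le_prod (fun p hp => ?_) fun p hp => ?_
  · have hp' := (Finset.mem_filter.1 hp).2
    rw [hfn, inv_nonneg, sub_nonneg, div_le_one (by exact_mod_cast hp'.pos)]
    exact_mod_cast hp'.one_lt.le
  · have hp' := (Finset.mem_filter.1 hp).2
    have h2 : (2 : ℝ) ≤ p := by exact_mod_cast hp'.two_le
    rw [hfn]
    have hx : 1 / (p : ℝ) ≤ 1 / 2 := one_div_le_one_div_of_le two_pos h2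
    have hx0 : 0 ≤ 1 / (p : ℝ) := by positivity
    set x := 1 / (p : ℝ)
    -- For 0 ≤ x ≤ 1/2 one has (1 - x)(1 + 2x) ≥ 1, hence 1/(1 - x) ≤ e^(2x).
    rw [inv_le_iff_one_le_mul₀ (by linarith)]
    have h3 := Real.add_one_le_exp (2 * x)
    nlinarith

/-! ### Blocks and prime windows -/

/-- The integer `n` lies in the `j`-th block when `2 ^ 2 ^ j ≤ n < 2 ^ 2 ^ (j + 1)`. -/
def blockIndex (n : ℕ) : ℕ := Nat.log 2 (Nat.log 2 n)

/-- The primes whose presence as a factor is required in the `j`-th block. -/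
def primeWindow (j : ℕ) : Finset ℕ :=
  (Finset.Ioc (2 ^ j ^ 2) (2 ^ (2 ^ j / (j ^ 2 + 1)))).filter Nat.Prime

theorem prime_of_mem_primeWindow {j p : ℕ} (h : p ∈ primeWindow j) : p.Prime :=
  (Finset.mem_filter.1 h).2

theorem lt_of_mem_primeWindow {j p : ℕ} (h : p ∈ primeWindow j) : 2 ^ j ^ 2 < p :=
  (Finset.mem_Ioc.1 (Finset.mem_filter.1 h).1).1

theorem le_of_mem_primeWindow {j p : ℕ} (h : p ∈ primeWindow j) : p ≤ 2 ^ (2 ^ j / (j ^ 2 + 1)) :=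
  (Finset.mem_Ioc.1 (Finset.mem_filter.1 h).1).2

theorem blockIndex_eq {j n : ℕ} (h1 : 2 ^ 2 ^ j ≤ n) (h2 : n < 2 ^ 2 ^ (j + 1)) :
    blockIndex n = j := by
  have hn : n ≠ 0 := by have := Nat.one_le_two_pow (n := 2 ^ j); omega
  have h3 : 2 ^ j ≤ Nat.log 2 n := Nat.le_log_of_pow_le one_lt_two h1
  have h4 : Nat.log 2 n < 2 ^ (j + 1) := Nat.log_lt_of_lt_pow hn h2
  exact (Nat.log_eq_iff (Or.inr ⟨one_lt_two, by have := Nat.one_le_two_pow (n := j); omega⟩)).2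
    ⟨h3, h4⟩

theorem blockIndex_eq_zero {n : ℕ} (h : n < 4) : blockIndex n = 0 := by
  interval_cases n <;> decide

theorem two_pow_blockIndex_le {n : ℕ} (hn : 2 ≤ n) : 2 ^ 2 ^ blockIndex n ≤ n := by
  have h1 : Nat.log 2 n ≠ 0 := (Nat.log_pos one_lt_two hn).ne'
  exact (Nat.pow_le_pow_right two_pos (Nat.pow_log_le_self 2 h1)).trans
    (Nat.pow_log_le_self 2 (by omega))

theorem lt_two_pow_blockIndex_succ (n : ℕ) : n < 2 ^ 2 ^ (blockIndex n + 1) :=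
  (Nat.lt_pow_succ_log_self one_lt_two n).trans_le
    (Nat.pow_le_pow_right two_pos (Nat.lt_pow_succ_log_self one_lt_two _))

theorem two_pow_two_pow_succ (j : ℕ) : 2 ^ 2 ^ (j + 1) = (2 ^ 2 ^ j) ^ 2 := by
  rw [← pow_mul, pow_succ 2 j]

theorem one_add_log_le {j N : ℕ} (h : N ≤ 2 ^ 2 ^ (j + 1)) : 1 + Real.log N ≤ 3 * 2 ^ j := by
  have h1 : (1 : ℝ) ≤ 2 ^ j := one_le_pow₀ one_le_two
  rcases Nat.eq_zero_or_pos N with rfl | hN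
  · simp; linarith
  have h2 : Real.log N ≤ 2 ^ (j + 1) * Real.log 2 := by
    have : Real.log N ≤ Real.log ((2 : ℝ) ^ 2 ^ (j + 1)) :=
      Real.log_le_log (by exact_mod_cast hN) (by exact_mod_cast h)
    rw [Real.log_pow] at this
    push_cast at this; exact this
  have h3 : Real.log 2 ≤ 1 := by have := Real.log_two_lt_d9; linarith
  have h4 : (2 : ℝ) ^ (j + 1) * Real.log 2 ≤ 2 ^ (j + 1) * 1 := by gcongr
  rw [pow_succ] at h2 h4
  linarith

theorem two_pow_le_two_mul_log {j : ℕ} {N : ℝ} (h : (2 : ℝ) ^ 2 ^ j ≤ N) :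
    2 ^ j ≤ 2 * Real.log N := by
  have h1 : Real.log ((2 : ℝ) ^ 2 ^ j) ≤ Real.log N := Real.log_le_log (by positivity) h
  rw [Real.log_pow] at h1
  push_cast at h1
  have h2 := Real.log_two_gt_d9
  have : (2 : ℝ) ^ j * (1 / 2) ≤ 2 ^ j * Real.log 2 := by gcongr; linarith
  linarith

theorem sum_divisor_pow_block_le {j N : ℕ} (h : N ≤ 2 ^ 2 ^ (j + 1)) (B : ℕ) :
    ∑ n ∈ Finset.Icc 1 N, (n.divisors.card : ℝ) ^ B ≤ 3 ^ 2 ^ B * N * (2 ^ j) ^ 2 ^ B := by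
  refine (sum_divisor_pow_le B N).trans ?_
  rw [mul_comm (3 ^ 2 ^ B : ℝ), mul_assoc, ← mul_pow]
  have h0 := Real.log_natCast_nonneg N
  gcongr
  exact one_add_log_le h

/-- Because jA ≤ A² + j²: the lower end 2^(j²) of the window beats every fixed power of 2^j, so an
error divided by it is negligible. -/
theorem two_pow_pow_le_two_pow_sq (j A : ℕ) : ((2 : ℝ) ^ j) ^ A ≤ 2 ^ A ^ 2 * 2 ^ j ^ 2 := by
  rw [← pow_mul, ← pow_add]
  exact pow_le_pow_right₀ one_le_two (by nlinarith [sq_nonneg ((j : ℤ) - A)])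

theorem sum_divisor_pow_sqrt_le (A B : ℕ) : ∃ K : ℝ, 0 ≤ K ∧ ∀ j N y : ℕ, 2 ^ 2 ^ j ≤ N →
    N ≤ 2 ^ 2 ^ (j + 1) → y ^ 2 ≤ N →
    ∑ n ∈ Finset.Icc 1 y, (n.divisors.card : ℝ) ^ B ≤ K * (N / (2 ^ j) ^ A) := by
  obtain ⟨K, hK, h⟩ := exists_succ_pow_le_sqrt_two_pow (A + 2 ^ B)
  refine ⟨3 ^ 2 ^ B * K, by positivity, fun j N y hN1 hN2 hy => ?_⟩
  have hyN : y ≤ N := (Nat.le_self_pow two_ne_zero y).trans hy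
  have h1 : ((2 : ℝ) ^ j) ^ (A + 2 ^ B) ≤ K * √N := by
    have h2 := h (2 ^ j)
    have h3 : √2 ^ 2 ^ j ≤ √N := by
      rw [Real.le_sqrt (by positivity) N.cast_nonneg, ← pow_mul, mul_comm, pow_mul,
        Real.sq_sqrt zero_le_two]
      exact_mod_cast hN1
    push_cast at h2
    calc ((2 : ℝ) ^ j) ^ (A + 2 ^ B) ≤ ((2 : ℝ) ^ j + 1) ^ (A + 2 ^ B) := by gcongr; linarith
      _ ≤ K * √2 ^ 2 ^ j := h2
      _ ≤ _ := by gcongr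
  have hysq : (y : ℝ) ≤ √N := by
    rw [Real.le_sqrt y.cast_nonneg N.cast_nonneg]
    exact_mod_cast hy
  refine (sum_divisor_pow_block_le (hyN.trans hN2) B).trans ?_
  rw [mul_div_assoc', le_div_iff₀ (by positivity)]
  calc (3 : ℝ) ^ 2 ^ B * y * (2 ^ j) ^ 2 ^ B * (2 ^ j) ^ A
      = 3 ^ 2 ^ B * y * (2 ^ j) ^ (A + 2 ^ B) := by rw [pow_add]; ring
    _ ≤ 3 ^ 2 ^ B * √N * (K * √N) := by gcongr
    _ = 3 ^ 2 ^ B * K * (√N * √N) := by ring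
    _ = _ := by rw [Real.mul_self_sqrt N.cast_nonneg]

/-- Summation over blocks of a function given by a different formula on each block. -/
theorem norm_sum_blocks_le {E : Type*} [NormedAddCommGroup E] (F : ℕ → ℕ → E) (b : ℕ → ℝ) (B : ℕ)
    (hF : ∀ j n, 1 ≤ n → ‖F j n‖ ≤ (n.divisors.card : ℝ) ^ B)
    (hb : ∀ j N y : ℕ, 2 ^ 2 ^ j ≤ N → N ≤ 2 ^ 2 ^ (j + 1) → y ≤ N →
      ‖∑ n ∈ Finset.Icc 1 y, F j n‖ ≤ N * b j)
    {j N : ℕ} (hN1 : 2 ^ 2 ^ (j + 1) ≤ N) (hN2 : N < 2 ^ 2 ^ (j + 2)) :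
    ‖∑ n ∈ Finset.Icc 1 N, F (blockIndex n) n‖ ≤
      ∑ n ∈ Finset.Icc 1 (2 ^ 2 ^ j), (n.divisors.card : ℝ) ^ B + N * (2 * b j + 2 * b (j + 1)) := by
  set x := 2 ^ 2 ^ j with hx
  set z := 2 ^ 2 ^ (j + 1) with hz
  have hx1 : 1 ≤ x := Nat.one_le_two_pow
  have hxz : x ≤ z := Nat.pow_le_pow_right two_pos (Nat.pow_le_pow_right two_pos (by omega))
  -- A stretch [s, t) is a difference of two initial segments, which is why the block hypothesis is
  -- needed for all y ≤ N.
  have hsplit : ∀ (f : ℕ → E) (s t : ℕ), 1 ≤ s → s ≤ t → ∑ n ∈ Finset.Ico s t, f n =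
      ∑ n ∈ Finset.Icc 1 (t - 1), f n - ∑ n ∈ Finset.Icc 1 (s - 1), f n := by
    intro f s t hs hst
    have h1 : Finset.Icc 1 (t - 1) = Finset.Ico 1 t := by ext; simp; omega
    have h2 : Finset.Icc 1 (s - 1) = Finset.Ico 1 s := by ext; simp; omega
    rw [h1, h2, ← Finset.sum_Ico_consecutive _ hs hst, add_sub_cancel_left]
  have hIcc : Finset.Icc 1 N = Finset.Ico 1 (N + 1) := by ext; simp
  have e1 : ∑ n ∈ Finset.Icc 1 N, F (blockIndex n) n =
      ∑ n ∈ Finset.Ico 1 x, F (blockIndex n) n + ∑ n ∈ Finset.Ico x z, F j n +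
        ∑ n ∈ Finset.Ico z (N + 1), F (j + 1) n := by
    rw [hIcc, ← Finset.sum_Ico_consecutive _ (hx1.trans hxz) (show z ≤ N + 1 by omega),
      ← Finset.sum_Ico_consecutive _ hx1 hxz]
    congr 1
    · congr 1
      refine Finset.sum_congr rfl fun n hn => ?_
      rw [Finset.mem_Ico] at hn
      rw [blockIndex_eq hn.1 hn.2]
    · refine Finset.sum_congr rfl fun n hn => ?_
      rw [Finset.mem_Ico] at hn
      rw [blockIndex_eq hn.1 ((Nat.lt_succ_iff.1 hn.2).trans_lt hN2)]
  rw [e1, hsplit _ _ _ hx1 hxz, hsplit _ _ _ (hx1.trans hxz) (show z ≤ N + 1 by omega),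
    Nat.add_sub_cancel]
  have t1 : ‖∑ n ∈ Finset.Ico 1 x, F (blockIndex n) n‖ ≤
      ∑ n ∈ Finset.Icc 1 x, (n.divisors.card : ℝ) ^ B := by
    refine (norm_sum_le _ _).trans ((Finset.sum_le_sum fun n hn =>
      hF _ _ (Finset.mem_Ico.1 hn).1).trans ?_)
    exact Finset.sum_le_sum_of_subset_of_nonneg Finset.Ico_subset_Icc_self fun _ _ _ => by positivity
  have hzN : (z : ℝ) ≤ N := by exact_mod_cast hN1
  have hbj : 0 ≤ b j := by
    have := (norm_nonneg _).trans (hb j z 0 hxz le_rfl (by omega))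
    exact nonneg_of_mul_nonneg_right this (by exact_mod_cast hx1.trans hxz)
  have t2 : ∀ y ≤ z, ‖∑ n ∈ Finset.Icc 1 y, F j n‖ ≤ N * b j := fun y hy =>
    (hb j z y hxz le_rfl hy).trans (by gcongr)
  have t3 : ∀ y ≤ N, ‖∑ n ∈ Finset.Icc 1 y, F (j + 1) n‖ ≤ N * b (j + 1) := fun y hy =>
    hb (j + 1) N y hN1 hN2.le hy
  calc _ ≤ ‖∑ n ∈ Finset.Ico 1 x, F (blockIndex n) n‖ +
        (‖∑ n ∈ Finset.Icc 1 (z - 1), F j n‖ + ‖∑ n ∈ Finset.Icc 1 (x - 1), F j n‖) +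
        (‖∑ n ∈ Finset.Icc 1 N, F (j + 1) n‖ + ‖∑ n ∈ Finset.Icc 1 (z - 1), F (j + 1) n‖) :=
        (norm_add_le _ _).trans (add_le_add ((norm_add_le _ _).trans
          (add_le_add_right (norm_sub_le _ _) _)) (norm_sub_le _ _))
    _ ≤ ∑ n ∈ Finset.Icc 1 x, (n.divisors.card : ℝ) ^ B + (N * b j + N * b j) +
        (N * b (j + 1) + N * b (j + 1)) := by
        gcongr
        · exact t2 _ (by omega)
        · exact t2 _ (by omega)
        · exact t3 _ le_rfl
        · exact t3 _ (by omega)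
    _ = _ := by ring

theorem sq_lt_two_pow {j : ℕ} (hj : 5 ≤ j) : j ^ 2 + 1 ≤ 2 ^ j := by
  induction j, hj using Nat.le_induction with
  | base => norm_num
  | succ j hj ih =>
    rw [pow_succ 2 j]
    nlinarith

/-- The primes below the window and those between it and the end of the block each contribute O(log
j) to ∑ 1/p once j is large; exponentiating gives a power of j. -/
theorem sum_inv_avoiding_primeWindow_le : ∃ K : ℝ, 0 ≤ K ∧ ∀ j N : ℕ, N ≤ 2 ^ 2 ^ (j + 1) →
    ∑ n ∈ Finset.Icc 1 N with ∀ p ∈ primeWindow j, ¬ p ∣ n, 1 / (n : ℝ) ≤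
      K * ((j : ℝ) + 1) ^ 64 := by
  refine ⟨max 48 (Real.exp 16 * 4 ^ 16), by positivity, fun j N hN => ?_⟩
  have hj1 : (1 : ℝ) ≤ (j : ℝ) + 1 := by linarith [Nat.cast_nonneg (α := ℝ) j]
  -- From j = 5 on, j² + 1 ≤ 2^j, so the exponent b of the window's upper end is at least 1. The
  -- earlier blocks go into the constant.
  by_cases hj : j < 5
  · have h1 : ∑ n ∈ Finset.Icc 1 N with ∀ p ∈ primeWindow j, ¬ p ∣ n, 1 / (n : ℝ) ≤ 48 := by
      calc _ ≤ ∑ n ∈ Finset.Icc 1 N, 1 / (n : ℝ) :=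
            Finset.sum_le_sum_of_subset_of_nonneg (Finset.filter_subset _ _)
              fun _ _ _ => by positivity
        _ ≤ 1 + Real.log N := sum_one_div_le N
        _ ≤ 3 * 2 ^ j := one_add_log_le hN
        _ ≤ 3 * 2 ^ 4 := by
            gcongr
            · norm_num
            · omega
        _ = 48 := by norm_num
    calc _ ≤ (48 : ℝ) := h1
      _ ≤ max 48 (Real.exp 16 * 4 ^ 16) * 1 := by rw [mul_one]; exact le_max_left _ _
      _ ≤ _ := by gcongr; exact one_le_pow₀ hj1
  push Not at hj
  have hj0 : (0 : ℝ) < j := by exact_mod_cast (by omega : 0 < j)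
  refine (sum_inv_avoiding_le _ N).trans ?_
  set b := 2 ^ j / (j ^ 2 + 1) with hb
  have hsq := sq_lt_two_pow hj
  have hb1 : 1 ≤ b := Nat.div_pos hsq (by omega)
  have hcb : 2 ^ (j + 1) ≤ 4 * (j ^ 2 + 1) * b := by
    have := Nat.lt_div_mul_add (a := 2 ^ j) (b := j ^ 2 + 1) (by omega)
    rw [← hb] at this
    rw [pow_succ]
    nlinarith
  have hb2 : b ≤ 2 ^ (j + 1) := (Nat.div_le_self _ _).trans (Nat.pow_le_pow_right two_pos (by omega))
  have hb0 : (0 : ℝ) < b := by exact_mod_cast hb1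
  have hsum : ∑ p ∈ Finset.Icc 1 N \ primeWindow j with p.Prime, 1 / (p : ℝ) ≤
      (8 + 8 * Real.log (j ^ 2 : ℕ)) + 8 * (Real.log (2 ^ (j + 1) : ℕ) - Real.log b) := by
    have hsub : (Finset.Icc 1 N \ primeWindow j).filter Nat.Prime ⊆
        (Finset.Ioc (2 ^ 0) (2 ^ (j ^ 2))).filter Nat.Prime ∪
          (Finset.Ioc (2 ^ b) (2 ^ 2 ^ (j + 1))).filter Nat.Prime := by
      intro p hp
      simp only [Finset.mem_filter, Finset.mem_sdiff, Finset.mem_Icc, primeWindow, Finset.mem_Ioc,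
        Finset.mem_union, ← hb] at hp ⊢
      have := hp.2.one_lt
      by_cases h : p ≤ 2 ^ j ^ 2
      · left; exact ⟨⟨by simpa using this, h⟩, hp.2⟩
      · right
        refine ⟨⟨?_, hp.1.1.2.trans hN⟩, hp.2⟩
        by_contra hcon
        exact hp.1.2 ⟨⟨by omega, by omega⟩, hp.2⟩
    calc _ ≤ ∑ p ∈ (Finset.Ioc (2 ^ 0) (2 ^ (j ^ 2))).filter Nat.Prime ∪
          (Finset.Ioc (2 ^ b) (2 ^ 2 ^ (j + 1))).filter Nat.Prime, 1 / (p : ℝ) :=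
          Finset.sum_le_sum_of_subset_of_nonneg hsub fun _ _ _ => by positivity
      _ ≤ ∑ p ∈ (Finset.Ioc (2 ^ 0) (2 ^ (j ^ 2))).filter Nat.Prime, 1 / (p : ℝ) +
          ∑ p ∈ (Finset.Ioc (2 ^ b) (2 ^ 2 ^ (j + 1))).filter Nat.Prime, 1 / (p : ℝ) := by
          rw [← Finset.sum_union_inter]
          exact le_add_of_nonneg_right (Finset.sum_nonneg fun _ _ => by positivity)
      _ ≤ _ := by
          refine add_le_add ?_ ?_
          · refine (sum_prime_inv_Ioc_le 0 (j ^ 2) (Nat.zero_le _)).trans ?_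
            have hj2 : 1 ≤ j ^ 2 := Nat.one_le_pow _ _ (by omega)
            rw [← Finset.sum_Ico_consecutive _ (Nat.zero_le 1) hj2]
            have := sum_inv_succ_le_log 1 (j ^ 2) le_rfl hj2
            rw [Nat.cast_one, Real.log_one, sub_zero] at this
            simpa using this
          · exact (sum_prime_inv_Ioc_le _ _ hb2).trans (sum_inv_succ_le_log _ _ hb1 hb2)
  have hratio : (2 : ℝ) ^ (j + 1) / b ≤ 4 * ((j : ℝ) + 1) ^ 2 := by
    rw [div_le_iff₀ hb0]
    have : (2 : ℝ) ^ (j + 1) ≤ 4 * ((j : ℝ) ^ 2 + 1) * b := by exact_mod_cast hcb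
    refine this.trans ?_
    gcongr
    nlinarith
  calc _ ≤ Real.exp (2 * ((8 + 8 * Real.log (j ^ 2 : ℕ)) +
        8 * (Real.log (2 ^ (j + 1) : ℕ) - Real.log b))) := by gcongr
    _ = Real.exp 16 * ((j : ℝ) ^ 2) ^ 16 * ((2 : ℝ) ^ (j + 1) / b) ^ 16 := by
        push_cast
        rw [← Real.log_div (by positivity) hb0.ne']
        have e : 2 * ((8 + 8 * Real.log ((j : ℝ) ^ 2)) + 8 * Real.log ((2 : ℝ) ^ (j + 1) / b)) =
          16 + (16 : ℕ) * Real.log ((j : ℝ) ^ 2) + (16 : ℕ) * Real.log ((2 : ℝ) ^ (j + 1) / b) := by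
          push_cast; ring
        rw [e, Real.exp_add, Real.exp_add, Real.exp_nat_mul, Real.exp_nat_mul,
          Real.exp_log (by positivity), Real.exp_log (by positivity)]
    _ ≤ Real.exp 16 * (((j : ℝ) + 1) ^ 2) ^ 16 * (4 * ((j : ℝ) + 1) ^ 2) ^ 16 := by
        gcongr; linarith
    _ = (Real.exp 16 * 4 ^ 16) * ((j : ℝ) + 1) ^ 64 := by ring
    _ ≤ _ := by gcongr; exact le_max_right _ _

/-- This is the estimate for g₂ on one block: the sieve saves a full logarithm, up to powers of j,
which is of order log log N. -/
theorem sum_divisor_pow_avoiding_primeWindow_le (B : ℕ) : ∃ (K : ℝ) (E : ℕ), 0 ≤ K ∧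
    ∀ j N : ℕ, 2 ^ 2 ^ j ≤ N → N ≤ 2 ^ 2 ^ (j + 1) →
    ∑ n ∈ Finset.Icc 1 N with ∀ p ∈ primeWindow j, ¬ p ∣ n, (n.divisors.card : ℝ) ^ B ≤
      N * (K * ((j : ℝ) + 1) ^ E / 2 ^ j) := by
  obtain ⟨K₁, hK₁, h₁⟩ := sum_divisor_pow_sieved_le B
  obtain ⟨K₂, hK₂, h₂⟩ := sum_inv_avoiding_primeWindow_le
  refine ⟨2 * K₁ * K₂ ^ 2 ^ B, 64 * 2 ^ B, by positivity, fun j N hN1 hN2 => ?_⟩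
  have hlog : (2 : ℝ) ^ j ≤ 2 * Real.log N := two_pow_le_two_mul_log (by exact_mod_cast hN1)
  have h3 := h₁ (fun n => ∀ p ∈ primeWindow j, ¬ p ∣ n)
    (fun a b h => ⟨fun p hp hpa => h p hp (hpa.mul_right b), fun p hp hpb => h p hp (hpb.mul_left a)⟩)
    N (Nat.one_le_two_pow.trans hN1)
  set S := ∑ n ∈ Finset.Icc 1 N with ∀ p ∈ primeWindow j, ¬ p ∣ n, (n.divisors.card : ℝ) ^ B
  have hS : 0 ≤ S := Finset.sum_nonneg fun _ _ => by positivity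
  rw [mul_div_assoc', le_div_iff₀ (by positivity)]
  calc S * 2 ^ j ≤ S * (2 * Real.log N) := by gcongr
    _ = 2 * (S * Real.log N) := by ring
    _ ≤ 2 * (K₁ * N * (K₂ * ((j : ℝ) + 1) ^ 64) ^ 2 ^ B) := by
        refine mul_le_mul_of_nonneg_left (h3.trans ?_) zero_le_two
        refine mul_le_mul_of_nonneg_left (pow_le_pow_left₀ ?_ (h₂ j N hN2) _) (by positivity)
        exact Finset.sum_nonneg fun _ _ => by positivity
    _ = _ := by rw [mul_pow, ← pow_mul]; ring

theorem two_pow_pow_div_le (A E j : ℕ) :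
    ((2 : ℝ) ^ j) ^ E / 2 ^ j ^ 2 ≤ 2 ^ (A + E) ^ 2 / (2 ^ j) ^ A := by
  rw [div_le_div_iff₀ (by positivity) (by positivity), ← pow_add, add_comm E A]
  exact two_pow_pow_le_two_pow_sq j (A + E)

theorem sum_sq_dvd_primeWindow_le (A B : ℕ) : ∃ K : ℝ, 0 ≤ K ∧ ∀ j N : ℕ, N ≤ 2 ^ 2 ^ (j + 1) →
    ∑ n ∈ Finset.Icc 1 N with ∃ p ∈ primeWindow j, p ^ 2 ∣ n, (n.divisors.card : ℝ) ^ B ≤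
      K * (N / (2 ^ j) ^ A) := by
  refine ⟨3 ^ B * 3 ^ 2 ^ B * 2 ^ (A + 2 ^ B) ^ 2, by positivity, fun j N hN => ?_⟩
  have h := sum_divisor_pow_sq_dvd_le (primeWindow j) (Y := 2 ^ j ^ 2) Nat.one_le_two_pow
    (fun p hp => ⟨prime_of_mem_primeWindow hp, lt_of_mem_primeWindow hp⟩) B N
  have h0 := Real.log_natCast_nonneg N
  have h1 := one_add_log_le hN
  refine h.trans ?_
  push_cast
  calc (3 : ℝ) ^ B * (N * (1 + Real.log N) ^ 2 ^ B) / (2 : ℝ) ^ j ^ 2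
      ≤ 3 ^ B * (N * (3 * 2 ^ j) ^ 2 ^ B) / (2 : ℝ) ^ j ^ 2 := by gcongr
    _ = 3 ^ B * 3 ^ 2 ^ B * N * (((2 : ℝ) ^ j) ^ 2 ^ B / 2 ^ j ^ 2) := by rw [mul_pow]; ring
    _ ≤ 3 ^ B * 3 ^ 2 ^ B * N * (2 ^ (A + 2 ^ B) ^ 2 / (2 ^ j) ^ A) := by
        exact mul_le_mul_of_nonneg_left (two_pow_pow_div_le A (2 ^ B) j) (by positivity)
    _ = _ := by ring

theorem sum_divisor_pow_div_two_pow_sq_le (A B : ℕ) : ∃ K : ℝ, 0 ≤ K ∧ ∀ j N : ℕ,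
    N ≤ 2 ^ 2 ^ (j + 1) →
    (∑ n ∈ Finset.Icc 1 N, (n.divisors.card : ℝ) ^ B) / 2 ^ j ^ 2 ≤ K * (N / (2 ^ j) ^ A) := by
  refine ⟨3 ^ 2 ^ B * 2 ^ (A + 2 ^ B) ^ 2, by positivity, fun j N hN => ?_⟩
  calc (∑ n ∈ Finset.Icc 1 N, (n.divisors.card : ℝ) ^ B) / 2 ^ j ^ 2
      ≤ 3 ^ 2 ^ B * N * (2 ^ j) ^ 2 ^ B / 2 ^ j ^ 2 := by
        gcongr; exact sum_divisor_pow_block_le hN B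
    _ = 3 ^ 2 ^ B * N * (((2 : ℝ) ^ j) ^ 2 ^ B / 2 ^ j ^ 2) := by ring
    _ ≤ 3 ^ 2 ^ B * N * (2 ^ (A + 2 ^ B) ^ 2 / (2 ^ j) ^ A) := by
        exact mul_le_mul_of_nonneg_left (two_pow_pow_div_le A (2 ^ B) j) (by positivity)
    _ = _ := by ring

/-! ### Siegel–Walfisz on blocks and Legendre's sieve -/

section

variable {g : ArithmeticFunction ℂ} {C : ℕ}

theorem SiegelWalfisz.exists_nat_bound (hSW : SiegelWalfisz (fun n => g n)) :
    ∃ C : ℕ, ∀ n : ℕ, 1 ≤ n → ‖g n‖ ≤ (n.divisors.card : ℝ) ^ C := by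
  obtain ⟨C, hC, h⟩ := hSW.divisorBounded
  refine ⟨⌈C⌉₊, fun n hn => (h n hn).trans ?_⟩
  rw [← Real.rpow_natCast]
  exact Real.rpow_le_rpow_of_exponent_le (by exact_mod_cast Nat.one_le_card_divisors hn)
    (Nat.le_ceil C)

/-- The bound is relative to Z, not to the length y, so it covers arbitrarily short sums; Z may be
as small as the square root of the block's start, since it will be N/d with d ≤ √N. If y is shorter
than Z by a suitable power of L, the divisor bound suffices; otherwise log y ≥ L/8 once L is large,
and the assumption with exponent A + 1 has a spare logarithm for the constants. -/
theorem SiegelWalfisz.uniform (hSW : SiegelWalfisz (fun n => g n))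
    (hC : ∀ n : ℕ, 1 ≤ n → ‖g n‖ ≤ (n.divisors.card : ℝ) ^ C) (A : ℕ) :
    ∃ K : ℝ, 0 ≤ K ∧ ∀ (j : ℕ) (Z : ℝ), (2 : ℝ) ^ 2 ^ j ≤ Z ^ 2 → 0 ≤ Z → Z ≤ 2 ^ 2 ^ (j + 1) →
      ∀ y q a : ℕ, (y : ℝ) ≤ Z → 1 ≤ q → (q : ℝ) ≤ (2 ^ j) ^ A →
      ‖∑ n ∈ Finset.Icc 1 y with n ≡ a [MOD q], g n‖ ≤ K * (Z / (2 ^ j) ^ A) := by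
  obtain ⟨K₀, hK₀⟩ := hSW.equidistributed ((A + 1 : ℕ) : ℝ) (by positivity)
  set D := 2 ^ C with hD
  obtain ⟨K₁, hK₁, hgrow⟩ := exists_succ_pow_le_sqrt_two_pow (4 * (A + D))
  set R : ℝ := max (8 ^ (A + 1)) (K₁ ^ 2) with hR
  have hR0 : 0 < R := lt_of_lt_of_le (by positivity) (le_max_left _ _)
  refine ⟨max (3 ^ D) (3 ^ D * R ^ (A + D)) + max K₀ 0 * 8 ^ (A + 1), by positivity,
    fun j Z hZ1 hZ0 hZ2 y q a hyZ hq1 hq2 => ?_⟩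
  set L : ℝ := 2 ^ j with hL
  have hL1 : 1 ≤ L := one_le_pow₀ one_le_two
  have hL0 : 0 < L := by linarith
  have hyX : y ≤ 2 ^ 2 ^ (j + 1) := by exact_mod_cast hyZ.trans hZ2
  have htriv : ‖∑ n ∈ Finset.Icc 1 y with n ≡ a [MOD q], g n‖ ≤ 3 ^ D * y * L ^ D := by
    refine (norm_sum_le _ _).trans (le_trans ?_ (sum_divisor_pow_block_le hyX C))
    refine (Finset.sum_le_sum_of_subset_of_nonneg (Finset.filter_subset _ _)
      fun _ _ _ => norm_nonneg _).trans ?_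
    exact Finset.sum_le_sum fun n hn => hC n (Finset.mem_Icc.1 hn).1
  have hZL : 0 ≤ Z / L ^ A := by positivity
  have hmax0 : 0 ≤ max K₀ 0 * 8 ^ (A + 1) := by positivity
  by_cases hc1 : L < R
  · refine htriv.trans ?_
    calc 3 ^ D * y * L ^ D = 3 ^ D * L ^ (A + D) * (y / L ^ A) := by
          rw [pow_add]; field_simp
      _ ≤ (3 ^ D * R ^ (A + D)) * (Z / L ^ A) := by gcongr
      _ ≤ _ := by
          refine mul_le_mul_of_nonneg_right ?_ hZL
          exact (le_max_right _ _).trans (le_add_of_nonneg_right hmax0)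
  push Not at hc1
  by_cases hc2 : y * L ^ (A + D) ≤ Z
  · refine htriv.trans ?_
    calc 3 ^ D * y * L ^ D = 3 ^ D * (y * L ^ (A + D) / L ^ A) := by
          rw [pow_add]; field_simp
      _ ≤ 3 ^ D * (Z / L ^ A) := by gcongr
      _ ≤ _ := by
          refine mul_le_mul_of_nonneg_right ?_ hZL
          exact (le_max_left _ _).trans (le_add_of_nonneg_right hmax0)
  push Not at hc2
  set s : ℝ := √2 ^ 2 ^ j with hs
  have hs0 : 0 < s := by positivity
  have hs2 : s ^ 2 = 2 ^ 2 ^ j := by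
    rw [hs, ← pow_mul, mul_comm, pow_mul, Real.sq_sqrt zero_le_two]
  have hLs : L ^ (4 * (A + D)) ≤ K₁ * s := by
    have := hgrow (2 ^ j)
    push_cast at this
    refine le_trans ?_ this
    gcongr
    linarith
  have hLX : L ≤ s ^ 2 := by
    rw [hs2, hL]
    exact pow_le_pow_right₀ one_le_two (Nat.lt_two_pow_self).le
  have hK₁s : K₁ ≤ s := by
    have : K₁ ^ 2 ≤ s ^ 2 := (le_max_right _ _).trans (hc1.trans hLX)
    exact le_of_sq_le_sq this hs0.le
  -- Here s² = 2^(2^j). From Z ≤ yL^(A+D) and Z⁴ ≥ s⁴, only the fourth power of L^(A+D) is lost, and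
  -- that is at most s².
  have hy4 : s ^ 2 ≤ (y : ℝ) ^ 4 := by
    have h1 : Z ^ 4 ≤ (y * L ^ (A + D)) ^ 4 := by gcongr
    have h2 : (s ^ 2) ^ 2 ≤ Z ^ 4 := by
      calc (s ^ 2) ^ 2 ≤ (Z ^ 2) ^ 2 := by rw [hs2]; gcongr
        _ = Z ^ 4 := by ring
    have h3 : (y * L ^ (A + D)) ^ 4 ≤ (y : ℝ) ^ 4 * (s * s) := by
      rw [mul_pow, ← pow_mul, mul_comm (A + D)]
      gcongr
      exact hLs.trans (by gcongr)
    have h4 : s ^ 2 * (s * s) ≤ (y : ℝ) ^ 4 * (s * s) := by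
      calc s ^ 2 * (s * s) = (s ^ 2) ^ 2 := by ring
        _ ≤ _ := h2.trans (h1.trans h3)
    exact le_of_mul_le_mul_right h4 (by positivity)
  have h8L : (8 : ℝ) ^ (A + 1) ≤ L := (le_max_left _ _).trans hc1
  have h8 : (8 : ℝ) ≤ L := (le_self_pow₀ (by norm_num) (by omega)).trans h8L
  have hj3 : 3 ≤ j := by
    by_contra hcon
    have : L ≤ 2 ^ 2 := pow_le_pow_right₀ one_le_two (by omega)
    linarith
  have hy3 : (3 : ℝ) ≤ y := by
    by_contra hcon
    push Not at hcon
    have h1 : (y : ℝ) ^ 4 < 3 ^ 4 := by gcongr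
    have h2 : (2 : ℝ) ^ 2 ^ 3 ≤ 2 ^ 2 ^ j :=
      pow_le_pow_right₀ one_le_two (Nat.pow_le_pow_right two_pos hj3)
    rw [← hs2] at h2
    norm_num at h1 h2
    linarith
  have hlogy : L / 8 ≤ Real.log y := by
    have h1 : L ≤ 2 * Real.log ((y : ℝ) ^ 4) := two_pow_le_two_mul_log (by rw [← hs2]; exact hy4)
    rw [Real.log_pow] at h1
    push_cast at h1
    linarith
  have hlogy0 : 0 < Real.log y := lt_of_lt_of_le (by positivity) hlogy
  have hL8 : L ^ A ≤ (L / 8) ^ (A + 1) := by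
    rw [div_pow, le_div_iff₀ (by positivity), pow_succ L]
    gcongr
  -- Residues in the assumption run over 1, …, q, so the class of 0 is represented by q.
  obtain ⟨c, hc1', hc2', hca⟩ : ∃ c, 1 ≤ c ∧ c ≤ q ∧ c ≡ a [MOD q] := by
    rcases Nat.eq_zero_or_pos (a % q) with h0 | h0
    · exact ⟨q, hq1, le_rfl, by rw [Nat.ModEq, h0, Nat.mod_self]⟩
    · exact ⟨a % q, h0, (Nat.mod_lt _ hq1).le, Nat.mod_modEq a q⟩
  have hmain := hK₀ y hy3 c q hc1' hc2' (by
    rw [Real.rpow_natCast]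
    exact hq2.trans (hL8.trans (by gcongr)))
  rw [natInterval, Nat.floor_natCast, Real.rpow_natCast] at hmain
  have hfilter : (Finset.Icc 1 y).filter (fun n => n ≡ a [MOD q]) =
      (Finset.Icc 1 y).filter (fun n => n ≡ c [MOD q]) :=
    Finset.filter_congr fun n _ => ⟨fun h => h.trans hca.symm, fun h => h.trans hca⟩
  rw [hfilter]
  refine hmain.trans ?_
  calc K₀ * (y / Real.log y ^ (A + 1)) ≤ max K₀ 0 * (Z / (L / 8) ^ (A + 1)) := by
        gcongr
        exact le_max_left _ _
    _ = max K₀ 0 * 8 ^ (A + 1) * (Z / L ^ (A + 1)) := by rw [div_pow]; field_simp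
    _ ≤ max K₀ 0 * 8 ^ (A + 1) * (Z / L ^ A) := by
        gcongr
        omega
    _ ≤ _ := by
        refine mul_le_mul_of_nonneg_right ?_ hZL
        exact le_add_of_nonneg_left (by positivity)

/-- A common prime of d and n/d would belong to T, and its square would divide n. -/
theorem coprime_div_of_dvd_prod {T : Finset ℕ} (hT : ∀ p ∈ T, p.Prime) {n d : ℕ} (hdn : d ∣ n)
    (hd : d ∣ ∏ p ∈ T, p) (hn : ¬ ∃ p ∈ T, p ^ 2 ∣ n) : Nat.Coprime d (n / d) := by
  refine Nat.Coprime.symm (Nat.coprime_of_dvd fun r hr h1 h2 => hn ⟨r, ?_, ?_⟩)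
  · obtain ⟨p, hp, hrp⟩ := (hr.prime.dvd_finsetProd_iff _).1 (h2.trans hd)
    rwa [(Nat.prime_dvd_prime_iff_eq hr (hT p hp)).1 hrp]
  · rw [sq, ← Nat.mul_div_cancel' hdn]
    exact mul_dvd_mul h2 h1

/-- Legendre's identity, away from integers divisible by the square of a sifting prime. -/
theorem sum_moebius_mul_eq (hmul : g.IsMultiplicative) {T : Finset ℕ} (hT : ∀ p ∈ T, p.Prime)
    {n : ℕ} (hn : ¬ ∃ p ∈ T, p ^ 2 ∣ n) :
    ∑ d ∈ (∏ p ∈ T, p).divisors with d ∣ n,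
      (ArithmeticFunction.moebius d : ℂ) * g d * g (n / d) =
    if ∀ p ∈ T, ¬ p ∣ n then g n else 0 := by
  have hP0 : ∏ p ∈ T, p ≠ 0 := Finset.prod_ne_zero_iff.2 fun p hp => (hT p hp).ne_zero
  have h1 : ∀ d ∈ (∏ p ∈ T, p).divisors.filter (fun d => d ∣ n),
      (ArithmeticFunction.moebius d : ℂ) * g d * g (n / d) =
        (ArithmeticFunction.moebius d : ℂ) * g n := by
    intro d hd
    rw [Finset.mem_filter, Nat.mem_divisors] at hd
    rw [mul_assoc, ← hmul.map_mul_of_coprime (coprime_div_of_dvd_prod hT hd.2 hd.1.1 hn),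
      Nat.mul_div_cancel' hd.2]
  rw [Finset.sum_congr rfl h1, ← Finset.sum_mul]
  have h2 : (∏ p ∈ T, p).divisors.filter (fun d => d ∣ n) = (Nat.gcd (∏ p ∈ T, p) n).divisors := by
    ext d
    rw [Finset.mem_filter, Nat.mem_divisors, Nat.mem_divisors, Nat.dvd_gcd_iff]
    have : Nat.gcd (∏ p ∈ T, p) n ≠ 0 := Nat.gcd_ne_zero_left hP0
    tauto
  rw [h2]
  have h3 : ∑ d ∈ (Nat.gcd (∏ p ∈ T, p) n).divisors, (ArithmeticFunction.moebius d : ℂ) =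
      if Nat.gcd (∏ p ∈ T, p) n = 1 then 1 else 0 := by
    have := congrArg (fun f : ArithmeticFunction ℤ => f (Nat.gcd (∏ p ∈ T, p) n))
      ArithmeticFunction.moebius_mul_coe_zeta
    simp only [ArithmeticFunction.coe_mul_zeta_apply, ArithmeticFunction.one_apply] at this
    exact_mod_cast this
  rw [h3]
  have h4 : Nat.gcd (∏ p ∈ T, p) n = 1 ↔ ∀ p ∈ T, ¬ p ∣ n := by
    rw [← Nat.coprime_iff_gcd_eq_one, Nat.coprime_prod_left_iff]
    exact forall₂_congr fun p hp => (hT p hp).coprime_iff_not_dvd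
  simp only [h4]
  split_ifs <;> simp

theorem two_pow_card_primeFactors_le {n : ℕ} (hn : n ≠ 0) :
    2 ^ n.primeFactors.card ≤ n.divisors.card := by
  rw [Nat.card_divisors hn]
  refine Finset.pow_card_le_prod _ _ _ fun p hp => ?_
  have := (Nat.prime_of_mem_primeFactors hp).factorization_pos_of_dvd hn
    (Nat.dvd_of_mem_primeFactors hp)
  omega

theorem le_pow_card_primeFactors {T : Finset ℕ} (hT : ∀ p ∈ T, p.Prime) {U d : ℕ}
    (hU : ∀ p ∈ T, p ≤ U) (hd : d ∣ ∏ p ∈ T, p) : d ≤ U ^ d.primeFactors.card := by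
  have hsq : Squarefree (∏ p ∈ T, p) :=
    Finset.squarefree_prod_of_pairwise_isCoprime
      (fun p hp q hq hpq => Nat.coprime_iff_isRelPrime.1
        ((Nat.coprime_primes (hT p hp) (hT q hq)).2 hpq))
      fun p hp => (hT p hp).prime.squarefree
  have h1 := Nat.prod_primeFactors_of_squarefree (hsq.squarefree_of_dvd hd)
  conv_lhs => rw [← h1]
  refine Finset.prod_le_pow_card _ _ _ fun r hr => ?_
  have hr' := Nat.prime_of_mem_primeFactors hr
  obtain ⟨p, hp, hrp⟩ := (hr'.prime.dvd_finsetProd_iff _).1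
    ((Nat.dvd_of_mem_primeFactors hr).trans hd)
  rw [(Nat.prime_dvd_prime_iff_eq hr' (hT p hp)).1 hrp]
  exact hU p hp

/-- Large divisors composed of primes in the window have many prime factors. -/
theorem two_pow_sq_le_card_divisors_sq {j d : ℕ} (hd : d ∣ ∏ p ∈ primeWindow j, p)
    (hlarge : 2 ^ 2 ^ j < d ^ 2) : 2 ^ j ^ 2 ≤ d.divisors.card ^ 2 := by
  have hd0 : d ≠ 0 := by rintro rfl; simp at hlarge
  have h1 := le_pow_card_primeFactors (fun p hp => prime_of_mem_primeWindow hp)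
    (fun p hp => le_of_mem_primeWindow hp) hd
  set w := d.primeFactors.card
  set b := 2 ^ j / (j ^ 2 + 1) with hb
  have h2 : 2 ^ 2 ^ j < 2 ^ (b * w * 2) := by
    refine hlarge.trans_le ?_
    rw [pow_mul, pow_mul]
    exact Nat.pow_le_pow_left h1 2
  have h3 : 2 ^ j < b * w * 2 := (Nat.pow_lt_pow_iff_right one_lt_two).1 h2
  have h4 : b * (j ^ 2 + 1) ≤ 2 ^ j := Nat.div_mul_le_self _ _
  -- d ≤ 2^(bw), while d exceeds the square root of 2^(2^j), and b(j² + 1) ≤ 2^j. The division by j²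
  -- + 1 in the window's upper end forces w to be this large.
  have h5 : j ^ 2 + 1 < w * 2 := by
    by_contra hcon
    push Not at hcon
    have : b * (w * 2) ≤ b * (j ^ 2 + 1) := Nat.mul_le_mul_left b hcon
    rw [← mul_assoc] at this
    omega
  calc 2 ^ j ^ 2 ≤ 2 ^ (w * 2) := Nat.pow_le_pow_right two_pos (by omega)
    _ = (2 ^ w) ^ 2 := by rw [pow_mul]
    _ ≤ _ := Nat.pow_le_pow_left (two_pow_card_primeFactors_le hd0) 2

theorem norm_mul_div_le (hC : ∀ n : ℕ, 1 ≤ n → ‖g n‖ ≤ (n.divisors.card : ℝ) ^ C) {n d : ℕ}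
    (hn : 1 ≤ n) (hd : d ∣ n) : ‖g d * g (n / d)‖ ≤ (n.divisors.card : ℝ) ^ (2 * C) := by
  have h1 : 1 ≤ d := Nat.pos_of_dvd_of_pos hd hn
  have h2 : 1 ≤ n / d := Nat.div_pos (Nat.le_of_dvd hn hd) h1
  rw [norm_mul, two_mul, pow_add]
  refine mul_le_mul ((hC _ h1).trans ?_) ((hC _ h2).trans ?_) (norm_nonneg _) (by positivity)
  · have := Nat.card_divisors_le_of_dvd hn hd
    exact pow_le_pow_left₀ (by positivity) (by exact_mod_cast this) _
  · have := Nat.card_divisors_le_of_dvd hn (Nat.div_dvd_of_dvd hd)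
    exact pow_le_pow_left₀ (by positivity) (by exact_mod_cast this) _

theorem norm_moebius_cast_le (d : ℕ) : ‖(ArithmeticFunction.moebius d : ℂ)‖ ≤ 1 := by
  rw [Complex.norm_intCast]
  exact_mod_cast ArithmeticFunction.abs_moebius_le_one

/-- The part of `g` supported on integers without prime factors in the window. -/
noncomputable def sievedPart (g : ArithmeticFunction ℂ) (j n : ℕ) : ℂ :=
  if ∀ p ∈ primeWindow j, ¬ p ∣ n then g n else 0

/-- The part of `g` supported on integers with a prime factor in the window. -/
noncomputable def windowPart (g : ArithmeticFunction ℂ) (j n : ℕ) : ℂ :=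
  if ∃ p ∈ primeWindow j, p ∣ n then g n else 0

theorem windowPart_add_sievedPart (g : ArithmeticFunction ℂ) (j n : ℕ) :
    windowPart g j n + sievedPart g j n = g n := by
  unfold windowPart sievedPart
  by_cases h : ∃ p ∈ primeWindow j, p ∣ n
  · rw [if_pos h, if_neg (by push Not; exact h), add_zero]
  · rw [if_neg h, if_pos (by push Not at h; exact h), zero_add]

/-- Away from multiples of p² the full Legendre sum is exact; elsewhere both sides are bounded
trivially. Each d > √N dropped by the truncation forces τ(n)² ≥ 2^(j²), so its term may be
multiplied by τ(n)²/2^(j²). -/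
theorem norm_sievedPart_sub_le (hmul : g.IsMultiplicative)
    (hC : ∀ n : ℕ, 1 ≤ n → ‖g n‖ ≤ (n.divisors.card : ℝ) ^ C) (j N : ℕ) (hN : 2 ^ 2 ^ j ≤ N) {n : ℕ}
    (hn : 1 ≤ n) :
    ‖sievedPart g j n - ∑ d ∈ (∏ p ∈ primeWindow j, p).divisors.filter (fun d => d ^ 2 ≤ N) with d ∣ n,
      (ArithmeticFunction.moebius d : ℂ) * g d * g (n / d)‖ ≤
    2 * (if ∃ p ∈ primeWindow j, p ^ 2 ∣ n then (n.divisors.card : ℝ) ^ (2 * C + 1) else 0) +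
      (n.divisors.card : ℝ) ^ (2 * C + 3) / 2 ^ j ^ 2 := by
  set 𝒟 := (∏ p ∈ primeWindow j, p).divisors with h𝒟
  set G : ℕ → ℂ := fun d => (ArithmeticFunction.moebius d : ℂ) * g d * g (n / d) with hG
  have hτ : (1 : ℝ) ≤ n.divisors.card := by exact_mod_cast Nat.one_le_card_divisors hn
  have hGle : ∀ d, d ∣ n → ‖G d‖ ≤ (n.divisors.card : ℝ) ^ (2 * C) := fun d hd => by
    simp only [hG]
    rw [mul_assoc, norm_mul]
    exact (mul_le_of_le_one_left (norm_nonneg _) (norm_moebius_cast_le d)).trans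
      (norm_mul_div_le hC hn hd)
  have hcard : ∀ D : Finset ℕ, ((D.filter (fun d => d ∣ n)).card : ℝ) ≤ n.divisors.card :=
    fun D => by
      exact_mod_cast Finset.card_le_card fun d hd =>
        Nat.mem_divisors.2 ⟨(Finset.mem_filter.1 hd).2, by omega⟩
  have hfull : ‖sievedPart g j n - ∑ d ∈ 𝒟 with d ∣ n, G d‖ ≤
      2 * (if ∃ p ∈ primeWindow j, p ^ 2 ∣ n then (n.divisors.card : ℝ) ^ (2 * C + 1) else 0) := by
    split_ifs with h
    · have h1 : ‖sievedPart g j n‖ ≤ (n.divisors.card : ℝ) ^ (2 * C + 1) := by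
        unfold sievedPart
        split_ifs
        · exact (hC n hn).trans (pow_le_pow_right₀ hτ (by omega))
        · rw [norm_zero]; positivity
      have h2 : ‖∑ d ∈ 𝒟 with d ∣ n, G d‖ ≤ (n.divisors.card : ℝ) ^ (2 * C + 1) := by
        calc ‖∑ d ∈ 𝒟 with d ∣ n, G d‖ ≤
            ∑ d ∈ 𝒟 with d ∣ n, (n.divisors.card : ℝ) ^ (2 * C) :=
              (norm_sum_le _ _).trans (Finset.sum_le_sum fun d hd =>
                hGle d (Finset.mem_filter.1 hd).2)
          _ = ((𝒟.filter (fun d => d ∣ n)).card : ℝ) * (n.divisors.card : ℝ) ^ (2 * C) := by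
              rw [Finset.sum_const, nsmul_eq_mul]
          _ ≤ n.divisors.card * (n.divisors.card : ℝ) ^ (2 * C) := by
              exact mul_le_mul_of_nonneg_right (hcard _) (by positivity)
          _ = _ := by ring
      calc _ ≤ _ := norm_sub_le _ _
        _ ≤ _ := by linarith
    · rw [sum_moebius_mul_eq hmul (fun p hp => prime_of_mem_primeWindow hp) h, sievedPart,
        sub_self, norm_zero, mul_zero]
  have hsplit : ∑ d ∈ 𝒟 with d ∣ n, G d =
      ∑ d ∈ 𝒟.filter (fun d => d ^ 2 ≤ N) with d ∣ n, G d +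
        ∑ d ∈ 𝒟.filter (fun d => ¬ d ^ 2 ≤ N) with d ∣ n, G d := by
    rw [← Finset.sum_filter_add_sum_filter_not (𝒟.filter _) (fun d => d ^ 2 ≤ N)]
    simp only [Finset.filter_filter, and_comm]
  have hlarge : ‖∑ d ∈ 𝒟.filter (fun d => ¬ d ^ 2 ≤ N) with d ∣ n, G d‖ ≤
      (n.divisors.card : ℝ) ^ (2 * C + 3) / 2 ^ j ^ 2 := by
    calc _ ≤ ∑ d ∈ 𝒟.filter (fun d => ¬ d ^ 2 ≤ N) with d ∣ n,
          (n.divisors.card : ℝ) ^ (2 * C + 2) / 2 ^ j ^ 2 := by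
          refine (norm_sum_le _ _).trans (Finset.sum_le_sum fun d hd => ?_)
          rw [Finset.mem_filter, Finset.mem_filter, h𝒟, Nat.mem_divisors] at hd
          have h1 := two_pow_sq_le_card_divisors_sq hd.1.1.1 (hN.trans_lt (not_le.1 hd.1.2))
          have h2 : (2 : ℝ) ^ j ^ 2 ≤ (n.divisors.card : ℝ) ^ 2 := by
            exact_mod_cast h1.trans (Nat.pow_le_pow_left (Nat.card_divisors_le_of_dvd hn hd.2) 2)
          rw [le_div_iff₀ (by positivity), pow_add]
          exact mul_le_mul (hGle d hd.2) h2 (by positivity) (by positivity)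
      _ ≤ n.divisors.card * ((n.divisors.card : ℝ) ^ (2 * C + 2) / 2 ^ j ^ 2) := by
          rw [Finset.sum_const, nsmul_eq_mul]
          exact mul_le_mul_of_nonneg_right (hcard _) (by positivity)
      _ = _ := by ring
  calc _ = ‖(sievedPart g j n - ∑ d ∈ 𝒟 with d ∣ n, G d) +
        ∑ d ∈ 𝒟.filter (fun d => ¬ d ^ 2 ≤ N) with d ∣ n, G d‖ := by
        rw [hsplit]; congr 1; ring
    _ ≤ _ := (norm_add_le _ _).trans (add_le_add hfull hlarge)

end

/-! ### The windowed function in arithmetic progressions -/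

section

variable {g : ArithmeticFunction ℂ} {C : ℕ}

theorem norm_windowPart_le (hC : ∀ n : ℕ, 1 ≤ n → ‖g n‖ ≤ (n.divisors.card : ℝ) ^ C) (j : ℕ) {n : ℕ}
    (hn : 1 ≤ n) : ‖windowPart g j n‖ ≤ (n.divisors.card : ℝ) ^ C := by
  unfold windowPart
  split_ifs
  · exact hC n hn
  · rw [norm_zero]; positivity

/-- Disposes of the finitely many blocks up to a threshold j₀ by the divisor bound, at the price of
a constant depending on j₀. -/
theorem norm_sum_le_of_index_lt {f : ℕ → ℂ} {B j j₀ N : ℕ} (A : ℕ)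
    (hf : ∀ n : ℕ, 1 ≤ n → ‖f n‖ ≤ (n.divisors.card : ℝ) ^ B) (hj : j ≤ j₀)
    (hN : N ≤ 2 ^ 2 ^ (j + 1)) {s : Finset ℕ} (hs : s ⊆ Finset.Icc 1 N) :
    ‖∑ n ∈ s, f n‖ ≤ 3 ^ 2 ^ B * (2 ^ j₀) ^ (2 ^ B + A) * (N / (2 ^ j) ^ A) := by
  calc ‖∑ n ∈ s, f n‖ ≤ ∑ n ∈ s, (n.divisors.card : ℝ) ^ B :=
        (norm_sum_le _ _).trans (Finset.sum_le_sum fun n hn =>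
          hf n (Finset.mem_Icc.1 (hs hn)).1)
    _ ≤ ∑ n ∈ Finset.Icc 1 N, (n.divisors.card : ℝ) ^ B :=
        Finset.sum_le_sum_of_subset_of_nonneg hs fun _ _ _ => by positivity
    _ ≤ 3 ^ 2 ^ B * N * (2 ^ j) ^ 2 ^ B := sum_divisor_pow_block_le hN B
    _ = 3 ^ 2 ^ B * (2 ^ j) ^ (2 ^ B + A) * (N / (2 ^ j) ^ A) := by
        rw [pow_add]; field_simp
    _ ≤ _ := by
        gcongr
        exact one_le_two

/-- A modulus up to 2^(j²) is too small to contain a window prime. Hence d is invertible mod q, and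
dm ≡ a is one congruence for m. -/
theorem coprime_of_dvd_primeWindow {j q d : ℕ} (hq1 : 1 ≤ q) (hq : q ≤ 2 ^ j ^ 2)
    (hd : d ∣ ∏ p ∈ primeWindow j, p) : Nat.Coprime d q := by
  refine Nat.coprime_of_dvd fun r hr h1 h2 => ?_
  obtain ⟨p, hp, hrp⟩ := (hr.prime.dvd_finsetProd_iff _).1 (h1.trans hd)
  have h3 := lt_of_mem_primeWindow hp
  rw [← (Nat.prime_dvd_prime_iff_eq hr (prime_of_mem_primeWindow hp)).1 hrp] at h3
  have := Nat.le_of_dvd hq1 h2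
  omega

theorem exists_modEq_mul_iff {d q : ℕ} (hdq : Nat.Coprime d q) (a : ℕ) :
    ∃ c : ℕ, ∀ m : ℕ, d * m ≡ a [MOD q] ↔ m ≡ c [MOD q] := by
  rcases Nat.eq_zero_or_pos q with rfl | hq
  · have hd : d = 1 := by simpa using hdq
    exact ⟨a, fun m => by rw [hd, one_mul]⟩
  · have : NeZero q := ⟨hq.ne'⟩
    refine ⟨(((d : ZMod q)⁻¹ * a : ZMod q)).val, fun m => ?_⟩
    rw [← ZMod.natCast_eq_natCast_iff, ← ZMod.natCast_eq_natCast_iff, ZMod.natCast_zmod_val]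
    push_cast
    have h1 : (d : ZMod q) * (d : ZMod q)⁻¹ = 1 := ZMod.coe_mul_inv_eq_one d hdq
    constructor
    · intro h
      rw [← h, ← mul_assoc, mul_comm _ (d : ZMod q), h1, one_mul]
    · intro h
      rw [h, ← mul_assoc, h1, one_mul]

/-- The sifted main term is small in arithmetic progressions. -/
theorem norm_small_divisor_sum_le (hSW : SiegelWalfisz (fun n => g n))
    (hC : ∀ n : ℕ, 1 ≤ n → ‖g n‖ ≤ (n.divisors.card : ℝ) ^ C) (A : ℕ) :
    ∃ K : ℝ, 0 ≤ K ∧ ∀ j N y q a : ℕ, A ≤ j → 2 ^ 2 ^ j ≤ N → N ≤ 2 ^ 2 ^ (j + 1) → y ≤ N →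
      1 ≤ q → (q : ℝ) ≤ (2 ^ j) ^ A →
      ‖∑ n ∈ Finset.Icc 1 y with n ≡ a [MOD q],
        ∑ d ∈ (∏ p ∈ primeWindow j, p).divisors.filter (fun d => d ^ 2 ≤ N) with d ∣ n,
          (ArithmeticFunction.moebius d : ℂ) * g d * g (n / d)‖ ≤ K * (N / (2 ^ j) ^ A) := by
  set D := 2 ^ C with hD
  -- The extra D powers of L pay for the sum of τ(d)^C/d, which is at most (3L)^D.
  obtain ⟨K, hK, hsw⟩ := hSW.uniform hC (A + D)
  refine ⟨3 ^ D * K, by positivity, fun j N y q a hAj hN1 hN2 hy hq1 hq2 => ?_⟩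
  set L : ℝ := 2 ^ j with hL
  have hL1 : 1 ≤ L := one_le_pow₀ one_le_two
  have hN0 : 0 < N := lt_of_lt_of_le (by positivity) hN1
  set 𝒟 := (∏ p ∈ primeWindow j, p).divisors.filter (fun d => d ^ 2 ≤ N) with h𝒟
  have hq3 : q ≤ 2 ^ j ^ 2 := by
    have h1 : ((2 : ℝ) ^ j) ^ A ≤ 2 ^ j ^ 2 := by
      rw [← pow_mul, sq]
      exact pow_le_pow_right₀ one_le_two (Nat.mul_le_mul_left j hAj)
    exact_mod_cast hq2.trans h1
  have hdpos : ∀ d ∈ 𝒟, 0 < d := fun d hd =>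
    Nat.pos_of_mem_divisors (Finset.mem_filter.1 hd).1
  set F : ℕ → ℕ → ℂ := fun d n =>
    if n ≡ a [MOD q] then (ArithmeticFunction.moebius d : ℂ) * g d * g (n / d) else 0 with hF
  have hswap : ∑ n ∈ Finset.Icc 1 y with n ≡ a [MOD q], ∑ d ∈ 𝒟 with d ∣ n,
      (ArithmeticFunction.moebius d : ℂ) * g d * g (n / d) =
      ∑ d ∈ 𝒟, ∑ m ∈ Finset.Icc 1 (y / d), F d (d * m) := by
    rw [← sum_sum_dvd_eq 𝒟 hdpos y F, Finset.sum_filter]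
    refine Finset.sum_congr rfl fun n _ => ?_
    simp only [hF]
    split_ifs
    · rfl
    · simp
  rw [hswap]
  have hterm : ∀ d ∈ 𝒟, ‖∑ m ∈ Finset.Icc 1 (y / d), F d (d * m)‖ ≤
      K * (N / L ^ (A + D)) * ((d.divisors.card : ℝ) ^ C / d) := by
    intro d hd
    have hd0 := hdpos d hd
    have hd0' : (0 : ℝ) < d := by exact_mod_cast hd0
    rw [h𝒟, Finset.mem_filter, Nat.mem_divisors] at hd
    obtain ⟨c, hc⟩ := exists_modEq_mul_iff (coprime_of_dvd_primeWindow hq1 hq3 hd.1.1) a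
    have h1 : ∑ m ∈ Finset.Icc 1 (y / d), F d (d * m) =
        ((ArithmeticFunction.moebius d : ℂ) * g d) *
          ∑ m ∈ Finset.Icc 1 (y / d) with m ≡ c [MOD q], g m := by
      rw [Finset.mul_sum, Finset.sum_filter]
      refine Finset.sum_congr rfl fun m _ => ?_
      simp only [hF, hc m, Nat.mul_div_cancel_left m hd0]
    have hd2 : ((d : ℝ)) ^ 2 ≤ N := by exact_mod_cast hd.2
    have h2 := hsw j (N / d) (by
        rw [div_pow, le_div_iff₀ (by positivity)]
        calc (2 : ℝ) ^ 2 ^ j * (d : ℝ) ^ 2 ≤ N * N := by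
              gcongr
              exact_mod_cast hN1
          _ = _ := by ring)
      (by positivity)
      ((div_le_self (by positivity) (by exact_mod_cast hd0)).trans (by exact_mod_cast hN2))
      (y / d) q c
      (Nat.cast_div_le.trans (by gcongr)) hq1 (hq2.trans (pow_le_pow_right₀ hL1 (Nat.le_add_right _ _)))
    rw [h1, norm_mul]
    have h3 : ‖(ArithmeticFunction.moebius d : ℂ) * g d‖ ≤ (d.divisors.card : ℝ) ^ C := by
      rw [norm_mul]
      exact (mul_le_of_le_one_left (norm_nonneg _) (norm_moebius_cast_le d)).trans (hC d hd0)
    calc _ ≤ (d.divisors.card : ℝ) ^ C * (K * (N / d / L ^ (A + D))) :=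
          mul_le_mul h3 h2 (norm_nonneg _) (by positivity)
      _ = _ := by ring
  refine (norm_sum_le _ _).trans ((Finset.sum_le_sum hterm).trans ?_)
  rw [← Finset.mul_sum]
  have hsum : ∑ d ∈ 𝒟, (d.divisors.card : ℝ) ^ C / d ≤ 3 ^ D * L ^ D := by
    have hsub : 𝒟 ⊆ Finset.Icc 1 N := fun d hd =>
      Finset.mem_Icc.2 ⟨hdpos d hd,
        (Nat.le_self_pow two_ne_zero d).trans (Finset.mem_filter.1 hd).2⟩
    have h0 := Real.log_natCast_nonneg N
    calc _ ≤ ∑ d ∈ Finset.Icc 1 N, (d.divisors.card : ℝ) ^ C / d :=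
          Finset.sum_le_sum_of_subset_of_nonneg hsub fun _ _ _ => by positivity
      _ ≤ (1 + Real.log N) ^ D := sum_divisor_pow_div_le_log C N
      _ ≤ (3 * L) ^ D := by gcongr; exact one_add_log_le hN2
      _ = _ := mul_pow _ _ _
  calc _ ≤ K * (N / L ^ (A + D)) * (3 ^ D * L ^ D) := by gcongr
    _ = _ := by rw [pow_add]; field_simp

/-- `windowPart` is g minus `sievedPart`: the assumption handles g, and the truncated Legendre sum
handles `sievedPart` up to negligible errors. This is the base of the induction on the degree and
the only route by which equidistribution of g enters. -/
theorem windowPart_progression (hmul : g.IsMultiplicative) (hSW : SiegelWalfisz (fun n => g n))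
    (hC : ∀ n : ℕ, 1 ≤ n → ‖g n‖ ≤ (n.divisors.card : ℝ) ^ C) (A : ℕ) :
    ∃ K : ℝ, 0 ≤ K ∧ ∀ j N y q a : ℕ, 2 ^ 2 ^ j ≤ N → N ≤ 2 ^ 2 ^ (j + 1) → y ≤ N →
      1 ≤ q → (q : ℝ) ≤ (2 ^ j) ^ A →
      ‖∑ n ∈ Finset.Icc 1 y with n ≡ a [MOD q], windowPart g j n‖ ≤ K * (N / (2 ^ j) ^ A) := by
  obtain ⟨K₁, hK₁, h₁⟩ := hSW.uniform hC A
  obtain ⟨K₂, hK₂, h₂⟩ := norm_small_divisor_sum_le hSW hC A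
  obtain ⟨K₃, hK₃, h₃⟩ := sum_sq_dvd_primeWindow_le A (2 * C + 1)
  obtain ⟨K₄, hK₄, h₄⟩ := sum_divisor_pow_div_two_pow_sq_le A (2 * C + 3)
  set K₀ : ℝ := 3 ^ 2 ^ C * (2 ^ A) ^ (2 ^ C + A) with hK₀
  refine ⟨K₀ + (K₁ + K₂ + (2 * K₃ + K₄)), by positivity,
    fun j N y q a hN1 hN2 hy hq1 hq2 => ?_⟩
  set W : ℝ := N / (2 ^ j) ^ A with hW
  have hW0 : 0 ≤ W := by positivity
  by_cases hj : j ≤ A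
  · refine (norm_sum_le_of_index_lt A (fun n hn => norm_windowPart_le hC j hn) hj hN2
      ((Finset.filter_subset _ _).trans (Finset.Icc_subset_Icc_right hy))).trans ?_
    exact mul_le_mul_of_nonneg_right (le_add_of_nonneg_right (by positivity)) hW0
  push Not at hj
  set s : ℕ → ℂ := fun n =>
    ∑ d ∈ (∏ p ∈ primeWindow j, p).divisors.filter (fun d => d ^ 2 ≤ N) with d ∣ n,
      (ArithmeticFunction.moebius d : ℂ) * g d * g (n / d) with hs
  have hsplit : ∑ n ∈ Finset.Icc 1 y with n ≡ a [MOD q], windowPart g j n =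
      ∑ n ∈ Finset.Icc 1 y with n ≡ a [MOD q], g n -
        ∑ n ∈ Finset.Icc 1 y with n ≡ a [MOD q], s n -
        ∑ n ∈ Finset.Icc 1 y with n ≡ a [MOD q], (sievedPart g j n - s n) := by
    rw [← Finset.sum_sub_distrib, ← Finset.sum_sub_distrib]
    refine Finset.sum_congr rfl fun n _ => ?_
    rw [← windowPart_add_sievedPart g j n]; ring
  have hN0 : (1 : ℝ) ≤ N := by exact_mod_cast Nat.one_le_two_pow.trans hN1
  have e1 : ‖∑ n ∈ Finset.Icc 1 y with n ≡ a [MOD q], g n‖ ≤ K₁ * W := by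
    refine h₁ j N ?_ (by positivity) (by exact_mod_cast hN2) y q a (by exact_mod_cast hy) hq1 hq2
    calc (2 : ℝ) ^ 2 ^ j ≤ N := by exact_mod_cast hN1
      _ ≤ _ := le_self_pow₀ hN0 two_ne_zero
  have e2 : ‖∑ n ∈ Finset.Icc 1 y with n ≡ a [MOD q], s n‖ ≤ K₂ * W :=
    h₂ j N y q a hj.le hN1 hN2 hy hq1 hq2
  have e3 : ‖∑ n ∈ Finset.Icc 1 y with n ≡ a [MOD q], (sievedPart g j n - s n)‖ ≤
      (2 * K₃ + K₄) * W := by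
    have hsub : (Finset.Icc 1 y).filter (fun n => n ≡ a [MOD q]) ⊆ Finset.Icc 1 N :=
      (Finset.filter_subset _ _).trans (Finset.Icc_subset_Icc_right hy)
    calc _ ≤ ∑ n ∈ Finset.Icc 1 y with n ≡ a [MOD q],
          (2 * (if ∃ p ∈ primeWindow j, p ^ 2 ∣ n then (n.divisors.card : ℝ) ^ (2 * C + 1) else 0) +
            (n.divisors.card : ℝ) ^ (2 * C + 3) / 2 ^ j ^ 2) :=
          (norm_sum_le _ _).trans (Finset.sum_le_sum fun n hn =>
            norm_sievedPart_sub_le hmul hC j N hN1 (Finset.mem_Icc.1 (hsub hn)).1)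
      _ ≤ ∑ n ∈ Finset.Icc 1 N,
          (2 * (if ∃ p ∈ primeWindow j, p ^ 2 ∣ n then (n.divisors.card : ℝ) ^ (2 * C + 1) else 0) +
            (n.divisors.card : ℝ) ^ (2 * C + 3) / 2 ^ j ^ 2) :=
          Finset.sum_le_sum_of_subset_of_nonneg hsub fun _ _ _ => by positivity
      _ = 2 * (∑ n ∈ Finset.Icc 1 N with ∃ p ∈ primeWindow j, p ^ 2 ∣ n,
            (n.divisors.card : ℝ) ^ (2 * C + 1)) +
          (∑ n ∈ Finset.Icc 1 N, (n.divisors.card : ℝ) ^ (2 * C + 3)) / 2 ^ j ^ 2 := by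
          rw [Finset.sum_add_distrib, ← Finset.mul_sum, Finset.sum_filter, Finset.sum_div]
      _ ≤ 2 * (K₃ * W) + K₄ * W := by
          gcongr
          · exact h₃ j N hN2
          · exact h₄ j N hN2
      _ = _ := by ring
  rw [hsplit]
  calc _ ≤ K₁ * W + K₂ * W + (2 * K₃ + K₄) * W :=
        (norm_sub_le _ _).trans (add_le_add ((norm_sub_le _ _).trans (add_le_add e1 e2)) e3)
    _ = (K₁ + K₂ + (2 * K₃ + K₄)) * W := by ring
    _ ≤ _ := mul_le_mul_of_nonneg_right (le_add_of_nonneg_left (by positivity)) hW0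

end

/-! ### Ramaré's identity and the Type II dichotomy -/

/-- The number of primes of the window dividing `n`. -/
def windowOmega (j n : ℕ) : ℕ := ((primeWindow j).filter (fun p => p ∣ n)).card

section

variable {g : ArithmeticFunction ℂ} {C : ℕ}

/-- Ramaré's identity, away from integers divisible by the square of a prime of the window. -/
theorem ramare_identity (hmul : g.IsMultiplicative) {j n : ℕ}
    (hn : ¬ ∃ p ∈ primeWindow j, p ^ 2 ∣ n) :
    ∑ p ∈ primeWindow j with p ∣ n, g p * (g (n / p) / (1 + windowOmega j (n / p) : ℕ)) =
      windowPart g j n := by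
  have hterm : ∀ p ∈ (primeWindow j).filter (fun p => p ∣ n),
      g p * (g (n / p) / (1 + windowOmega j (n / p) : ℕ)) = g n / (windowOmega j n : ℕ) := by
    intro p hp
    have hp' := Finset.mem_filter.1 hp
    have hpp := prime_of_mem_primeWindow hp'.1
    have hcop : Nat.Coprime p (n / p) := coprime_div_of_dvd_prod
      (fun p hp => prime_of_mem_primeWindow hp) hp'.2 (Finset.dvd_prod_of_mem _ hp'.1) hn
    have hset : (primeWindow j).filter (fun r => r ∣ n / p) =
        ((primeWindow j).filter (fun r => r ∣ n)).erase p := by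
      ext r
      rw [Finset.mem_erase, Finset.mem_filter, Finset.mem_filter]
      constructor
      · rintro ⟨hr, hrn⟩
        refine ⟨?_, hr, hrn.trans (Nat.div_dvd_of_dvd hp'.2)⟩
        rintro rfl
        exact (hpp.coprime_iff_not_dvd.1 hcop) hrn
      · rintro ⟨hrp, hr, hrn⟩
        refine ⟨hr, ?_⟩
        rw [← Nat.mul_div_cancel' hp'.2] at hrn
        exact (((Nat.coprime_primes (prime_of_mem_primeWindow hr) hpp).2 hrp).dvd_mul_left).1 hrn
    -- As p² does not divide n, passing to n/p removes exactly p from the window primes dividing n.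
    -- The weight thus depends on the cofactor alone, as a bilinear sum requires.
    have hω : 1 + windowOmega j (n / p) = windowOmega j n := by
      unfold windowOmega
      rw [hset, Finset.card_erase_of_mem hp]
      have := Finset.card_pos.2 ⟨p, hp⟩
      omega
    rw [hω, mul_div_assoc', ← hmul.map_mul_of_coprime hcop, Nat.mul_div_cancel' hp'.2]
  rw [Finset.sum_congr rfl hterm, Finset.sum_const, nsmul_eq_mul, windowPart]
  split_ifs with h
  · obtain ⟨p, hp, hpn⟩ := h
    have : (windowOmega j n : ℂ) ≠ 0 :=
      Nat.cast_ne_zero.2 (Finset.card_pos.2 ⟨p, Finset.mem_filter.2 ⟨hp, hpn⟩⟩).ne'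
    exact mul_div_cancel₀ _ this
  · have : (primeWindow j).filter (fun p => p ∣ n) = ∅ :=
      Finset.filter_eq_empty_iff.2 fun p hp hpn => h ⟨p, hp, hpn⟩
    rw [this]; simp

theorem norm_div_one_add_nat_le (z : ℂ) (m : ℕ) : ‖z / (1 + m : ℕ)‖ ≤ ‖z‖ := by
  rw [norm_div, Complex.norm_natCast]
  exact div_le_self (norm_nonneg _) (by push_cast; linarith [Nat.cast_nonneg (α := ℝ) m])

theorem norm_windowPart_sub_ramare_le (hmul : g.IsMultiplicative)
    (hC : ∀ n : ℕ, 1 ≤ n → ‖g n‖ ≤ (n.divisors.card : ℝ) ^ C) (j : ℕ) {n : ℕ} (hn : 1 ≤ n) :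
    ‖windowPart g j n -
      ∑ p ∈ primeWindow j with p ∣ n, g p * (g (n / p) / (1 + windowOmega j (n / p) : ℕ))‖ ≤
    2 * (if ∃ p ∈ primeWindow j, p ^ 2 ∣ n then (n.divisors.card : ℝ) ^ (2 * C + 1) else 0) := by
  have hτ : (1 : ℝ) ≤ n.divisors.card := by exact_mod_cast Nat.one_le_card_divisors hn
  split_ifs with h
  · have h1 : ‖windowPart g j n‖ ≤ (n.divisors.card : ℝ) ^ (2 * C + 1) :=
      (norm_windowPart_le hC j hn).trans (pow_le_pow_right₀ hτ (by omega))
    have h2 : ‖∑ p ∈ primeWindow j with p ∣ n,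
        g p * (g (n / p) / (1 + windowOmega j (n / p) : ℕ))‖ ≤
        (n.divisors.card : ℝ) ^ (2 * C + 1) := by
      calc _ ≤ ∑ p ∈ primeWindow j with p ∣ n, (n.divisors.card : ℝ) ^ (2 * C) := by
            refine (norm_sum_le _ _).trans (Finset.sum_le_sum fun p hp => ?_)
            refine le_trans ?_ (norm_mul_div_le hC hn (Finset.mem_filter.1 hp).2)
            rw [norm_mul, norm_mul]
            exact mul_le_mul_of_nonneg_left (norm_div_one_add_nat_le _ _) (norm_nonneg _)
        _ ≤ n.divisors.card * (n.divisors.card : ℝ) ^ (2 * C) := by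
            rw [Finset.sum_const, nsmul_eq_mul]
            refine mul_le_mul_of_nonneg_right ?_ (by positivity)
            exact_mod_cast Finset.card_le_card fun d hd =>
              Nat.mem_divisors.2 ⟨(Finset.mem_filter.1 hd).2, by omega⟩
        _ = _ := by ring
    calc _ ≤ _ := norm_sub_le _ _
      _ ≤ _ := by linarith
  · rw [ramare_identity hmul h, sub_self, norm_zero, mul_zero]

theorem sum_Ioc_dyadic {M : Type*} [AddCommMonoid M] (f : ℕ → M) (a b : ℕ) (hab : a ≤ b) :
    ∑ n ∈ Finset.Ioc (2 ^ a) (2 ^ b), f n =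
      ∑ i ∈ Finset.Ico a b, ∑ n ∈ Finset.Ioc (2 ^ i) (2 ^ (i + 1)), f n := by
  induction b, hab using Nat.le_induction with
  | base => simp
  | succ b hab ih =>
    rw [Finset.sum_Ico_succ_top hab, ← ih, Finset.sum_Ioc_consecutive _
      (Nat.pow_le_pow_right two_pos hab) (Nat.pow_le_pow_right two_pos (Nat.le_succ b))]

theorem sum_primeWindow_dyadic {M : Type*} [AddCommMonoid M] (f : ℕ → M) (j : ℕ) :
    ∑ p ∈ primeWindow j, f p = ∑ i ∈ Finset.Ico (j ^ 2) (2 ^ j / (j ^ 2 + 1)),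
      ∑ n ∈ Finset.Ioc (2 ^ i) (2 ^ (i + 1)), if n.Prime then f n else 0 := by
  rcases le_total (j ^ 2) (2 ^ j / (j ^ 2 + 1)) with h | h
  · rw [← sum_Ioc_dyadic _ _ _ h, primeWindow, Finset.sum_filter]
  · rw [primeWindow, Finset.Ioc_eq_empty_of_le (Nat.pow_le_pow_right two_pos h),
      Finset.Ico_eq_empty_of_le h]
    simp

/-- A Type II sum over a dyadic range of primes is small unless the leading coefficient of the
polynomial lies on a major arc. -/
theorem typeII_window (hC : ∀ n : ℕ, 1 ≤ n → ‖g n‖ ≤ (n.divisors.card : ℝ) ^ C) (k A : ℕ) :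
    ∃ E j₀ : ℕ, ∀ j N y i : ℕ, j₀ ≤ j → 2 ^ 2 ^ j ≤ N → N ≤ 2 ^ 2 ^ (j + 1) → y ≤ N → j ^ 2 ≤ i →
      i < 2 ^ j / (j ^ 2 + 1) → ∀ P : Polynomial ℝ, P.natDegree ≤ k + 1 →
      ‖∑ n ∈ Finset.Ioc (2 ^ i) (2 ^ (i + 1)), if n.Prime then ∑ m ∈ Finset.Icc 1 (y / n),
        g n * (g m / (1 + windowOmega j m : ℕ)) * phase (P.eval ((n * m : ℕ) : ℝ)) else 0‖ ≤
          N / (2 ^ j) ^ A ∨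
      ∃ q : ℕ, 1 ≤ q ∧ (q : ℝ) ≤ (2 ^ j) ^ E ∧
        distInt (q * P.coeff (k + 1)) * (N : ℝ) ^ (k + 1) ≤ (2 ^ j) ^ E := by
  obtain ⟨C₁, hII⟩ := typeII_inverse k
  set D := 2 ^ (2 * C) with hD
  -- 2A comes from squaring the lower bound N/L^A, D from the second moment of the coefficients in
  -- m, and the last factor L absorbs 4·4^C·3^D for large j.
  set E₁ := 2 * A + D + 1 with hE₁
  refine ⟨E₁ * C₁, E₁ * C₁ + 6 + 4 * 4 ^ C * 3 ^ D, fun j N y i hj hN1 hN2 hy hi1 hi2 P hP => ?_⟩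
  set L : ℝ := 2 ^ j with hL
  have hL1 : 1 ≤ L := one_le_pow₀ one_le_two
  have hL0 : 0 < L := by linarith
  have hL2 : 2 ≤ L := le_self_pow₀ one_le_two (by omega)
  set S := ∑ n ∈ Finset.Ioc (2 ^ i) (2 ^ (i + 1)), if n.Prime then ∑ m ∈ Finset.Icc 1 (y / n),
        g n * (g m / (1 + windowOmega j m : ℕ)) * phase (P.eval ((n * m : ℕ) : ℝ)) else 0 with hS
  by_cases hsmall : ‖S‖ ≤ N / L ^ A
  · exact Or.inl hsmall
  right
  push Not at hsmall
  set Y := 2 ^ i with hY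
  set M := N / Y + 1 with hM
  -- A prime has two divisors, so dividing by 2^C makes these coefficients bounded by 1.
  set a : ℕ → ℂ := fun n => if n.Prime then g n / 2 ^ C else 0 with ha
  set b : ℕ → ℂ := fun m => g m / (1 + windowOmega j m : ℕ) with hb
  have hi : 1 ≤ i := le_trans (Nat.one_le_pow _ _ (by omega)) hi1
  have hYpos : 0 < Y := by positivity
  have hY2 : 2 ≤ Y := le_self_pow₀ one_le_two (by omega)
  have hYM : N ≤ Y * M := by
    have := Nat.lt_div_mul_add (a := N) hYpos
    rw [hM, mul_add, mul_one, mul_comm]; exact this.le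
  have hib : i * 2 ≤ 2 ^ j := by
    calc i * 2 ≤ 2 ^ j / (j ^ 2 + 1) * (j ^ 2 + 1) :=
          Nat.mul_le_mul hi2.le (by have := Nat.one_le_pow 2 j (by omega); omega)
      _ ≤ 2 ^ j := Nat.div_mul_le_self _ _
  have hN4 : 4 ≤ N := by
    calc 4 = 2 ^ 2 := rfl
      _ ≤ 2 ^ 2 ^ j := Nat.pow_le_pow_right two_pos (by omega)
      _ ≤ N := hN1
  have hYN : Y ≤ N := (Nat.pow_le_pow_right two_pos (by omega)).trans hN1
  have hMN : M ≤ N := by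
    have : N / Y ≤ N / 2 := Nat.div_le_div_left hY2 two_pos
    omega
  have hYM2 : (Y : ℝ) * M ≤ 2 * N := by
    have h1 : Y * M ≤ 2 * N := by
      have := Nat.mul_div_le N Y
      rw [hM, mul_add, mul_one]; omega
    exact_mod_cast h1
  have hMpos : (0 : ℝ) < M := by positivity
  have hY0 : (0 : ℝ) < Y := by exact_mod_cast hYpos
  have hSa : S = 2 ^ C * ∑ n ∈ Finset.Ioc Y (2 * Y), ∑ m ∈ Finset.Icc 1 (y / n),
      a n * b m * phase (P.eval ((n : ℝ) * m)) := by
    rw [hS, Finset.mul_sum, pow_succ' 2 i]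
    refine Finset.sum_congr rfl fun n _ => ?_
    simp only [ha, hb]
    split_ifs
    · rw [Finset.mul_sum]
      refine Finset.sum_congr rfl fun m _ => ?_
      push_cast
      field_simp
    · simp
  have ha1 : ∀ n, ‖a n‖ ≤ 1 := fun n => by
    simp only [ha]
    split_ifs with hn
    · have := hC n hn.one_lt.le
      rw [hn.divisors, Finset.card_pair hn.one_lt.ne] at this
      rw [norm_div, norm_pow, Complex.norm_ofNat, div_le_one (by positivity)]
      exact_mod_cast this
    · simp
  have hbB : ∑ m ∈ Finset.Icc 1 M, ‖b m‖ ^ 2 ≤ 3 ^ D * M * L ^ D := by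
    refine le_trans (Finset.sum_le_sum fun m hm => ?_)
      (sum_divisor_pow_block_le (hMN.trans hN2) (2 * C))
    rw [mul_comm 2 C, pow_mul]
    have : ‖b m‖ ≤ (m.divisors.card : ℝ) ^ C :=
      (norm_div_one_add_nat_le _ _).trans (hC m (Finset.mem_Icc.1 hm).1)
    gcongr
  have hinv : ((L ^ E₁)⁻¹)⁻¹ ^ C₁ = L ^ (E₁ * C₁) := by rw [inv_inv, ← pow_mul]
  have hbig : (4 * 4 ^ C * 3 ^ D : ℝ) ≤ L := by
    have h1 : 4 * 4 ^ C * 3 ^ D ≤ 2 ^ j := le_trans (by omega) (Nat.lt_two_pow_self (n := j)).le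
    rw [hL]
    exact_mod_cast h1
  have hE₁0 : E₁ ≠ 0 := Nat.succ_ne_zero _
  obtain ⟨q, hq1, hq2, hq3⟩ := hII (L ^ E₁)⁻¹ (by positivity) (by
      rw [inv_le_comm₀ (by positivity) (by positivity), one_div, inv_inv]
      exact hL2.trans (le_self_pow₀ hL1 hE₁0)) Y M y (by
      rw [hinv, hL, ← pow_mul, hY]
      push_cast
      -- Y ≥ 2^(j²) exceeds L^(E₁C₁) once j ≥ E₁C₁; this is the purpose of the window's lower end.
      refine pow_le_pow_right₀ one_le_two (le_trans ?_ hi1)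
      rw [sq]
      exact Nat.mul_le_mul_left j (by omega)) (by
      rw [hinv, hL, ← pow_mul]
      -- Y is at most the square root of 2^(2^j). If M were below L^(E₁C₁), itself at most that
      -- square root for large j, then YM < 2^(2^j) ≤ N.
      by_contra hcon
      push Not at hcon
      have h1 : M < 2 ^ (j * (E₁ * C₁)) := by exact_mod_cast hcon
      have h2 : j * (E₁ * C₁) ≤ 2 ^ (j - 1) := by
        have h3 := sq_lt_two_pow (j := j - 1) (by omega)
        obtain ⟨t, rfl⟩ : ∃ t, j = t + 1 := ⟨j - 1, by omega⟩
        rw [Nat.add_sub_cancel] at h3 ⊢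
        refine le_trans ?_ h3
        have h4 : E₁ * C₁ + 5 ≤ t := by omega
        nlinarith
      have h5 : 2 ^ (j * (E₁ * C₁)) ≤ 2 ^ 2 ^ (j - 1) := Nat.pow_le_pow_right two_pos h2
      have h6 : 2 ^ j = 2 * 2 ^ (j - 1) := by
        rw [← pow_succ']; congr 1; omega
      have h7 : Y ≤ 2 ^ 2 ^ (j - 1) := Nat.pow_le_pow_right two_pos (by omega)
      have h8 : Y * M < 2 ^ 2 ^ j := by
        calc Y * M < Y * 2 ^ 2 ^ (j - 1) := Nat.mul_lt_mul_of_pos_left (h1.trans_le h5) hYpos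
          _ ≤ 2 ^ 2 ^ (j - 1) * 2 ^ 2 ^ (j - 1) := Nat.mul_le_mul_right _ h7
          _ = 2 ^ 2 ^ j := by rw [← pow_add, h6, two_mul]
      omega) (hy.trans hYM) a b ha1 (3 ^ D * M * L ^ D) (by positivity) hbB P hP (by
      have h1 : (N / L ^ A) ^ 2 ≤ ‖S‖ ^ 2 := by
        have : 0 ≤ N / L ^ A := by positivity
        gcongr
      rw [hSa, norm_mul, norm_pow, Complex.norm_ofNat, mul_pow] at h1
      have h2 : (L ^ E₁)⁻¹ * Y ^ 2 * M * (3 ^ D * M * L ^ D) * 4 ^ C ≤ (N / L ^ A) ^ 2 := by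
        rw [div_pow, le_div_iff₀ (by positivity)]
        calc (L ^ E₁)⁻¹ * Y ^ 2 * M * (3 ^ D * M * L ^ D) * 4 ^ C * (L ^ A) ^ 2
            = (Y * M) ^ 2 * (4 ^ C * 3 ^ D) * ((L ^ E₁)⁻¹ * L ^ (2 * A + D)) := by
              ring
          _ = (Y * M) ^ 2 * (4 ^ C * 3 ^ D) * L⁻¹ := by
              rw [hE₁, pow_succ L]; field_simp
          _ ≤ (2 * N) ^ 2 * (4 ^ C * 3 ^ D) * L⁻¹ := by gcongr
          _ = N ^ 2 * (4 * 4 ^ C * 3 ^ D * L⁻¹) := by ring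
          _ ≤ N ^ 2 * (L * L⁻¹) := by gcongr
          _ = _ := by rw [mul_inv_cancel₀ hL0.ne', mul_one]
      have h3 : (((2 : ℝ) ^ C)) ^ 2 = 4 ^ C := by rw [← pow_mul, mul_comm, pow_mul]; norm_num
      rw [h3] at h1
      have h4 := h2.trans h1
      rw [mul_comm ((4 : ℝ) ^ C)] at h4
      exact le_of_mul_le_mul_right h4 (by positivity))
  rw [hinv] at hq2 hq3
  refine ⟨q, hq1, hq2, le_trans ?_ hq3⟩
  have h1 : (N : ℝ) ≤ Y * M := by exact_mod_cast hYM
  have := distInt_nonneg (q * P.coeff (k + 1))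
  gcongr

/-- The twisted sum of the windowed function is small unless the leading coefficient of the
polynomial lies on a major arc. -/
theorem windowPart_dichotomy (hmul : g.IsMultiplicative)
    (hC : ∀ n : ℕ, 1 ≤ n → ‖g n‖ ≤ (n.divisors.card : ℝ) ^ C) (k A : ℕ) :
    ∃ (E : ℕ) (K : ℝ), 0 ≤ K ∧ ∀ j N y : ℕ, 2 ^ 2 ^ j ≤ N → N ≤ 2 ^ 2 ^ (j + 1) → y ≤ N →
      ∀ P : Polynomial ℝ, P.natDegree ≤ k + 1 →
      ‖∑ n ∈ Finset.Icc 1 y, windowPart g j n * phase (P.eval (n : ℝ))‖ ≤ K * (N / (2 ^ j) ^ A) ∨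
      ∃ q : ℕ, 1 ≤ q ∧ (q : ℝ) ≤ (2 ^ j) ^ E ∧
        distInt (q * P.coeff (k + 1)) * (N : ℝ) ^ (k + 1) ≤ (2 ^ j) ^ E := by
  -- The extra power of 2^j pays for the dyadic ranges of the window, of which there are at most
  -- 2^j.
  obtain ⟨E, j₀, hII⟩ := typeII_window hC k (A + 1)
  obtain ⟨K₃, hK₃, h₃⟩ := sum_sq_dvd_primeWindow_le A (2 * C + 1)
  set K₀ : ℝ := 3 ^ 2 ^ C * (2 ^ j₀) ^ (2 ^ C + A) with hK₀
  refine ⟨E, K₀ + (1 + 2 * K₃), by positivity, fun j N y hN1 hN2 hy P hP => ?_⟩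
  set W : ℝ := N / (2 ^ j) ^ A with hW
  have hW0 : 0 ≤ W := by positivity
  by_cases hj : j ≤ j₀
  · left
    refine (norm_sum_le_of_index_lt A (fun n hn => ?_) hj hN2
      (Finset.Icc_subset_Icc_right hy)).trans
      (mul_le_mul_of_nonneg_right (le_add_of_nonneg_right (by positivity)) hW0)
    rw [norm_mul, norm_phase, mul_one]
    exact norm_windowPart_le hC j hn
  push Not at hj
  by_cases hmajor : ∃ q : ℕ, 1 ≤ q ∧ (q : ℝ) ≤ (2 ^ j) ^ E ∧
      distInt (q * P.coeff (k + 1)) * (N : ℝ) ^ (k + 1) ≤ (2 ^ j) ^ E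
  · exact Or.inr hmajor
  left
  set r : ℕ → ℂ := fun n =>
    ∑ p ∈ primeWindow j with p ∣ n, g p * (g (n / p) / (1 + windowOmega j (n / p) : ℕ)) with hr
  set b := 2 ^ j / (j ^ 2 + 1) with hb
  have hsplit : ∑ n ∈ Finset.Icc 1 y, windowPart g j n * phase (P.eval (n : ℝ)) =
      ∑ n ∈ Finset.Icc 1 y, r n * phase (P.eval (n : ℝ)) +
        ∑ n ∈ Finset.Icc 1 y, (windowPart g j n - r n) * phase (P.eval (n : ℝ)) := by
    rw [← Finset.sum_add_distrib]
    exact Finset.sum_congr rfl fun n _ => by ring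
  have hmain : ∑ n ∈ Finset.Icc 1 y, r n * phase (P.eval (n : ℝ)) =
      ∑ i ∈ Finset.Ico (j ^ 2) b, ∑ n ∈ Finset.Ioc (2 ^ i) (2 ^ (i + 1)),
        if n.Prime then ∑ m ∈ Finset.Icc 1 (y / n),
          g n * (g m / (1 + windowOmega j m : ℕ)) * phase (P.eval ((n * m : ℕ) : ℝ)) else 0 := by
    rw [← sum_primeWindow_dyadic (fun n => ∑ m ∈ Finset.Icc 1 (y / n),
      g n * (g m / (1 + windowOmega j m : ℕ)) * phase (P.eval ((n * m : ℕ) : ℝ)))]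
    have hpos : ∀ p ∈ primeWindow j, 0 < p := fun p hp => (prime_of_mem_primeWindow hp).pos
    have := sum_sum_dvd_eq (primeWindow j) hpos y (fun p n =>
      g p * (g (n / p) / (1 + windowOmega j (n / p) : ℕ)) * phase (P.eval (n : ℝ)))
    simp only [hr, Finset.sum_mul]
    rw [this]
    refine Finset.sum_congr rfl fun p hp => Finset.sum_congr rfl fun m _ => ?_
    rw [Nat.mul_div_cancel_left m (hpos p hp)]
  have e1 : ‖∑ n ∈ Finset.Icc 1 y, r n * phase (P.eval (n : ℝ))‖ ≤ W := by
    rw [hmain]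
    calc _ ≤ ∑ i ∈ Finset.Ico (j ^ 2) b, N / (2 ^ j : ℝ) ^ (A + 1) := by
          refine (norm_sum_le _ _).trans (Finset.sum_le_sum fun i hi => ?_)
          rw [Finset.mem_Ico] at hi
          exact (hII j N y i hj.le hN1 hN2 hy hi.1 hi.2 P hP).resolve_right hmajor
      _ ≤ 2 ^ j * (N / (2 ^ j : ℝ) ^ (A + 1)) := by
          rw [Finset.sum_const, nsmul_eq_mul, Nat.card_Ico]
          gcongr
          have : b - j ^ 2 ≤ 2 ^ j := (Nat.sub_le _ _).trans (Nat.div_le_self _ _)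
          exact_mod_cast this
      _ = W := by rw [hW, pow_succ]; field_simp
  have e2 : ‖∑ n ∈ Finset.Icc 1 y, (windowPart g j n - r n) * phase (P.eval (n : ℝ))‖ ≤
      2 * (K₃ * W) := by
    calc _ ≤ ∑ n ∈ Finset.Icc 1 N, 2 * (if ∃ p ∈ primeWindow j, p ^ 2 ∣ n then
            (n.divisors.card : ℝ) ^ (2 * C + 1) else 0) := by
          refine (norm_sum_le _ _).trans (le_trans (Finset.sum_le_sum fun n hn => ?_)
            (Finset.sum_le_sum_of_subset_of_nonneg (Finset.Icc_subset_Icc_right hy)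
              fun _ _ _ => by positivity))
          rw [norm_mul, norm_phase, mul_one]
          exact norm_windowPart_sub_ramare_le hmul hC j (Finset.mem_Icc.1 hn).1
      _ ≤ _ := by
          rw [← Finset.mul_sum, ← Finset.sum_filter]
          exact mul_le_mul_of_nonneg_left (h₃ j N hN2) zero_le_two
  rw [hsplit]
  calc _ ≤ W + 2 * (K₃ * W) := (norm_add_le _ _).trans (add_le_add e1 e2)
    _ = (1 + 2 * K₃) * W := by ring
    _ ≤ _ := mul_le_mul_of_nonneg_right (le_add_of_nonneg_left (by positivity)) hW0

end

/-! ### Major arcs -/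

/-- Abel summation; it will remove the smooth phase left over from a rational approximation to the
leading coefficient. -/
theorem norm_sum_mul_le_of_variation (c φ : ℕ → ℂ) (y : ℕ) {S V : ℝ}
    (hS : ∀ z ≤ y, ‖∑ n ∈ Finset.Icc 1 z, c n‖ ≤ S) (hφ : ‖φ y‖ ≤ 1)
    (hV : ∑ n ∈ Finset.range y, ‖φ (n + 1) - φ n‖ ≤ V) :
    ‖∑ n ∈ Finset.Icc 1 y, c n * φ n‖ ≤ S * (1 + V) := by
  have habel : ∀ y : ℕ, ∑ n ∈ Finset.Icc 1 y, c n * φ n = (∑ n ∈ Finset.Icc 1 y, c n) * φ y -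
      ∑ n ∈ Finset.range y, (∑ m ∈ Finset.Icc 1 n, c m) * (φ (n + 1) - φ n) := by
    intro y
    induction y with
    | zero => simp
    | succ y ih =>
      rw [Finset.sum_Icc_succ_top (by omega), Finset.sum_Icc_succ_top (by omega), ih,
        Finset.sum_range_succ]
      ring
  have hS0 : 0 ≤ S := (norm_nonneg _).trans (hS 0 (Nat.zero_le _))
  rw [habel]
  calc _ ≤ S * 1 + S * V := by
        refine (norm_sub_le _ _).trans (add_le_add ?_ ?_)
        · rw [norm_mul]
          exact mul_le_mul (hS y le_rfl) hφ (norm_nonneg _) hS0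
        · calc _ ≤ ∑ n ∈ Finset.range y, S * ‖φ (n + 1) - φ n‖ := by
                refine (norm_sum_le _ _).trans (Finset.sum_le_sum fun n hn => ?_)
                rw [norm_mul]
                exact mul_le_mul_of_nonneg_right (hS n (Finset.mem_range.1 hn).le) (norm_nonneg _)
            _ ≤ S * V := by
                rw [← Finset.mul_sum]
                exact mul_le_mul_of_nonneg_left hV hS0
    _ = _ := by ring

/-- The phase is Lipschitz with constant 2π and n^(k+1) is increasing, so the increments telescope.
-/
theorem sum_norm_phase_diff_le (η : ℝ) (k y : ℕ) :
    ∑ n ∈ Finset.range y, ‖phase (η * ((n + 1 : ℕ) : ℝ) ^ (k + 1)) - phase (η * (n : ℝ) ^ (k + 1))‖ ≤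
      2 * Real.pi * (|η| * (y : ℝ) ^ (k + 1)) := by
  have h : ∀ n : ℕ, ‖phase (η * ((n + 1 : ℕ) : ℝ) ^ (k + 1)) - phase (η * (n : ℝ) ^ (k + 1))‖ ≤
      2 * Real.pi * |η| * (((n + 1 : ℕ) : ℝ) ^ (k + 1) - (n : ℝ) ^ (k + 1)) := by
    intro n
    have h1 : phase (η * ((n + 1 : ℕ) : ℝ) ^ (k + 1)) - phase (η * (n : ℝ) ^ (k + 1)) =
        phase (η * (n : ℝ) ^ (k + 1)) *
          (phase (η * (((n + 1 : ℕ) : ℝ) ^ (k + 1) - (n : ℝ) ^ (k + 1))) - 1) := by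
      rw [mul_sub, mul_one, ← phase_add]
      congr 2; ring
    have h2 : (n : ℝ) ^ (k + 1) ≤ ((n + 1 : ℕ) : ℝ) ^ (k + 1) := by
      gcongr; omega
    rw [h1, norm_mul, norm_phase, one_mul]
    refine (norm_phase_sub_one_le _).trans (le_of_eq ?_)
    rw [abs_mul, abs_of_nonneg (sub_nonneg.2 h2)]; ring
  refine (Finset.sum_le_sum fun n _ => h n).trans (le_of_eq ?_)
  rw [← Finset.mul_sum, Finset.sum_range_sub (fun n : ℕ => (n : ℝ) ^ (k + 1))]
  simp; ring

theorem sum_phase_eq_ite (q n a : ℕ) (hq : 1 ≤ q) :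
    ∑ b ∈ Finset.range q, phase ((b : ℝ) * (((n : ℝ) - a) / q)) =
      if n ≡ a [MOD q] then (q : ℂ) else 0 := by
  have hq0 : (q : ℝ) ≠ 0 := by exact_mod_cast (by omega : q ≠ 0)
  simp only [phase_nat_mul]
  split_ifs with h
  · obtain ⟨t, ht⟩ := (Nat.modEq_iff_dvd.1 h.symm)
    have h1 : ((n : ℝ) - a) / q = (t : ℝ) := by
      rw [div_eq_iff hq0, mul_comm]; exact_mod_cast ht
    rw [h1, phase_int]; simp
  · have hne : phase (((n : ℝ) - a) / q) - 1 ≠ 0 := by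
      intro h0
      have h1 := four_mul_distInt_le (((n : ℝ) - a) / q)
      rw [h0, norm_zero] at h1
      have h2 : distInt (((n : ℝ) - a) / q) = 0 :=
        le_antisymm (by linarith) (distInt_nonneg _)
      rw [distInt_eq, abs_eq_zero, sub_eq_zero, div_eq_iff hq0] at h2
      refine h (Nat.modEq_iff_dvd.2 ⟨round (((n : ℝ) - a) / q), ?_⟩).symm
      rw [mul_comm]; exact_mod_cast h2
    have h3 := geom_sum_mul (phase (((n : ℝ) - a) / q)) q
    rw [← phase_nat_mul, mul_div_cancel₀ _ hq0] at h3
    have h4 : phase ((n : ℝ) - a) = 1 := by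
      have := phase_int ((n : ℤ) - a)
      push_cast at this; exact this
    rw [h4, sub_self] at h3
    exact (mul_eq_zero.1 h3).resolve_right hne

/-- Detecting an arithmetic progression by additive characters. -/
theorem norm_sum_progression_le (f : ℕ → ℂ) (y q a : ℕ) (hq : 1 ≤ q) {S : ℝ}
    (hS : ∀ b : ℕ, ‖∑ n ∈ Finset.Icc 1 y, f n * phase ((b : ℝ) / q * n)‖ ≤ S) :
    ‖∑ n ∈ Finset.Icc 1 y with n ≡ a [MOD q], f n‖ ≤ S := by
  have hq0 : (0 : ℝ) < q := by exact_mod_cast hq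
  have h1 : (q : ℂ) * ∑ n ∈ Finset.Icc 1 y with n ≡ a [MOD q], f n =
      ∑ b ∈ Finset.range q, phase (-((b : ℝ) / q * a)) *
        ∑ n ∈ Finset.Icc 1 y, f n * phase ((b : ℝ) / q * n) := by
    simp only [Finset.mul_sum]
    rw [Finset.sum_comm, Finset.sum_filter]
    refine Finset.sum_congr rfl fun n _ => ?_
    have h2 : ∑ b ∈ Finset.range q, phase (-((b : ℝ) / q * a)) * (f n * phase ((b : ℝ) / q * n)) =
        f n * ∑ b ∈ Finset.range q, phase ((b : ℝ) * (((n : ℝ) - a) / q)) := by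
      rw [Finset.mul_sum]
      refine Finset.sum_congr rfl fun b _ => ?_
      have h3 : (b : ℝ) * (((n : ℝ) - a) / q) = (b : ℝ) / q * n + -((b : ℝ) / q * a) := by ring
      rw [h3, phase_add]; ring
    rw [h2, sum_phase_eq_ite q n a hq]
    split_ifs
    · exact mul_comm _ _
    · rw [mul_zero]
  have h2 : q * ‖∑ n ∈ Finset.Icc 1 y with n ≡ a [MOD q], f n‖ ≤ q * S := by
    calc _ = ‖(q : ℂ) * ∑ n ∈ Finset.Icc 1 y with n ≡ a [MOD q], f n‖ := by
          rw [norm_mul, Complex.norm_natCast]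
      _ ≤ ∑ b ∈ Finset.range q, S := by
          rw [h1]
          refine (norm_sum_le _ _).trans (Finset.sum_le_sum fun b _ => ?_)
          rw [norm_mul, norm_phase, one_mul]
          exact hS b
      _ = _ := by simp
  exact le_of_mul_le_mul_left h2 hq0

/-- A sum twisted by a polynomial phase with major arc leading coefficient reduces to sums in
progressions twisted by polynomial phases of lower degree. -/
theorem norm_sum_major_arc_le (f : ℕ → ℂ) (y q k : ℕ) (hq : 1 ≤ q) (P : Polynomial ℝ)
    (hP : P.natDegree ≤ k + 1) {S V : ℝ} (hV : distInt (q * P.coeff (k + 1)) * (y : ℝ) ^ (k + 1) ≤ V)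
    (hS : ∀ z a : ℕ, z ≤ y → ∀ R : Polynomial ℝ, R.natDegree ≤ k →
      ‖∑ n ∈ Finset.Icc 1 z with n ≡ a [MOD q], f n * phase (R.eval (n : ℝ))‖ ≤ S) :
    ‖∑ n ∈ Finset.Icc 1 y, f n * phase (P.eval (n : ℝ))‖ ≤ q * (S * (1 + 2 * Real.pi * V)) := by
  have hq0 : (0 : ℝ) < q := by exact_mod_cast hq
  set α := P.coeff (k + 1) with hα
  set r := round (q * α) with hr
  -- The leading phase splits into (r/q)n^(k+1), constant on classes mod q, and ηn^(k+1), of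
  -- variation at most 2πV because |η| is at most the distance from qα to the integers.
  set η := α - r / q with hη
  set R := P - Polynomial.C α * Polynomial.X ^ (k + 1) with hR
  have hRdeg : R.natDegree ≤ k := by
    refine Polynomial.natDegree_le_iff_coeff_eq_zero.2 fun n hn => ?_
    rw [hR, Polynomial.coeff_sub, Polynomial.coeff_C_mul, Polynomial.coeff_X_pow]
    rcases eq_or_ne n (k + 1) with rfl | hne
    · rw [if_pos rfl, mul_one, ← hα, sub_self]
    · rw [if_neg hne, mul_zero, sub_zero, Polynomial.natDegree_le_iff_coeff_eq_zero.1 hP n (by omega)]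
  have hηV : |η| * (y : ℝ) ^ (k + 1) ≤ V := by
    refine le_trans ?_ hV
    refine mul_le_mul_of_nonneg_right ?_ (by positivity)
    rw [distInt_eq, ← hr]
    have h1 : q * α - r = q * η := by rw [hη]; field_simp
    rw [h1, abs_mul, abs_of_pos hq0]
    exact le_mul_of_one_le_left (abs_nonneg _) (by exact_mod_cast hq)
  set φ : ℕ → ℂ := fun n => phase (η * (n : ℝ) ^ (k + 1)) with hφ
  have hphase : ∀ n : ℕ, phase (P.eval (n : ℝ)) =
      phase (r / q * (n : ℝ) ^ (k + 1)) * (phase (R.eval (n : ℝ)) * φ n) := by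
    intro n
    simp only [hφ]
    rw [← phase_add, ← phase_add, hR, hη]
    congr 1
    simp; ring
  have hper : ∀ n a : ℕ, n ≡ a [MOD q] →
      phase (r / q * (n : ℝ) ^ (k + 1)) = phase (r / q * (a : ℝ) ^ (k + 1)) := by
    intro n a h
    obtain ⟨t, ht⟩ := Nat.modEq_iff_dvd.1 (h.symm.pow (k + 1))
    have h1 : (n : ℝ) ^ (k + 1) = (a : ℝ) ^ (k + 1) + q * t := by
      have : (n : ℝ) ^ (k + 1) - (a : ℝ) ^ (k + 1) = q * t := by exact_mod_cast ht
      linarith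
    have h2 : r / q * (n : ℝ) ^ (k + 1) = r / q * (a : ℝ) ^ (k + 1) + ((r * t : ℤ) : ℝ) := by
      rw [h1]; push_cast; field_simp
    rw [h2, phase_add, phase_int, mul_one]
  have hfib : ∑ n ∈ Finset.Icc 1 y, f n * phase (P.eval (n : ℝ)) =
      ∑ a ∈ Finset.range q, phase (r / q * (a : ℝ) ^ (k + 1)) * ∑ n ∈ Finset.Icc 1 y,
        (if n ≡ a [MOD q] then f n * phase (R.eval (n : ℝ)) else 0) * φ n := by
    rw [← Finset.sum_fiberwise_of_maps_to (s := Finset.Icc 1 y) (t := Finset.range q)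
      (g := fun n => n % q) (fun n _ => Finset.mem_range.2 (Nat.mod_lt n hq))]
    refine Finset.sum_congr rfl fun a ha => ?_
    rw [Finset.mul_sum, Finset.sum_filter]
    refine Finset.sum_congr rfl fun n _ => ?_
    have hiff : n % q = a ↔ n ≡ a [MOD q] := by
      rw [Nat.ModEq, Nat.mod_eq_of_lt (Finset.mem_range.1 ha)]
    simp only [hiff]
    split_ifs with h
    · rw [hphase, hper n a h]; ring
    · ring
  rw [hfib]
  calc _ ≤ ∑ a ∈ Finset.range q, S * (1 + 2 * Real.pi * V) := by
        refine (norm_sum_le _ _).trans (Finset.sum_le_sum fun a _ => ?_)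
        rw [norm_mul, norm_phase, one_mul]
        refine norm_sum_mul_le_of_variation _ φ y (fun z hz => ?_) (norm_phase _).le
          ((sum_norm_phase_diff_le η k y).trans
            (mul_le_mul_of_nonneg_left hηV (by positivity)))
        rw [← Finset.sum_filter]
        exact hS z a hz R hRdeg
    _ = _ := by simp

section

variable {g : ArithmeticFunction ℂ} {C : ℕ}

/-- Additive characters absorb the progression into the polynomial; then the sum is small, or the
leading coefficient lies on a major arc and is stripped off. A is quantified inside the induction
because the lower degree is needed with a larger exponent and larger moduli. -/
theorem windowPart_polynomial_progression (hmul : g.IsMultiplicative)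
    (hSW : SiegelWalfisz (fun n => g n))
    (hC : ∀ n : ℕ, 1 ≤ n → ‖g n‖ ≤ (n.divisors.card : ℝ) ^ C) (k : ℕ) : ∀ A : ℕ,
    ∃ K : ℝ, 0 ≤ K ∧ ∀ j N y q a : ℕ, 2 ^ 2 ^ j ≤ N → N ≤ 2 ^ 2 ^ (j + 1) → y ≤ N →
      1 ≤ q → (q : ℝ) ≤ (2 ^ j) ^ A → ∀ P : Polynomial ℝ, P.natDegree ≤ k →
      ‖∑ n ∈ Finset.Icc 1 y with n ≡ a [MOD q], windowPart g j n * phase (P.eval (n : ℝ))‖ ≤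
        K * (N / (2 ^ j) ^ A) := by
  induction k with
  | zero =>
    intro A
    obtain ⟨K, hK, h⟩ := windowPart_progression hmul hSW hC A
    refine ⟨K, hK, fun j N y q a hN1 hN2 hy hq1 hq2 P hP => ?_⟩
    rw [Polynomial.eq_C_of_natDegree_le_zero hP]
    simp only [Polynomial.eval_C]
    rw [← Finset.sum_mul, norm_mul, norm_phase, mul_one]
    exact h j N y q a hN1 hN2 hy hq1 hq2
  | succ k ih =>
    intro A
    obtain ⟨E, K₁, hK₁, hdich⟩ := windowPart_dichotomy hmul hC k A
    -- Stripping costs one factor L^E for the residue classes and one for the variation.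
    obtain ⟨K₂, hK₂, hlow⟩ := ih (A + 2 * E)
    refine ⟨K₁ + 8 * K₂, by positivity, fun j N y q a hN1 hN2 hy hq1 hq2 P hP => ?_⟩
    set L : ℝ := 2 ^ j with hL
    have hL1 : 1 ≤ L := one_le_pow₀ one_le_two
    have hL0 : 0 < L := by linarith
    have hW0 : 0 ≤ N / L ^ A := by positivity
    refine norm_sum_progression_le _ y q a hq1 fun b => ?_
    -- When k = 0 the character changes the top coefficient itself, so the dichotomy must be applied
    -- to P' rather than P.
    set P' := P + Polynomial.C ((b : ℝ) / q) * Polynomial.X with hP'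
    have hP'deg : P'.natDegree ≤ k + 1 := by
      refine (Polynomial.natDegree_add_le _ _).trans (max_le hP ?_)
      exact (Polynomial.natDegree_C_mul_le _ _).trans (Polynomial.natDegree_X_le.trans (by omega))
    have hsum : ∑ n ∈ Finset.Icc 1 y,
        windowPart g j n * phase (P.eval (n : ℝ)) * phase ((b : ℝ) / q * n) =
        ∑ n ∈ Finset.Icc 1 y, windowPart g j n * phase (P'.eval (n : ℝ)) := by
      refine Finset.sum_congr rfl fun n _ => ?_
      rw [mul_assoc, ← phase_add, hP']
      simp
    rw [hsum]
    rcases hdich j N y hN1 hN2 hy P' hP'deg with h | ⟨q', hq'1, hq'2, hq'3⟩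
    · refine h.trans (mul_le_mul_of_nonneg_right (le_add_of_nonneg_right (by positivity)) hW0)
    · have hyN : (y : ℝ) ≤ N := by exact_mod_cast hy
      have hd := distInt_nonneg (q' * P'.coeff (k + 1))
      have hmaj := norm_sum_major_arc_le (windowPart g j) y q' k hq'1 P' hP'deg (V := L ^ E)
        (S := K₂ * (N / L ^ (A + 2 * E))) (le_trans (by gcongr) hq'3)
        (fun z a' hz R hR => hlow j N z q' a' hN1 hN2 (hz.trans hy) hq'1
          (hq'2.trans (pow_le_pow_right₀ hL1 (by omega))) R hR)
      refine hmaj.trans ?_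
      have hLE : 1 ≤ L ^ E := one_le_pow₀ hL1
      have hpi : 1 + 2 * Real.pi * L ^ E ≤ 8 * L ^ E := by
        have := Real.pi_lt_d2
        nlinarith
      calc _ ≤ L ^ E * (K₂ * (N / L ^ (A + 2 * E)) * (8 * L ^ E)) := by gcongr
        _ = 8 * K₂ * (N / L ^ A) := by
            rw [pow_add, mul_comm 2 E, pow_mul]; field_simp
        _ ≤ _ := mul_le_mul_of_nonneg_right (le_add_of_nonneg_left hK₁) hW0

end

/-! ### Gluing the blocks and the final estimates -/

/-- The profile u may not drop too fast, so that the last two blocks share one bound, and it must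
dominate 2^(-jA), so that the integers up to √N are absorbed. K is chosen before F, which makes the
bound uniform over polynomial phases. -/
theorem norm_sum_blockIndex_le (A B : ℕ) {K₁ c : ℝ} (hK₁ : 0 ≤ K₁) {u : ℕ → ℝ}
    (hu : ∀ j, u j ≤ c * u (j + 1)) (hu' : ∀ j, 1 / ((2 : ℝ) ^ j) ^ A ≤ u j) :
    ∃ K : ℝ, ∀ {E : Type} [NormedAddCommGroup E] (F : ℕ → ℕ → E),
      (∀ j n, 1 ≤ n → ‖F j n‖ ≤ (n.divisors.card : ℝ) ^ B) →
      (∀ j N y : ℕ, 2 ^ 2 ^ j ≤ N → N ≤ 2 ^ 2 ^ (j + 1) → y ≤ N →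
        ‖∑ n ∈ Finset.Icc 1 y, F j n‖ ≤ N * (K₁ * u j)) →
      ∀ N : ℕ, 2 ≤ N →
        ‖∑ n ∈ Finset.Icc 1 N, F (blockIndex n) n‖ ≤ N * (K * u (blockIndex N)) := by
  obtain ⟨K₂, hK₂, h₂⟩ := sum_divisor_pow_sqrt_le A B
  have hu0 : ∀ j, 0 ≤ u j := fun j => le_trans (by positivity) (hu' j)
  refine ⟨max K₁ (K₂ + 2 * K₁ * c + 2 * K₁), fun {E} _ F hF hb N hN => ?_⟩
  rcases hJ : blockIndex N with - | j
  · have h4 : N < 4 := by simpa [hJ] using lt_two_pow_blockIndex_succ N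
    have hsum : ∑ n ∈ Finset.Icc 1 N, F (blockIndex n) n = ∑ n ∈ Finset.Icc 1 N, F 0 n :=
      Finset.sum_congr rfl fun n hn => by
        rw [blockIndex_eq_zero ((Finset.mem_Icc.1 hn).2.trans_lt h4)]
    rw [hsum]
    refine (hb 0 N N (by simpa using hN) (by simpa using h4.le) le_rfl).trans ?_
    gcongr
    · exact hu0 0
    · exact le_max_left _ _
  · have hN1 : 2 ^ 2 ^ (j + 1) ≤ N := hJ ▸ two_pow_blockIndex_le hN
    have hN2 : N < 2 ^ 2 ^ (j + 2) := by
      have := lt_two_pow_blockIndex_succ N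
      rwa [hJ] at this
    refine (norm_sum_blocks_le F (fun j => K₁ * u j) B hF hb hN1 hN2).trans ?_
    have h3 := h₂ (j + 1) N (2 ^ 2 ^ j) hN1 hN2.le (by rwa [← two_pow_two_pow_succ])
    calc _ ≤ K₂ * (N / ((2 : ℝ) ^ (j + 1)) ^ A) +
          N * (2 * (K₁ * (c * u (j + 1))) + 2 * (K₁ * u (j + 1))) := by
          gcongr
          exact hu j
      _ = N * (K₂ * (1 / ((2 : ℝ) ^ (j + 1)) ^ A) +
          (2 * K₁ * c + 2 * K₁) * u (j + 1)) := by ring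
      _ ≤ N * (K₂ * u (j + 1) + (2 * K₁ * c + 2 * K₁) * u (j + 1)) := by
          gcongr
          exact hu' _
      _ = N * ((K₂ + 2 * K₁ * c + 2 * K₁) * u (j + 1)) := by ring
      _ ≤ _ := by
          gcongr
          · exact hu0 _
          · exact le_max_right _ _

theorem card_natInterval (N : ℝ) : (natInterval N).card = ⌊N⌋₊ := by
  simp [natInterval]

theorem log_le_two_mul_two_pow_blockIndex {N : ℝ} (hN : 1 ≤ N) :
    Real.log N ≤ 2 * 2 ^ blockIndex ⌊N⌋₊ := by
  set J := blockIndex ⌊N⌋₊ with hJ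
  have h1 : N ≤ 2 ^ 2 ^ (J + 1) := by
    refine (Nat.lt_floor_add_one N).le.trans ?_
    exact_mod_cast lt_two_pow_blockIndex_succ ⌊N⌋₊
  have h2 := Real.log_le_log (by linarith) h1
  rw [Real.log_pow] at h2
  push_cast at h2
  have h3 : Real.log 2 ≤ 1 := by have := Real.log_two_lt_d9; linarith
  have h4 : (2 : ℝ) ^ (J + 1) * Real.log 2 ≤ 2 ^ (J + 1) * 1 := by gcongr
  rw [pow_succ] at h2 h4
  linarith

theorem two_pow_blockIndex_floor_le {N : ℝ} (hN : 2 ≤ N) :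
    2 ^ blockIndex ⌊N⌋₊ ≤ 2 * Real.log N := by
  have h2 : 2 ≤ ⌊N⌋₊ := Nat.le_floor (by exact_mod_cast hN)
  refine two_pow_le_two_mul_log (le_trans ?_ (Nat.floor_le (by linarith)))
  exact_mod_cast two_pow_blockIndex_le h2

theorem one_le_log_of_three_le {N : ℝ} (hN : 3 ≤ N) : 1 ≤ Real.log N := by
  rw [Real.le_log_iff_exp_le (by linarith)]
  have := Real.exp_one_lt_d9
  linarith

theorem uNorm_le {k : ℕ} {N b : ℝ} {f : ℕ → ℂ} (hN : 1 ≤ N)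
    (h : ∀ P : Polynomial ℝ, P.natDegree ≤ k - 1 →
      ‖∑ n ∈ Finset.Icc 1 ⌊N⌋₊, f n * phase (P.eval (n : ℝ))‖ ≤ ⌊N⌋₊ * b) : uNorm k N f ≤ b := by
  have hpos : (0 : ℝ) < ⌊N⌋₊ := by exact_mod_cast Nat.floor_pos.2 hN
  have : Nonempty {P : Polynomial ℝ // P.degree < (k : WithBot ℕ)} :=
    ⟨0, by rw [Polynomial.degree_zero]; exact WithBot.bot_lt_coe k⟩
  refine ciSup_le fun ⟨P, hP⟩ => ?_
  -- The sign accounts for e(-P) in the correlation. For k = 0 only P = 0 occurs, and the truncated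
  -- k - 1 = 0 is still a valid bound.
  have hdeg : (-P).natDegree ≤ k - 1 := by
    rw [Polynomial.natDegree_neg]
    rcases eq_or_ne P 0 with rfl | hP0
    · simp
    · have := (Polynomial.natDegree_lt_iff_degree_lt hP0).2 hP
      omega
  rw [polyCorrelation, Finset.expect_eq_sum_div_card, card_natInterval, norm_div,
    Complex.norm_natCast, div_le_iff₀ hpos, mul_comm b]
  simpa [natInterval] using h (-P) hdeg

section

variable {g : ArithmeticFunction ℂ}

/-- Blocks save integer powers of 2^J, which is at least half of log N, hence the rounding of A. The
modulus 1 recovers the sum over all n. -/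
theorem uNorm_windowPart_le (hmul : g.IsMultiplicative) (hSW : SiegelWalfisz (fun n => g n))
    (k : ℕ) {A : ℝ} : ∃ K : ℝ, ∀ N : ℝ, 3 ≤ N →
      uNorm k N (fun n => windowPart g (blockIndex n) n) ≤ K * Real.log N ^ (-A) := by
  obtain ⟨C, hC⟩ := hSW.exists_nat_bound
  obtain ⟨K₁, hK₁, h₁⟩ := windowPart_polynomial_progression hmul hSW hC (k - 1) ⌈A⌉₊
  obtain ⟨K, hK⟩ := norm_sum_blockIndex_le ⌈A⌉₊ C (c := 2 ^ ⌈A⌉₊)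
    (u := fun j => 1 / ((2 : ℝ) ^ j) ^ ⌈A⌉₊) hK₁
    (fun j => le_of_eq (by rw [pow_succ (2 : ℝ) j, mul_pow]; field_simp)) (fun j => le_rfl)
  refine ⟨|K| * 2 ^ ⌈A⌉₊, fun N hN => ?_⟩
  set J := blockIndex ⌊N⌋₊ with hJ
  have hlog1 := one_le_log_of_three_le hN
  have hlog := log_le_two_mul_two_pow_blockIndex (N := N) (by linarith)
  have key : uNorm k N (fun n => windowPart g (blockIndex n) n) ≤
      K * (1 / ((2 : ℝ) ^ J) ^ ⌈A⌉₊) := by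
    refine uNorm_le (by linarith) fun P hP => ?_
    refine hK (fun j n => windowPart g j n * phase (P.eval (n : ℝ))) (fun j n hn => ?_)
      (fun j N y hN1 hN2 hy => ?_) ⌊N⌋₊ (Nat.le_floor (by norm_num; linarith))
    · rw [norm_mul, norm_phase, mul_one]
      exact norm_windowPart_le hC j hn
    · have h := h₁ j N y 1 0 hN1 hN2 hy le_rfl
        (by exact_mod_cast Nat.one_le_pow _ _ (by positivity)) P hP
      simp only [Nat.modEq_one, Finset.filter_true] at h
      refine h.trans (le_of_eq (by ring))
  have h2 : 1 / ((2 : ℝ) ^ J) ^ ⌈A⌉₊ ≤ 2 ^ ⌈A⌉₊ * Real.log N ^ (-A) := by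
    have h3 : Real.log N ^ A ≤ Real.log N ^ ⌈A⌉₊ := by
      rw [← Real.rpow_natCast]
      exact Real.rpow_le_rpow_of_exponent_le hlog1 (Nat.le_ceil A)
    have h4 : Real.log N ^ A ≤ 2 ^ ⌈A⌉₊ * (2 ^ J) ^ ⌈A⌉₊ := by
      rw [← mul_pow]
      exact h3.trans (by gcongr)
    have h5 : 0 < Real.log N ^ A := Real.rpow_pos_of_pos (by linarith) _
    rw [Real.rpow_neg (by linarith), ← div_eq_mul_inv, div_le_div_iff₀ (by positivity) h5, one_mul]
    exact h4
  calc _ ≤ K * (1 / ((2 : ℝ) ^ J) ^ ⌈A⌉₊) := key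
    _ ≤ |K| * (1 / ((2 : ℝ) ^ J) ^ ⌈A⌉₊) := by gcongr; exact le_abs_self K
    _ ≤ |K| * (2 ^ ⌈A⌉₊ * Real.log N ^ (-A)) := by gcongr
    _ = _ := by ring

/-- Powers of the block index are absorbed into `(log N)^{1/√(log log N)}`. -/
theorem succ_blockIndex_pow_div_le (E : ℕ) : ∃ K : ℝ, 0 ≤ K ∧ ∀ N : ℝ, 3 ≤ N →
    ((blockIndex ⌊N⌋₊ : ℝ) + 1) ^ E / 2 ^ blockIndex ⌊N⌋₊ ≤
      K * Real.log N ^ (-1 + (√(Real.log (Real.log N)))⁻¹) := by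
  refine ⟨2 ^ E * ((2 * E).factorial * Real.exp 1) * 2, by positivity, fun N hN => ?_⟩
  set J := blockIndex ⌊N⌋₊ with hJ
  have hlog1 : 1 < Real.log N := by
    rw [Real.lt_log_iff_exp_lt (by linarith)]
    have := Real.exp_one_lt_d9
    linarith
  have hl := log_le_two_mul_two_pow_blockIndex (N := N) (by linarith)
  have hJ2 := two_pow_blockIndex_floor_le (N := N) (by linarith)
  rw [← hJ] at hl hJ2
  set L := Real.log N with hL
  set x := Real.log L with hx
  have hx0 : 0 < x := Real.log_pos hlog1
  set s := √x with hs
  have hs0 : 0 < s := Real.sqrt_pos.2 hx0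
  have hss : s * s = x := Real.mul_self_sqrt hx0.le
  have hJx : (J : ℝ) ≤ 1 + 2 * x := by
    have h1 := Real.log_le_log (by positivity) hJ2
    rw [Real.log_pow, Real.log_mul two_ne_zero (by positivity), ← hx] at h1
    have h2 := Real.log_two_gt_d9
    have h3 := Real.log_two_lt_d9
    have h4 : (0 : ℝ) ≤ J := J.cast_nonneg
    nlinarith
  -- With s = √(log log N), powers of J are polynomial in s and so are O(e^s) = O((log N)^(1/s)).
  -- The same exponent 1/s serves every E, hence every r.
  have hJ1 : (J : ℝ) + 1 ≤ 2 * (1 + s) ^ 2 := by nlinarith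
  have hexp : (1 + s) ^ (2 * E) ≤ (2 * E).factorial * (Real.exp 1 * Real.exp s) := by
    have h1 := Real.pow_div_factorial_le_exp (1 + s) (by positivity) (2 * E)
    rw [div_le_iff₀ (by positivity), Real.exp_add] at h1
    linarith
  have hpow : L ^ (-1 + s⁻¹) = L⁻¹ * Real.exp s := by
    rw [Real.rpow_add (by linarith), Real.rpow_neg_one, Real.rpow_def_of_pos (by linarith), ← hx,
      ← hss, mul_assoc, mul_inv_cancel₀ hs0.ne', mul_one]
  have hinv : 1 / (2 : ℝ) ^ J ≤ 2 * L⁻¹ := by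
    rw [← div_eq_mul_inv, div_le_div_iff₀ (by positivity) (by linarith)]
    linarith
  rw [hpow]
  calc ((J : ℝ) + 1) ^ E / 2 ^ J ≤ (2 * (1 + s) ^ 2) ^ E / 2 ^ J := by gcongr
    _ = 2 ^ E * (1 + s) ^ (2 * E) * (1 / 2 ^ J) := by rw [mul_pow, ← pow_mul]; ring
    _ ≤ 2 ^ E * ((2 * E).factorial * (Real.exp 1 * Real.exp s)) * (2 * L⁻¹) := by gcongr
    _ = _ := by ring

/-- |g|^r ≤ τ^B with B = ⌈Cr⌉, so sifted moments of τ suffice. The dependence on r stays in the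
constant and never reaches the exponent of log N. -/
theorem expect_norm_sievedPart_rpow_le (hSW : SiegelWalfisz (fun n => g n)) {r : ℝ} (hr : 1 ≤ r) :
    ∃ K : ℝ, ∀ N : ℝ, 3 ≤ N →
      (𝔼 n ∈ natInterval N, ‖sievedPart g (blockIndex n) n‖ ^ r) ≤
        K * Real.log N ^ (-1 + (√(Real.log (Real.log N)))⁻¹) := by
  obtain ⟨C, hC⟩ := hSW.exists_nat_bound
  set B := ⌈C * r⌉₊ with hB
  obtain ⟨K₁, E, hK₁, h₁⟩ := sum_divisor_pow_avoiding_primeWindow_le B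
  obtain ⟨K₂, hK₂, h₂⟩ := succ_blockIndex_pow_div_le E
  obtain ⟨K, hK⟩ := norm_sum_blockIndex_le 1 B (c := 2)
    (u := fun j => ((j : ℝ) + 1) ^ E / 2 ^ j) hK₁
    (fun j => by
      rw [pow_succ (2 : ℝ) j, mul_div_assoc', mul_comm (2 : ℝ), mul_div_mul_right _ _ two_ne_zero]
      push_cast
      gcongr
      linarith)
    (fun j => by
      rw [pow_one]
      gcongr
      exact one_le_pow₀ (by linarith [(j.cast_nonneg : (0 : ℝ) ≤ j)]))
  refine ⟨|K| * K₂, fun N hN => ?_⟩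
  have hpos : (0 : ℝ) < ⌊N⌋₊ := by exact_mod_cast Nat.floor_pos.2 (by linarith)
  set F : ℕ → ℕ → ℝ := fun j n =>
    if ∀ p ∈ primeWindow j, ¬ p ∣ n then (n.divisors.card : ℝ) ^ B else 0 with hF
  have hF0 : ∀ j n, 0 ≤ F j n := fun j n => by
    simp only [hF]; split_ifs <;> positivity
  have hle : ∀ n, 1 ≤ n → ‖sievedPart g (blockIndex n) n‖ ^ r ≤ F (blockIndex n) n := by
    intro n hn
    have hτ : (1 : ℝ) ≤ n.divisors.card := by exact_mod_cast Nat.one_le_card_divisors hn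
    simp only [hF, sievedPart]
    split_ifs
    · calc ‖g n‖ ^ r ≤ ((n.divisors.card : ℝ) ^ C) ^ r :=
            Real.rpow_le_rpow (norm_nonneg _) (hC n hn) (by linarith)
        _ = (n.divisors.card : ℝ) ^ (C * r) := by
            rw [← Real.rpow_natCast, ← Real.rpow_mul (by positivity)]
        _ ≤ (n.divisors.card : ℝ) ^ (B : ℝ) := Real.rpow_le_rpow_of_exponent_le hτ (Nat.le_ceil _)
        _ = _ := Real.rpow_natCast _ _
    · rw [norm_zero, Real.zero_rpow (by linarith)]
  have key := hK F (fun j n hn => ?_) (fun j N y hN1 hN2 hy => ?_) ⌊N⌋₊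
    (Nat.le_floor (by norm_num; linarith))
  · rw [Finset.expect_eq_sum_div_card, card_natInterval, div_le_iff₀ hpos]
    calc _ ≤ ∑ n ∈ Finset.Icc 1 ⌊N⌋₊, F (blockIndex n) n :=
          Finset.sum_le_sum fun n hn => hle n (Finset.mem_Icc.1 hn).1
      _ ≤ _ := (Real.le_norm_self _).trans key
      _ ≤ ⌊N⌋₊ * (|K| * (K₂ * Real.log N ^ (-1 + (√(Real.log (Real.log N)))⁻¹))) := by
          gcongr
          · exact le_abs_self K
          · exact h₂ N hN
      _ = _ := by ring
  · rw [Real.norm_of_nonneg (hF0 j n)]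
    simp only [hF]
    split_ifs
    · exact le_rfl
    · positivity
  · rw [Real.norm_of_nonneg (Finset.sum_nonneg fun n _ => hF0 j n)]
    calc _ ≤ ∑ n ∈ Finset.Icc 1 N, F j n :=
          Finset.sum_le_sum_of_subset_of_nonneg (Finset.Icc_subset_Icc_right hy) fun n _ _ => hF0 j n
      _ ≤ N * (K₁ * ((j : ℝ) + 1) ^ E / 2 ^ j) := by
          rw [← Finset.sum_filter]; exact h₁ j N hN1 hN2
      _ = _ := by rw [mul_div_assoc]

end

theorem tendsto_inv_sqrt_log_log :
    Filter.Tendsto (fun N : ℝ => (√(Real.log (Real.log N)))⁻¹) Filter.atTop (nhds 0) :=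
  tendsto_inv_atTop_zero.comp (Real.tendsto_sqrt_atTop.comp
    (Real.tendsto_log_atTop.comp Real.tendsto_log_atTop))

theorem mainTheorem7 (g : ArithmeticFunction ℂ) (hmul : g.IsMultiplicative)
    (hSW : SiegelWalfisz (fun n => g n)) :
    ∃ g₁ g₂ : ArithmeticFunction ℂ,
      g = g₁ + g₂ ∧
      (∀ n : ℕ, ‖g₁ n‖ ≤ ‖g n‖) ∧
      (∀ n : ℕ, ‖g₂ n‖ ≤ ‖g n‖) ∧
      (∀ k : ℕ, 1 ≤ k → ∀ A : ℝ, 0 < A → ∃ K : ℝ, ∀ N : ℝ, 3 ≤ N →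
        uNorm k N (fun n => g₁ n) ≤ K * Real.log N ^ (-A)) ∧
      (∃ c : ℝ → ℝ, Filter.Tendsto c Filter.atTop (nhds 0) ∧
        ∀ r : ℝ, 1 ≤ r → ∃ K : ℝ, ∀ N : ℝ, 3 ≤ N →
          (𝔼 n ∈ natInterval N, ‖g₂ n‖ ^ r) ≤ K * Real.log N ^ (-1 + c N)) := by
  refine ⟨⟨fun n => windowPart g (blockIndex n) n, by simp [windowPart]⟩,
    ⟨fun n => sievedPart g (blockIndex n) n, by simp [sievedPart]⟩, ?_, fun n => ?_, fun n => ?_,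
    fun k _ A _ => uNorm_windowPart_le hmul hSW k, _, tendsto_inv_sqrt_log_log,
    fun r hr => expect_norm_sievedPart_rpow_le hSW hr⟩
  · ext n
    exact (windowPart_add_sievedPart g _ n).symm
  · change ‖windowPart g (blockIndex n) n‖ ≤ _
    unfold windowPart
    split_ifs <;> simp
  · change ‖sievedPart g (blockIndex n) n‖ ≤ _
    unfold sievedPart
    split_ifs <;> simp
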